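/- Let $\mathfrak g=\mathfrak g(E_6^{(1)})$ be the complex Lie algebra generated by $e_i,f_i,\alpha_i^\vee$ $(0\le i\le 6)$ and $d$ with relations, for all $i,j$, $(\mathrm{ad}\,e_i)^{1-a_{ij}}e_j=(\mathrm{ad}\,f_i)^{1-a_{ij}}f_j=0$ $(i\ne j)$, $[\alpha_i^\vee,\alpha_j^\vee]=0$, $[\alpha_i^\vee,e_j]=a_{ij}e_j$, $[\alpha_i^\vee,f_j]=-a_{ij}f_j$, $[e_i,f_j]=\delta_{ij}\alpha_i^\vee$, $[d,\alpha_i^\vee]=0$, $[d,e_i]=\delta_{i0}e_0$, $[d,f_i]=-\delta_{i0}f_0$, where $(a_{ij})$ is the Cartan matrix with $a_{ii}=2$, $a_{ij}=a_{ji}=-1$ for $\{i,j\}=\{1,2\},\{2,3\},\{3,4\},\{4,5\},\{3,6\},\{6,0\}$, and all other entries $0$. Let $\mathfrak h=\bigoplus_i\mathbb C\alpha_i^\vee\oplus\mathbb Cd$, with the form $(\alpha_i^\vee|\alpha_j^\vee)=a_{ij}$, $(d|\alpha_j^\vee)=\delta_{0j}$, $(d|d)=0$, and let $\mathfrak b_+=\mathfrak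 h\oplus\mathfrak n_+$, with $\mathfrak n_+$ generated by the $e_i$. Write $e_{i_1\cdots i_nj}=\mathrm{ad}\,e_{i_1}\cdots\mathrm{ad}\,e_{i_n}(e_j)$. Let $\vartheta\in\mathfrak h$ satisfy $(\vartheta|\alpha_i^\vee)=0$ for $i=2,4,6$ and $=1$ for $i=0,1,3,5$, and put $\mathfrak g_k=\{x\in\mathfrak g: [\vartheta,x]=kx\}$ (the gradation of type $(1,1,0,1,0,1,0)$). Let $$\Lambda_1=e_1+2e_3+e_5+e_{21}+e_{60}+e_{23}+e_{43}+e_{63}+e_{234}+e_{236}+e_{436}+2e_{6234},$$ $$\Lambda_2=2e_0-2e_3-2e_5-2e_{21}-2e_{45}+2e_{23}+2e_{43}-7e_{63}-4e_{234}+5e_{236}-4e_{436}-2e_{6234}.$$ *First gauge.* Let $\Gamma_1$ be a holomorphic function on an open set $T\subset\mathbb C^2$ of times $(t_1,t_2)$, with values in $\mathfrak g_0\cap\mathfrak b_+=\mathfrak h\oplus\mathbb Ce_2\oplus\mathbb Ce_4\oplus\mathbb Ce_6$, such that on $T$ $$e^{\mathrm{ad}\,\Gamma_1}(-t_1\Lambda_1-t_2\Lambda_2)=\sum_{i=0,1,3,5}c_ie_i+e_{21}+e_{45}+e_{60}+e_{23}+e_{43}+c_{63}e_{63}+e_{234}$$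 for some functions $c_0,c_1,c_3,c_5,c_{63}$ of $(t_1,t_2)$. Put $s_1=\frac{c_{63}(1+c_3-c_0c_{63})}{6}$, $s_2=\frac{c_{63}(1+c_1)(1+c_5)}{6}$, and let $s\mapsto t(s)\in T$ be a holomorphic curve, over a nonempty open set $U\subset\mathbb C\setminus\{0,1\}$, with $s_1(t(s))=s$ and $s_2(t(s))=1$. The $c$'s are evaluated along it. *The reduced system.* Fix $\kappa\in\mathfrak h$. For functions $\lambda_i,\mu_i$ $(i=2,4,6)$ on $U$ let $\Gamma_2=\sum_{i=2,4,6}\lambda_if_i$ and $$\mathcal M^+=\kappa+\sum_{i=2,4,6}\mu_ie_i+(c_0+\lambda_6)e_0+(c_1+\lambda_2)e_1+(c_3+\lambda_2+\lambda_4+c_{63}\lambda_6-\lambda_2\lambda_4)e_3+(c_5+\lambda_4)e_5$$ $$\qquad+e_{21}+e_{45}+e_{60}+(1-\lambda_4)e_{23}+(1-\lambda_2)e_{43}+c_{63}e_{63}+e_{234}.$$ The similarity reduction of the Drinfeld–Sokolov hierarchy is $[\partial_1-B_1,\partial_2-B_2]=0$, $[\partial_k-B_k,\mathcal M]=0$ $(k=1,2)$,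 where $\mathcal M=\vartheta-t_1B_1-t_2B_2$, $B_k=U_k+\Lambda_k$, $U_k\in\bigoplus_{i=0}^6\mathbb C\alpha_i^\vee\oplus\bigoplus_{i=2,4,6}(\mathbb Ce_i\oplus\mathbb Cf_i)$; the degree one part of the first equation is $[\Lambda_1,U_2]=[\Lambda_2,U_1]$. The functions $(\lambda,\mu)$ solve the *reduced system* if, at every $s\in U$, there are $U_1,U_2$ as above with $[\Lambda_1,U_2]=[\Lambda_2,U_1]$ such that the gauge transformation by $e^{\mathrm{ad}\,\Gamma_2}e^{\mathrm{ad}\,\Gamma_1}$ takes $\mathcal M$ to $\mathcal M^+$ and takes $\frac{d}{ds}-\sum_kB_k\frac{dt_k}{ds}$ to $\frac d{ds}-\mathcal B^+$ with $\mathcal B^+\in\mathfrak b_+$, and, with $B=s(s-1)\mathcal B^+$, $$\Big[s(s-1)\frac{d}{ds}-B,\ \mathcal M^+\Big]=0.$$ *The coupled Painlevé VI system.* Let, with $\beta_2=\frac{1-\beta_0-\beta_1-\beta_3-\beta_4}{2}$, $$H_{\mathrm{VI}}(p,q,s;\beta_0,\beta_1,\beta_3,\beta_4)=q(q-1)(q-s)p^2-\{(\beta_1-1)q(q-1)+\beta_3q(q-s)+\beta_4(q-1)(q-s)\}p+\beta_2(\beta_0+\beta_2)q,$$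 $$H=H_{\mathrm{VI}}(p_1,q_1,s;\alpha_3,1-\alpha_1-2\alpha_2-2\alpha_3,\alpha_1,\alpha_3)+H_{\mathrm{VI}}(p_2,q_2,s;\alpha_3,1-2\alpha_3-2\alpha_4-\alpha_5,\alpha_5,\alpha_3)$$ $$+H_{\mathrm{VI}}(p_3,q_3,s;\alpha_3,1-\alpha_0-2\alpha_3-2\alpha_6,\alpha_0,\alpha_3)+\sum_{1\le i<j\le3}\{(q_i-1)p_i+\alpha_{2i}\}\{(q_j-1)p_j+\alpha_{2j}\}(q_iq_j+s).$$ The system is $s(s-1)\frac{dq_i}{ds}=\{H,q_i\}$, $s(s-1)\frac{dp_i}{ds}=\{H,p_i\}$ $(i=1,2,3)$, where $\{p_i,q_j\}=\delta_{ij}$, $\{p_i,p_j\}=\{q_i,q_j\}=0$, with constant parameters satisfying $\alpha_0+\alpha_1+2\alpha_2+3\alpha_3+2\alpha_4+\alpha_5+2\alpha_6=1$. *Theorem.* Put $\alpha_i=(\kappa|\alpha_i^\vee)/6$ and $$q_1=\frac{1-\lambda_2}{1+c_1},\quad q_2=\frac{1-\lambda_4}{1+c_5},\quad q_3=\frac{1+c_3-c_0c_{63}}{1+c_3+c_{63}\lambda_6},\quad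 p_1=-\frac{(1+c_1)\mu_2}{6},\quad p_2=-\frac{(1+c_5)\mu_4}{6},$$ $$p_3=-\frac{(1+c_3+c_{63}\lambda_6)\{(1+c_3+c_{63}\lambda_6)\mu_6+c_{63}(\kappa|\alpha_6^\vee)\}}{6c_{63}(1+c_3-c_0c_{63})}.$$ For every $s\in U$ the map $(\lambda_2,\lambda_4,\lambda_6,\mu_2,\mu_4,\mu_6)\mapsto(q_1,q_2,q_3,p_1,p_2,p_3)$ is a bijection from $\{1+c_3+c_{63}\lambda_6\ne0\}$ onto $\{q_3\ne0\}$. Moreover, for all functions $\lambda_i,\mu_i$ on $U$ with $1+c_3+c_{63}\lambda_6\ne0$ on $U$: $(\lambda,\mu)$ solves the reduced system on $U$ if and only if $\alpha_0+\alpha_1+2\alpha_2+3\alpha_3+2\alpha_4+\alpha_5+2\alpha_6=1$ and $(q,p)$ solves the coupled Painlevé VI system on $U$. -/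

import Mathlib

namespace E6Painleve

/-! ## The affine Lie algebra of type `E₆⁽¹⁾`, by generators and relations -/

/-- The generalized Cartan matrix of type `E₆⁽¹⁾`, rows and columns indexed by `0, …, 6`. -/
def cartanMatrix : Matrix (Fin 7) (Fin 7) ℤ :=
  !![ 2,  0,  0,  0,  0,  0, -1;
      0,  2, -1,  0,  0,  0,  0;
      0, -1,  2, -1,  0,  0,  0;
      0,  0, -1,  2, -1,  0, -1;
      0,  0,  0, -1,  2, -1,  0;
      0,  0,  0,  0, -1,  2,  0;
     -1,  0,  0, -1,  0,  0,  2]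

/-- Symbols for the Chevalley generators `e_i`, `f_i`, `α_i^∨` and the scaling element `d`. -/
inductive Gen
  | e (i : Fin 7)
  | f (i : Fin 7)
  | h (i : Fin 7)
  | d

/-- The free complex Lie algebra on the generators. -/
abbrev FreeG : Type := FreeLieAlgebra ℂ Gen

/-- A generator, as an element of the free Lie algebra. -/
noncomputable def gen (x : Gen) : FreeG := FreeLieAlgebra.of ℂ x

/-- The fundamental relations (each element `r` of the set stands for the relation `r = 0`). -/
inductive Relator : FreeG → Prop
  | serre_e (i j : Fin 7) (hij : i ≠ j) :
      Relator (((LieAlgebra.ad ℂ FreeG (gen (.e i))) ^ (1 - cartanMatrix i j).toNat) (gen (.e j)))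
  | serre_f (i j : Fin 7) (hij : i ≠ j) :
      Relator (((LieAlgebra.ad ℂ FreeG (gen (.f i))) ^ (1 - cartanMatrix i j).toNat) (gen (.f j)))
  | h_h (i j : Fin 7) : Relator ⁅gen (.h i), gen (.h j)⁆
  | h_e (i j : Fin 7) :
      Relator (⁅gen (.h i), gen (.e j)⁆ - (cartanMatrix i j : ℂ) • gen (.e j))
  | h_f (i j : Fin 7) :
      Relator (⁅gen (.h i), gen (.f j)⁆ + (cartanMatrix i j : ℂ) • gen (.f j))
  | e_f (i j : Fin 7) :
      Relator (⁅gen (.e i), gen (.f j)⁆ - (if i = j then (1 : ℂ) else 0) • gen (.h i))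
  | d_h (i : Fin 7) : Relator ⁅gen .d, gen (.h i)⁆
  | d_e (i : Fin 7) :
      Relator (⁅gen .d, gen (.e i)⁆ - (if i = 0 then (1 : ℂ) else 0) • gen (.e i))
  | d_f (i : Fin 7) :
      Relator (⁅gen .d, gen (.f i)⁆ + (if i = 0 then (1 : ℂ) else 0) • gen (.f i))

/-- The ideal generated by the fundamental relations. -/
noncomputable def relIdeal : LieIdeal ℂ FreeG := LieSubmodule.lieSpan ℂ FreeG {r | Relator r}

/-- The affine Lie algebra `𝔤 = 𝔤(E₆⁽¹⁾)`. -/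
abbrev AffE6 : Type := FreeG ⧸ relIdeal

/-- The Chevalley generator `e_i`. -/
noncomputable def e (i : Fin 7) : AffE6 := LieSubmodule.Quotient.mk (gen (.e i))

/-- The Chevalley generator `f_i`. -/
noncomputable def f (i : Fin 7) : AffE6 := LieSubmodule.Quotient.mk (gen (.f i))

/-- The simple coroot `α_i^∨`. -/
noncomputable def coroot (i : Fin 7) : AffE6 := LieSubmodule.Quotient.mk (gen (.h i))

/-- The scaling element `d`. -/
noncomputable def scal : AffE6 := LieSubmodule.Quotient.mk (gen .d)

/-- `word [i₁, …, iₙ, j] = ad e_{i₁} ⋯ ad e_{iₙ} (e_j)`, written `e_{i₁ ⋯ iₙ j}`. -/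
noncomputable def word : List (Fin 7) → AffE6
  | [] => 0
  | [j] => e j
  | i :: j :: l => ⁅e i, word (j :: l)⁆

/-- The Cartan subalgebra `𝔥 = ⨁ ℂ α_i^∨ ⊕ ℂ d` in coordinates: `(x, y)` stands for
`∑ x_i α_i^∨ + y d`. -/
abbrev Cartan : Type := (Fin 7 → ℂ) × ℂ

/-- The element of `𝔤` with given coordinates in `𝔥`. -/
noncomputable def Cartan.toG (x : Cartan) : AffE6 := ∑ i, x.1 i • coroot i + x.2 • scal

/-- `α_i^∨` in coordinates. -/
def Cartan.coroot (i : Fin 7) : Cartan := (Pi.single i 1, 0)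

/-- The normalized invariant form on `𝔥`: `(α_i^∨|α_j^∨) = a_{ij}`, `(d|α_j^∨) = δ_{0j}`,
`(d|d) = 0`. -/
def Cartan.form (x y : Cartan) : ℂ :=
  ∑ i, ∑ j, (cartanMatrix i j : ℂ) * x.1 i * y.1 j + x.2 * y.1 0 + x.1 0 * y.2

/-- The Borel subalgebra `𝔟₊ = 𝔥 ⊕ 𝔫₊`, with `𝔫₊` the subalgebra generated by the `e_i`. -/
noncomputable def borel : Submodule ℂ AffE6 :=
  Submodule.span ℂ (Set.range Cartan.toG) ⊔
    (LieSubalgebra.lieSpan ℂ AffE6 (Set.range e)).toSubmodule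

/-- The nodes `2, 4, 6`. -/
def node : Fin 3 → Fin 7 := ![2, 4, 6]

/-- `ϑ ∈ 𝔥` defines the gradation of type `(1,1,0,1,0,1,0)`. -/
def IsGrading (θ : Cartan) : Prop :=
  (∀ i ∈ ({2, 4, 6} : Set (Fin 7)), θ.form (Cartan.coroot i) = 0) ∧
    ∀ i ∈ ({0, 1, 3, 5} : Set (Fin 7)), θ.form (Cartan.coroot i) = 1

noncomputable def Λ₁ : AffE6 :=
  e 1 + (2 : ℂ) • e 3 + e 5 + word [2, 1] + word [6, 0] + word [2, 3] + word [4, 3] + word [6, 3]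
    + word [2, 3, 4] + word [2, 3, 6] + word [4, 3, 6] + (2 : ℂ) • word [6, 2, 3, 4]

noncomputable def Λ₂ : AffE6 :=
  (2 : ℂ) • e 0 - (2 : ℂ) • e 3 - (2 : ℂ) • e 5 - (2 : ℂ) • word [2, 1] - (2 : ℂ) • word [4, 5]
    + (2 : ℂ) • word [2, 3] + (2 : ℂ) • word [4, 3] - (7 : ℂ) • word [6, 3]
    - (4 : ℂ) • word [2, 3, 4] + (5 : ℂ) • word [2, 3, 6] - (4 : ℂ) • word [4, 3, 6]
    - (2 : ℂ) • word [6, 2, 3, 4]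

/-! ## Calculus in `𝔤`

`𝔤` carries no topology. All functions and series below live in finite-dimensional subspaces, where
convergence and differentiability may be tested against all linear functionals. -/

/-- `y = exp(ad Γ) x`. -/
def IsExpAd (Γ x y : AffE6) : Prop :=
  ∀ φ : Module.Dual ℂ AffE6,
    HasSum (fun n : ℕ => φ (((n.factorial : ℂ)⁻¹) • ((LieAlgebra.ad ℂ AffE6 Γ) ^ n) x)) (φ y)

/-- The `𝔤`-valued function `F` has derivative `F'` at `s`. -/
def HasDerivG (F : ℂ → AffE6) (F' : AffE6) (s : ℂ) : Prop :=
  ∀ φ : Module.Dual ℂ AffE6, HasDerivAt (fun z => φ (F z)) (φ F') s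

/-- The terms of `exp(ad Γ)(∂ - B) = ∂ - ∑ₙ gaugeTerm Γ Γ' B n`, where `∂` is the derivation along
the parameter and `Γ' = ∂Γ`: since `[Γ, ∂] = -Γ'`, one has
`(ad Γ)^(n+1) (∂ - B) = -(ad Γ)^n (Γ' + [Γ, B])`. -/
noncomputable def gaugeTerm (Γ Γ' B : AffE6) : ℕ → AffE6
  | 0 => B
  | n + 1 => (((n + 1).factorial : ℂ)⁻¹) • ((LieAlgebra.ad ℂ AffE6 Γ) ^ n) (Γ' + ⁅Γ, B⁆)

/-- `∂ - B⁺ = exp(ad Γ)(∂ - B)`, where `Γ' = ∂Γ`. -/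
def IsGaugeTransform (Γ Γ' B Bplus : AffE6) : Prop :=
  ∀ φ : Module.Dual ℂ AffE6, HasSum (fun n : ℕ => φ (gaugeTerm Γ Γ' B n)) (φ Bplus)

/-! ## The first gauge transformation -/

/-- The coefficients `c₀, c₁, c₃, c₅, c₆₃`. -/
structure Coeffs where
  c0 : ℂ
  c1 : ℂ
  c3 : ℂ
  c5 : ℂ
  c63 : ℂ

/-- The normal form of the degree one part `𝓜₁ = -t₁Λ₁ - t₂Λ₂`. -/
noncomputable def Coeffs.normalForm (c : Coeffs) : AffE6 :=
  c.c0 • e 0 + c.c1 • e 1 + c.c3 • e 3 + c.c5 • e 5 + word [2, 1] + word [4, 5] + word [6, 0]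
    + word [2, 3] + word [4, 3] + c.c63 • word [6, 3] + word [2, 3, 4]

noncomputable def Coeffs.s₁ (c : Coeffs) : ℂ := c.c63 * (1 + c.c3 - c.c0 * c.c63) / 6

noncomputable def Coeffs.s₂ (c : Coeffs) : ℂ := c.c63 * (1 + c.c1) * (1 + c.c5) / 6

/-- A holomorphic function `Γ₁`, on a domain `T` of the times `(t₁, t₂)`, with values in
`𝔤₀ ∩ 𝔟₊ = 𝔥 ⊕ ℂe₂ ⊕ ℂe₄ ⊕ ℂe₆`, such that `exp(ad Γ₁)` brings `𝓜₁` to its normal form, together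
with the coefficients of the latter. -/
structure FirstGauge where
  T : Set (ℂ × ℂ)
  isOpen_T : IsOpen T
  η : ℂ × ℂ → Cartan
  ν : ℂ × ℂ → Fin 3 → ℂ
  differentiableOn_η : DifferentiableOn ℂ η T
  differentiableOn_ν : DifferentiableOn ℂ ν T
  c : ℂ × ℂ → Coeffs
  normalize : ∀ t ∈ T,
    IsExpAd ((η t).toG + ∑ i, ν t i • e (node i)) (-(t.1 • Λ₁) - t.2 • Λ₂) (c t).normalForm

/-- The `𝔤₀ ∩ 𝔟₊`-valued function `Γ₁`. -/
noncomputable def FirstGauge.Γ₁ (G : FirstGauge) (t : ℂ × ℂ) : AffE6 :=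
  (G.η t).toG + ∑ i, G.ν t i • e (node i)

/-- `γ` is the parametrization of the curve `s₂ = 1` by `s = s₁`, over the set `U`. -/
structure IsSlice (G : FirstGauge) (U : Set ℂ) (γ : ℂ → ℂ × ℂ) : Prop where
  differentiableOn : DifferentiableOn ℂ γ U
  mem : ∀ s ∈ U, γ s ∈ G.T
  s₁_eq : ∀ s ∈ U, (G.c (γ s)).s₁ = s
  s₂_eq : ∀ s ∈ U, (G.c (γ s)).s₂ = 1

/-! ## The reduced system -/

/-- Coordinates of an element `∑ u_i α_i^∨ + ∑_{i=2,4,6} x_i e_i + ∑_{i=2,4,6} y_i f_i` of `𝔤₀`. -/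
structure DegZero where
  u : Fin 7 → ℂ
  x : Fin 3 → ℂ
  y : Fin 3 → ℂ

noncomputable def DegZero.toG (V : DegZero) : AffE6 :=
  ∑ i, V.u i • coroot i + ∑ i, V.x i • e (node i) + ∑ i, V.y i • f (node i)

/-- The second gauge parameter `Γ₂ = λ₂ f₂ + λ₄ f₄ + λ₆ f₆`. -/
noncomputable def Γ₂ (lam : Fin 3 → ℂ) : AffE6 := ∑ i, lam i • f (node i)

/-- The operator `𝓜⁺`, with `lam = (λ₂, λ₄, λ₆)` and `mu = (μ₂, μ₄, μ₆)`. -/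
noncomputable def Mplus (c : Coeffs) (κ : Cartan) (lam mu : Fin 3 → ℂ) : AffE6 :=
  κ.toG + ∑ i, mu i • e (node i) + (c.c0 + lam 2) • e 0 + (c.c1 + lam 0) • e 1
    + (c.c3 + lam 0 + lam 1 + c.c63 * lam 2 - lam 0 * lam 1) • e 3 + (c.c5 + lam 1) • e 5
    + word [2, 1] + word [4, 5] + word [6, 0] + (1 - lam 1) • word [2, 3]
    + (1 - lam 0) • word [4, 3] + c.c63 • word [6, 3] + word [2, 3, 4]

/-- `B` is the operator of the reduced system at `s`, attached to `𝓜⁺`.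

There are `B_k = U_k + Λ_k` with `U_k ∈ 𝔤₀` (`k = 1, 2`) satisfying the degree one part
`[Λ₁, U₂] = [Λ₂, U₁]` of the zero curvature equation `[∂₁ - B₁, ∂₂ - B₂] = 0`, such that the gauge
transformation by `Γ₁` followed by the one by `Γ₂` takes `𝓜 = ϑ - t₁ B₁ - t₂ B₂` to `𝓜⁺`, and takes
`d/ds - (B₁ dt₁/ds + B₂ dt₂/ds)` along the curve `t = γ(s)` to `d/ds - 𝓑⁺`, where `𝓑⁺` takes its
value in `𝔟₊`; and `B = s(s-1)𝓑⁺`. -/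
def IsReducedOperator (θ : Cartan) (G : FirstGauge) (γ : ℂ → ℂ × ℂ) (κ : Cartan)
    (lam mu : ℂ → Fin 3 → ℂ) (s : ℂ) (B : AffE6) : Prop :=
  ∃ (U₁ U₂ : DegZero) (t' : ℂ × ℂ) (dΓ₁ dΓ₂ Mstar Bstar Bplus : AffE6),
    HasDerivAt γ t' s ∧
    ⁅Λ₁, U₂.toG⁆ - ⁅Λ₂, U₁.toG⁆ = 0 ∧
    IsExpAd (G.Γ₁ (γ s))
      (θ.toG - (γ s).1 • (U₁.toG + Λ₁) - (γ s).2 • (U₂.toG + Λ₂)) Mstar ∧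
    IsExpAd (Γ₂ (lam s)) Mstar (Mplus (G.c (γ s)) κ (lam s) (mu s)) ∧
    HasDerivG (fun z => G.Γ₁ (γ z)) dΓ₁ s ∧
    IsGaugeTransform (G.Γ₁ (γ s)) dΓ₁ (t'.1 • (U₁.toG + Λ₁) + t'.2 • (U₂.toG + Λ₂)) Bstar ∧
    HasDerivG (fun z => Γ₂ (lam z)) dΓ₂ s ∧
    IsGaugeTransform (Γ₂ (lam s)) dΓ₂ Bstar Bplus ∧
    Bplus ∈ borel ∧
    B = (s * (s - 1)) • Bplus

/-- The ordinary differential system `[s(s-1) d/ds - B, 𝓜⁺] = 0` on `U`, for the dependent variables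
`λ_i, μ_i` (`i = 2, 4, 6`), with the constant parameter `κ ∈ 𝔥`. -/
def ReducedODE (θ : Cartan) (G : FirstGauge) (γ : ℂ → ℂ × ℂ) (κ : Cartan) (U : Set ℂ)
    (lam mu : ℂ → Fin 3 → ℂ) : Prop :=
  ∀ s ∈ U, ∃ B M' : AffE6,
    IsReducedOperator θ G γ κ lam mu s B ∧
    HasDerivG (fun z => Mplus (G.c (γ z)) κ (lam z) (mu z)) M' s ∧
    (s * (s - 1)) • M' - ⁅B, Mplus (G.c (γ s)) κ (lam s) (mu s)⁆ = 0

/-! ## The coupled Painlevé VI system -/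

/-- The Painlevé VI Hamiltonian; `β₂` is determined by `β₀ + β₁ + 2β₂ + β₃ + β₄ = 1`. -/
noncomputable def hVI (p q s β₀ β₁ β₃ β₄ : ℂ) : ℂ :=
  let β₂ := (1 - β₀ - β₁ - β₃ - β₄) / 2
  q * (q - 1) * (q - s) * p ^ 2
    - ((β₁ - 1) * q * (q - 1) + β₃ * q * (q - s) + β₄ * (q - 1) * (q - s)) * p
    + β₂ * (β₀ + β₂) * q

/-- The coupled Hamiltonian, with `q = (q₁, q₂, q₃)` and `p = (p₁, p₂, p₃)`. -/
noncomputable def coupledH (α : Fin 7 → ℂ) (s : ℂ) (q p : Fin 3 → ℂ) : ℂ :=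
  hVI (p 0) (q 0) s (α 3) (1 - α 1 - 2 * α 2 - 2 * α 3) (α 1) (α 3)
    + hVI (p 1) (q 1) s (α 3) (1 - 2 * α 3 - 2 * α 4 - α 5) (α 5) (α 3)
    + hVI (p 2) (q 2) s (α 3) (1 - α 0 - 2 * α 3 - 2 * α 6) (α 0) (α 3)
    + ∑ i : Fin 3, ∑ j ∈ Finset.Ioi i,
        ((q i - 1) * p i + α (node i)) * ((q j - 1) * p j + α (node j)) * (q i * q j + s)

/-- `∂F/∂q_i`. -/
noncomputable def dq (i : Fin 3) (F : (Fin 3 → ℂ) → (Fin 3 → ℂ) → ℂ) (q p : Fin 3 → ℂ) : ℂ :=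
  deriv (fun z => F (Function.update q i z) p) (q i)

/-- `∂F/∂p_i`. -/
noncomputable def dp (i : Fin 3) (F : (Fin 3 → ℂ) → (Fin 3 → ℂ) → ℂ) (q p : Fin 3 → ℂ) : ℂ :=
  deriv (fun z => F q (Function.update p i z)) (p i)

/-- The Poisson bracket with `{p_i, q_j} = δ_{ij}`, `{p_i, p_j} = {q_i, q_j} = 0`. -/
noncomputable def poisson (F K : (Fin 3 → ℂ) → (Fin 3 → ℂ) → ℂ) (q p : Fin 3 → ℂ) : ℂ :=
  ∑ i, (dp i F q p * dq i K q p - dq i F q p * dp i K q p)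

/-- The parameters satisfy `α₀ + α₁ + 2α₂ + 3α₃ + 2α₄ + α₅ + 2α₆ = 1` and `(q, p)` solves
`s(s-1) dq_i/ds = {H, q_i}`, `s(s-1) dp_i/ds = {H, p_i}` (`i = 1, 2, 3`) on `U`. -/
def CoupledPVI (α : Fin 7 → ℂ) (U : Set ℂ) (q p : ℂ → Fin 3 → ℂ) : Prop :=
  α 0 + α 1 + 2 * α 2 + 3 * α 3 + 2 * α 4 + α 5 + 2 * α 6 = 1 ∧
  ∀ s ∈ U, ∀ i,
    DifferentiableAt ℂ (fun z => q z i) s ∧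
    DifferentiableAt ℂ (fun z => p z i) s ∧
    s * (s - 1) * deriv (fun z => q z i) s
      = poisson (coupledH α s) (fun q' _ => q' i) (q s) (p s) ∧
    s * (s - 1) * deriv (fun z => p z i) s
      = poisson (coupledH α s) (fun _ p' => p' i) (q s) (p s)

/-! ## The change of variables -/

/-- `α_i = (κ|α_i^∨)/6`. -/
noncomputable def param (κ : Cartan) (i : Fin 7) : ℂ := κ.form (Cartan.coroot i) / 6

/-- `(q₁, q₂, q₃)` in terms of `(λ₂, λ₄, λ₆)`. -/
noncomputable def qVar (c : Coeffs) (lam : Fin 3 → ℂ) : Fin 3 → ℂ :=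
  ![(1 - lam 0) / (1 + c.c1),
    (1 - lam 1) / (1 + c.c5),
    (1 + c.c3 - c.c0 * c.c63) / (1 + c.c3 + c.c63 * lam 2)]

/-- `(p₁, p₂, p₃)` in terms of `(λ₂, λ₄, λ₆)` and `(μ₂, μ₄, μ₆)`. -/
noncomputable def pVar (c : Coeffs) (κ : Cartan) (lam mu : Fin 3 → ℂ) : Fin 3 → ℂ :=
  ![-((1 + c.c1) * mu 0) / 6,
    -((1 + c.c5) * mu 1) / 6,
    -((1 + c.c3 + c.c63 * lam 2)
        * ((1 + c.c3 + c.c63 * lam 2) * mu 2 + c.c63 * κ.form (Cartan.coroot 6)))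
      / (6 * c.c63 * (1 + c.c3 - c.c0 * c.c63))]

end E6Painleve

/-!
Write `𝔤₀`, `𝔤₁`, … for the components of the gradation defined by `ϑ`. Both gauge parameters have
degree zero, and everything that matters takes place in `𝔤₁`, which is spanned by fourteen root
vectors (`rootVec`). In these coordinates (`Deg1`) the adjoint action of `𝔤₀` is an explicit
`14 × 14` matrix (`act`) and both gauge transformations have closed forms: `raiseExp`, `torus` and
`lowerExp` are the exponentials of the `e_i`, of the Cartan subalgebra and of the `f_i`
(`i = 2, 4, 6`). The gauge series are never summed directly: a solution of `dY/dr = Γ' + [Γ, Y]` on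
a finite-dimensional subspace has the terms of the series as its Taylor coefficients
(`isGaugeTransform_of_hasDerivG`), so that exhibiting a solution (`GaugeFlow`) is enough.

An algebra given by generators and relations could be too small. That the coordinates are faithful
follows from the representation of `𝔤` on the loop module of the 27-dimensional minuscule
representation of `E₆`: the `e_i` act by nonzero operators (`e_ne_zero`), brackets with the `f_i` then
show that the root vectors are nonzero (`rootVec_ne_zero`), and these are separated by the
eigenvalues of one element of the Cartan subalgebra (`linearIndependent_posVec`). Likewise `e₂, e₄, e₆` and `𝔤₁` lie in `𝔟₊`, and no nonzero
combination of the `f_i` does (`eq_zero_of_mem_borel`).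

As `[Λ₁, Λ₂] = 0`, the image under the first gauge transformation of the velocity
`Λ₁ dt₁/ds + Λ₂ dt₂/ds` of the curve commutes with the normal form. On the slice `s₁ = s`, `s₂ = 1`
the normal form is, up to the torus, the vector `mVec`, whose centralizer in `𝔤₁` is spanned by
`mVec` and one further vector `kVec` (`Coeffs.OnSlice.exists_of_lie_eq_zero`). The second gauge
transformation only translates the coordinates `x, y, h` of `mVec` and `kVec`, and leads to
`x = q₁`, `y = q₂`, `h = s / q₃`. After this normalization the derivatives of the first gauge
transformation and of the degree one part of `𝓜⁺` are given by one and the same linear system in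
`𝔤₁`: fourteen equations for thirteen unknowns, solved successively in `normalized_imp`, with the
compatibility condition that a multiple of the level `∑ aᵢ^∨ αᵢ` be equal to `1`. For the first
gauge transformation, where `ϑ / 6` takes the place of `κ / 6`, this condition determines the
speed of the curve (`CurveAt.first_gauge`). For `𝓜⁺` it then says that
`α₀ + α₁ + 2α₂ + 3α₃ + 2α₄ + α₅ + 2α₆ = 1`, and the remaining equations are an explicit system of
ordinary differential equations for `x, y, h` and the `μ_i` (`CurveAt.linear_system_imp`), whose
vector field is that of the coupled Painlevé VI Hamiltonian (`dp_zero`, …, `dq_two`).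

It remains to compare the reduced system with the linear system. If the reduced system holds, the
condition `𝓑⁺ ∈ 𝔟₊` removes the `f_i`, the degree one part of `𝓑⁺` is the image of the velocity, and
comparing coordinates gives the linear system (`linear_system_of_reduced`). Conversely the solution of
the linear system determines the degree zero parts of `𝓜⁺` and `𝓑⁺`. Transporting these back
through the two gauge transformations, and using that the two times and their derivatives are
linearly independent (`det_ne_zero`), recovers `U₁` and `U₂`. The equation `[Λ₁, U₂] = [Λ₂, U₁]` is
the evolution of `𝓜⁺` in degree one, gauged back (`zero_curvature_of_gauge`), and the level condition
ensures that `U₁` and `U₂` have no component along `d` (`reduced_of_linear_system`).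
-/

set_option linter.unusedSimpArgs false

open Finset

namespace E6Painleve

/-! ### Weak derivatives and one-parameter flows -/

section Calculus

variable {F F₁ F₂ : ℂ → AffE6} {x x' y y' Γ Γ' Γ'' B : AffE6} {s : ℂ}

theorem eq_of_forall_dual (h : ∀ φ : Module.Dual ℂ AffE6, φ x = φ y) : x = y := by
  rw [← sub_eq_zero, ← Module.forall_dual_apply_eq_zero_iff ℂ]
  intro φ
  rw [map_sub, h φ, sub_self]

theorem HasDerivG.unique (h : HasDerivG F x s) (h' : HasDerivG F y s) : x = y :=
  eq_of_forall_dual fun φ => (h φ).unique (h' φ)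

theorem HasDerivG.add (h₁ : HasDerivG F₁ x s) (h₂ : HasDerivG F₂ y s) :
    HasDerivG (fun z => F₁ z + F₂ z) (x + y) s := fun φ =>
  ((h₁ φ).add (h₂ φ)).congr_deriv (map_add φ x y).symm |>.congr_of_eventuallyEq
    (.of_forall fun _ => map_add φ _ _)

theorem HasDerivG.const_smul (c : ℂ) (h : HasDerivG F x s) :
    HasDerivG (fun z => c • F z) (c • x) s := fun φ => by
  simpa using (h φ).const_mul c

theorem hasDerivG_const (x : AffE6) (s : ℂ) : HasDerivG (fun _ => x) 0 s := fun φ => by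
  simpa using hasDerivAt_const s (φ x)

theorem hasDerivG_linear {V : Type*} [NormedAddCommGroup V] [NormedSpace ℂ V]
    [FiniteDimensional ℂ V] (T : V →ₗ[ℂ] AffE6) {v : ℂ → V} {v' : V} (hv : HasDerivAt v v' s) :
    HasDerivG (fun z => T (v z)) (T v') s := fun φ =>
  (LinearMap.toContinuousLinearMap (φ.comp T)).hasFDerivAt.comp_hasDerivAt s hv

theorem hasDerivG_bilinear {V W : Type*} [NormedAddCommGroup V] [NormedSpace ℂ V]
    [FiniteDimensional ℂ V] [NormedAddCommGroup W] [NormedSpace ℂ W] [FiniteDimensional ℂ W]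
    (S : V →ₗ[ℂ] AffE6) (T : W →ₗ[ℂ] AffE6) {v : ℂ → V} {v' : V} {w : ℂ → W} {w' : W}
    (hv : HasDerivAt v v' s) (hw : HasDerivAt w w' s) :
    HasDerivG (fun z => ⁅S (v z), T (w z)⁆) (⁅S v', T (w s)⁆ + ⁅S (v s), T w'⁆) s := fun φ => by
  let b : V →ₗ[ℂ] W →ₗ[ℂ] ℂ :=
    LinearMap.mk₂ ℂ (fun v w => φ ⁅S v, T w⁆) (by simp) (by simp) (by simp) (by simp)
  have hb := IsBoundedBilinearMap.hasFDerivAt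
    (LinearMap.toContinuousBilinearMap b).isBoundedBilinearMap (v s, w s)
  have h := hb.comp_hasDerivAt (f := fun z => (v z, w z)) s (hv.prodMk hw)
  refine h.congr_deriv ?_
  simp [b, add_comm]

/-- `∂ - B⁺ = exp(ad Γ)(∂ - B)` determines `B⁺`. -/
theorem IsGaugeTransform.unique (h : IsGaugeTransform Γ Γ' B x) (h' : IsGaugeTransform Γ Γ' B y) :
    x = y :=
  eq_of_forall_dual fun φ => (h φ).unique (h' φ)

theorem isExpAd_iff : IsExpAd Γ x y ↔ IsGaugeTransform Γ 0 x y := by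
  have h (n : ℕ) : ((n.factorial : ℂ)⁻¹) • ((LieAlgebra.ad ℂ AffE6 Γ) ^ n) x =
      gaugeTerm Γ 0 x n := by
    cases n with
    | zero => simp [gaugeTerm]
    | succ n => simp [gaugeTerm, pow_succ]
  simp only [IsExpAd, IsGaugeTransform, h]

/-- If `dY/dr = Γ' + [Γ, Y]`, the terms of the gauge series are the Taylor coefficients at `0` of
the entire functions `φ ∘ Y`. -/
theorem isGaugeTransform_of_hasDerivG {Y : ℂ → AffE6} (hY : ∀ r, HasDerivG Y (Γ' + ⁅Γ, Y r⁆) r) :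
    IsGaugeTransform Γ Γ' (Y 0) (Y 1) := by
  intro φ
  have hder : ∀ (n : ℕ) (φ : Module.Dual ℂ AffE6),
      iteratedDeriv (n + 1) (fun r => φ (Y r)) =
        fun r => φ (((LieAlgebra.ad ℂ AffE6 Γ) ^ n) (Γ' + ⁅Γ, Y r⁆)) := by
    intro n
    induction n with
    | zero =>
      intro φ
      funext r
      simpa using (hY r φ).deriv
    | succ n ih =>
      intro φ
      funext r
      rw [iteratedDeriv_succ, ih]
      refine HasDerivAt.deriv ?_
      have h := hY r ((φ.comp ((LieAlgebra.ad ℂ AffE6 Γ) ^ n)).comp (LieAlgebra.ad ℂ AffE6 Γ))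
      have h' := h.const_add (φ (((LieAlgebra.ad ℂ AffE6 Γ) ^ n) Γ'))
      refine (h'.congr_deriv ?_).congr_of_eventuallyEq (.of_forall fun z => ?_)
      · simp [pow_succ]
      · simp
  have hd : Differentiable ℂ (fun r => φ (Y r)) := fun r => (hY r φ).differentiableAt
  have h := Complex.hasSum_taylorSeries_of_entire hd 0 1
  refine Eq.subst (motive := fun t => HasSum t (φ (Y 1))) (funext fun n => ?_) h
  cases n with
  | zero => simp [gaugeTerm]
  | succ n =>
    rw [hder n φ]
    simp [gaugeTerm, mul_add]

/-- There is a solution `Y` of `dY/dr = Γ' + [Γ, Y]`, with values in a finite-dimensional subspace,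
which joins `B` at time `0` to `B⁺` at time `1`. By `isGaugeTransform_of_hasDerivG`, this is a way of
producing gauge transforms without summing any series; `Γ' = 0` gives the flow
`r ↦ exp(r ad Γ) B`. -/
def GaugeFlow (Γ Γ' B Bplus : AffE6) : Prop :=
  ∃ Y : ℂ → AffE6, Y 0 = B ∧ Y 1 = Bplus ∧ (∀ r, HasDerivG Y (Γ' + ⁅Γ, Y r⁆) r) ∧
    ∃ F : Submodule ℂ AffE6, FiniteDimensional ℂ F ∧ ∀ r, Y r ∈ F

theorem GaugeFlow.isGaugeTransform (h : GaugeFlow Γ Γ' x y) : IsGaugeTransform Γ Γ' x y := by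
  obtain ⟨Y, rfl, rfl, hY, -⟩ := h
  exact isGaugeTransform_of_hasDerivG hY

/-- Solutions given by coordinates in a finite-dimensional space. -/
theorem GaugeFlow.of_linear {V : Type*} [NormedAddCommGroup V] [NormedSpace ℂ V]
    [FiniteDimensional ℂ V] (T : V →ₗ[ℂ] AffE6) {v v' : ℂ → V}
    (hv : ∀ r, HasDerivAt v (v' r) r) (h : ∀ r, T (v' r) = Γ' + ⁅Γ, T (v r)⁆) :
    GaugeFlow Γ Γ' (T (v 0)) (T (v 1)) :=
  ⟨fun r => T (v r), rfl, rfl, fun r => h r ▸ hasDerivG_linear T (hv r), LinearMap.range T,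
    inferInstance, fun r => ⟨v r, rfl⟩⟩

theorem GaugeFlow.isExpAd (h : GaugeFlow Γ 0 x y) : IsExpAd Γ x y :=
  isExpAd_iff.2 h.isGaugeTransform

theorem GaugeFlow.eq_of_isGaugeTransform (h : GaugeFlow Γ Γ' x y)
    (h' : IsGaugeTransform Γ Γ' x y') : y' = y :=
  h'.unique h.isGaugeTransform

theorem GaugeFlow.eq_of_isExpAd (h : GaugeFlow Γ 0 x y) (h' : IsExpAd Γ x y') : y' = y :=
  h.eq_of_isGaugeTransform (isExpAd_iff.1 h')

theorem GaugeFlow.add (h : GaugeFlow Γ Γ' x y) (h' : GaugeFlow Γ Γ'' x' y') :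
    GaugeFlow Γ (Γ' + Γ'') (x + x') (y + y') := by
  obtain ⟨Y, rfl, rfl, hY, F, hF, hYF⟩ := h
  obtain ⟨Z, rfl, rfl, hZ, F', hF', hZF⟩ := h'
  refine ⟨fun r => Y r + Z r, rfl, rfl, fun r => ?_, F ⊔ F', inferInstance, fun r =>
    Submodule.add_mem_sup (hYF r) (hZF r)⟩
  convert (hY r).add (hZ r) using 1
  rw [lie_add]; abel

theorem GaugeFlow.const_smul (c : ℂ) (h : GaugeFlow Γ Γ' x y) :
    GaugeFlow Γ (c • Γ') (c • x) (c • y) := by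
  obtain ⟨Y, rfl, rfl, hY, F, hF, hYF⟩ := h
  refine ⟨fun r => c • Y r, rfl, rfl, fun r => ?_, F, hF, fun r => F.smul_mem c (hYF r)⟩
  convert (hY r).const_smul c using 1
  rw [lie_smul, smul_add]

theorem GaugeFlow.of_lie_eq_zero (h : ⁅Γ, x⁆ = 0) : GaugeFlow Γ 0 x x :=
  ⟨fun _ => x, rfl, rfl, fun r => by simpa [h] using hasDerivG_const x r, ℂ ∙ x, inferInstance,
    fun _ => Submodule.mem_span_singleton_self x⟩

theorem GaugeFlow.symm (h : GaugeFlow Γ 0 x y) : GaugeFlow (-Γ) 0 y x := by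
  obtain ⟨Y, rfl, rfl, hY, F, hF, hYF⟩ := h
  refine ⟨fun r => Y (1 - r), by simp, by simp, fun r φ => ?_, F, hF, fun r => hYF (1 - r)⟩
  have h := (hY (1 - r) φ).comp r ((hasDerivAt_id r).const_sub 1)
  refine h.congr_deriv ?_
  simp only [zero_add, neg_lie, map_neg, mul_neg, mul_one]

/-- Flows exist inside finite-dimensional `ad Γ`-stable subspaces. -/
theorem exists_gaugeFlow (S : Submodule ℂ AffE6) [FiniteDimensional ℂ S]
    (hS : ∀ x ∈ S, ⁅Γ, x⁆ ∈ S) (hx : x ∈ S) : ∃ y ∈ S, GaugeFlow Γ 0 x y := by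
  let b := Module.finBasis ℂ S
  let e := b.equivFun
  let D₀ : S →ₗ[ℂ] S := (LieAlgebra.ad ℂ AffE6 Γ).restrict hS
  let D : (Fin (Module.finrank ℂ S) → ℂ) →L[ℂ] (Fin (Module.finrank ℂ S) → ℂ) :=
    LinearMap.toContinuousLinearMap (e.toLinearMap ∘ₗ D₀ ∘ₗ e.symm.toLinearMap)
  let T : (Fin (Module.finrank ℂ S) → ℂ) →ₗ[ℂ] AffE6 := S.subtype ∘ₗ e.symm.toLinearMap
  have hT (v) : T (D v) = ⁅Γ, T v⁆ := by
    simp only [T, D, D₀, LinearMap.coe_toContinuousLinearMap', LinearMap.comp_apply,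
      LinearEquiv.coe_coe, LinearEquiv.symm_apply_apply, Submodule.subtype_apply]
    rfl
  let v₀ := e ⟨x, hx⟩
  let v : ℂ → (Fin (Module.finrank ℂ S) → ℂ) := fun r => NormedSpace.exp (r • D) v₀
  have hv (r : ℂ) : HasDerivAt v (D (v r)) r := by
    have h := (hasDerivAt_exp_smul_const' (𝕂 := ℂ) D r)
    exact h.clm_apply (hasDerivAt_const r v₀) |>.congr_deriv (by simp [v])
  have hflow := GaugeFlow.of_linear (Γ' := 0) T hv fun r => by rw [hT, zero_add]
  refine ⟨T (v 1), (e.symm (v 1)).2, ?_⟩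
  have hx₀ : T (v 0) = x := by
    have h0 : v 0 = v₀ := by
      have : (0 : ℂ) • D = 0 := zero_smul ℂ D
      change NormedSpace.exp ((0 : ℂ) • D) v₀ = v₀
      rw [this, NormedSpace.exp_zero]
      rfl
    simp only [h0, T, v₀, LinearMap.comp_apply, LinearEquiv.coe_coe, LinearEquiv.symm_apply_apply,
      Submodule.subtype_apply]
  rwa [hx₀] at hflow

/-- Weak derivatives of functions with values in a finite-dimensional subspace come from
derivatives of coordinates. -/
theorem exists_coord_of_hasDerivG {Y Y' : ℂ → AffE6} (S : Submodule ℂ AffE6)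
    [FiniteDimensional ℂ S] (hS : ∀ r, Y r ∈ S) (hY : ∀ r, HasDerivG Y (Y' r) r) :
    ∃ (n : ℕ) (T : (Fin n → ℂ) →ₗ[ℂ] AffE6) (v v' : ℂ → Fin n → ℂ),
      (∀ r, HasDerivAt v (v' r) r) ∧ (∀ r, T (v r) = Y r) ∧ ∀ r, T (v' r) = Y' r := by
  let b := Module.finBasis ℂ S
  obtain ⟨g, hg⟩ := LinearMap.exists_extend b.equivFun.toLinearMap
  let T : (Fin (Module.finrank ℂ S) → ℂ) →ₗ[ℂ] AffE6 := S.subtype ∘ₗ b.equivFun.symm.toLinearMap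
  have hT (r : ℂ) : T (g (Y r)) = Y r := by
    have h : g (Y r) = b.equivFun ⟨Y r, hS r⟩ := LinearMap.congr_fun hg ⟨Y r, hS r⟩
    rw [h]
    simp only [T, LinearMap.comp_apply, LinearEquiv.coe_coe, LinearEquiv.symm_apply_apply,
      Submodule.subtype_apply]
  have hv (r : ℂ) : HasDerivAt (fun r => g (Y r)) (g (Y' r)) r :=
    hasDerivAt_pi.2 fun i => hY r (LinearMap.proj i ∘ₗ g)
  refine ⟨_, T, fun r => g (Y r), fun r => g (Y' r), hv, hT, fun r => ?_⟩
  have h := hasDerivG_linear T (hv r)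
  simp only [hT] at h
  exact h.unique (hY r)

/-- `exp(ad Γ)` is compatible with brackets. -/
theorem GaugeFlow.isExpAd_lie (h : GaugeFlow Γ 0 x x') (h' : GaugeFlow Γ 0 y y') :
    IsExpAd Γ ⁅x, y⁆ ⁅x', y'⁆ := by
  obtain ⟨Y, rfl, rfl, hY, F, hF, hYF⟩ := h
  obtain ⟨Z, rfl, rfl, hZ, F', hF', hZF⟩ := h'
  obtain ⟨m, S, v, v', hv, hS, hS'⟩ := exists_coord_of_hasDerivG F hYF hY
  obtain ⟨n, T, w, w', hw, hT, hT'⟩ := exists_coord_of_hasDerivG F' hZF hZ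
  rw [isExpAd_iff]
  refine isGaugeTransform_of_hasDerivG (Y := fun r => ⁅Y r, Z r⁆) fun r => ?_
  have h := hasDerivG_bilinear S T (hv r) (hw r)
  simp only [hS, hS', hT, hT', zero_add] at h
  rw [zero_add, leibniz_lie]
  exact h

theorem exists_dual_of_notMem {S : Submodule ℂ AffE6} (hx : x ∉ S) :
    ∃ φ : Module.Dual ℂ AffE6, φ x ≠ 0 ∧ ∀ z ∈ S, φ z = 0 := by
  obtain ⟨φ, h₁, h₂⟩ := Submodule.exists_dual_map_eq_bot_of_notMem hx inferInstance
  refine ⟨φ, h₁, fun z hz => ?_⟩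
  have : φ z ∈ S.map φ := Submodule.mem_map_of_mem hz
  simpa [h₂] using this

/-- A subspace which contains all the terms of a gauge series contains its sum. -/
theorem IsGaugeTransform.mem {S : Submodule ℂ AffE6} (hS : ∀ z ∈ S, ⁅Γ, z⁆ ∈ S) (hB : B ∈ S)
    (hΓ : Γ' ∈ S) (h : IsGaugeTransform Γ Γ' B x) : x ∈ S := by
  by_contra hx
  obtain ⟨φ, h₁, h₂⟩ := exists_dual_of_notMem hx
  have hpow (n : ℕ) : ((LieAlgebra.ad ℂ AffE6 Γ) ^ n) (Γ' + ⁅Γ, B⁆) ∈ S := by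
    induction n with
    | zero => exact S.add_mem hΓ (hS _ hB)
    | succ n ih => rw [pow_succ']; exact hS _ ih
  have hterm (n : ℕ) : φ (gaugeTerm Γ Γ' B n) = 0 := by
    refine h₂ _ ?_
    cases n with
    | zero => exact hB
    | succ n => exact S.smul_mem _ (hpow n)
  have := h φ
  simp only [hterm] at this
  exact h₁ (this.unique hasSum_zero)

theorem IsGaugeTransform.sub (h : IsGaugeTransform Γ Γ' x y) (h' : IsGaugeTransform Γ 0 x' y') :
    IsGaugeTransform Γ Γ' (x - x') (y - y') := by
  intro φ
  have key (n : ℕ) : φ (gaugeTerm Γ Γ' (x - x') n) =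
      φ (gaugeTerm Γ Γ' x n) - φ (gaugeTerm Γ 0 x' n) := by
    refine Eq.trans (congrArg φ ?_) (map_sub φ _ _)
    cases n with
    | zero => rfl
    | succ n =>
      simp only [gaugeTerm, ← smul_sub, ← map_sub, lie_sub]
      congr 2
      abel
  simp only [key]
  exact ((h φ).sub (h' φ)) |> (map_sub φ y y' ▸ ·)

end Calculus

/-! ### The Chevalley relations -/

theorem mk_eq_zero_of_relator {r : FreeG} (h : Relator r) :
    (LieSubmodule.Quotient.mk r : AffE6) = 0 :=
  (LieSubmodule.Quotient.mk_eq_zero' (N := relIdeal)).2 (LieSubmodule.subset_lieSpan h)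

theorem lie_coroot_coroot (i j : Fin 7) : ⁅coroot i, coroot j⁆ = 0 :=
  mk_eq_zero_of_relator (.h_h i j)

theorem lie_coroot_e (i j : Fin 7) : ⁅coroot i, e j⁆ = (cartanMatrix i j : ℂ) • e j :=
  sub_eq_zero.1 (mk_eq_zero_of_relator (.h_e i j))

theorem lie_coroot_f (i j : Fin 7) : ⁅coroot i, f j⁆ = -(cartanMatrix i j : ℂ) • f j := by
  rw [neg_smul]
  exact eq_neg_of_add_eq_zero_left (mk_eq_zero_of_relator (.h_f i j))

theorem lie_e_f (i j : Fin 7) : ⁅e i, f j⁆ = (if i = j then (1 : ℂ) else 0) • coroot i :=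
  sub_eq_zero.1 (mk_eq_zero_of_relator (.e_f i j))

theorem lie_scal_coroot (i : Fin 7) : ⁅scal, coroot i⁆ = 0 :=
  mk_eq_zero_of_relator (.d_h i)

theorem lie_scal_e (i : Fin 7) : ⁅scal, e i⁆ = (if i = 0 then (1 : ℂ) else 0) • e i :=
  sub_eq_zero.1 (mk_eq_zero_of_relator (.d_e i))

theorem lie_scal_f (i : Fin 7) : ⁅scal, f i⁆ = -(if i = 0 then (1 : ℂ) else 0) • f i := by
  rw [neg_smul]
  exact eq_neg_of_add_eq_zero_left (mk_eq_zero_of_relator (.d_f i))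

theorem ad_pow_e (i j : Fin 7) (hij : i ≠ j) :
    ((LieAlgebra.ad ℂ AffE6 (e i)) ^ (1 - cartanMatrix i j).toNat) (e j) = 0 := by
  have h := mk_eq_zero_of_relator (.serre_e i j hij)
  rw [← h]
  generalize (1 - cartanMatrix i j).toNat = n
  induction n with
  | zero => rfl
  | succ n ih => rw [pow_succ', pow_succ', Module.End.mul_apply, ih]; rfl

theorem ad_pow_f (i j : Fin 7) (hij : i ≠ j) :
    ((LieAlgebra.ad ℂ AffE6 (f i)) ^ (1 - cartanMatrix i j).toNat) (f j) = 0 := by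
  have h := mk_eq_zero_of_relator (.serre_f i j hij)
  rw [← h]
  generalize (1 - cartanMatrix i j).toNat = n
  induction n with
  | zero => rfl
  | succ n ih => rw [pow_succ', pow_succ', Module.End.mul_apply, ih]; rfl

theorem lie_e_e {i j : Fin 7} (h : cartanMatrix i j = 0) : ⁅e i, e j⁆ = 0 := by
  have hij : i ≠ j := by
    rintro rfl
    revert h
    fin_cases i <;> decide
  simpa [h] using ad_pow_e i j hij

theorem lie_e_e_e {i j : Fin 7} (h : cartanMatrix i j = -1) : ⁅e i, ⁅e i, e j⁆⁆ = 0 := by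
  have hij : i ≠ j := by
    rintro rfl
    revert h
    fin_cases i <;> decide
  simpa [h, pow_succ] using ad_pow_e i j hij

theorem lie_f_f {i j : Fin 7} (h : cartanMatrix i j = 0) : ⁅f i, f j⁆ = 0 := by
  have hij : i ≠ j := by
    rintro rfl
    revert h
    fin_cases i <;> decide
  simpa [h] using ad_pow_f i j hij

theorem lie_e_f_self (i : Fin 7) : ⁅e i, f i⁆ = coroot i := by simp [lie_e_f]

theorem lie_f_e_self (i : Fin 7) : ⁅f i, e i⁆ = -coroot i := by
  rw [← lie_skew, lie_e_f_self]

theorem lie_f_e {i j : Fin 7} (h : i ≠ j) : ⁅f i, e j⁆ = 0 := by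
  rw [← lie_skew, lie_e_f, if_neg h.symm, zero_smul, neg_zero]

/-- If `x` and `y` commute, so do `ad x` and `ad y`. -/
theorem lie_lie_comm {x y : AffE6} (h : ⁅x, y⁆ = 0) (z : AffE6) : ⁅x, ⁅y, z⁆⁆ = ⁅y, ⁅x, z⁆⁆ := by
  rw [leibniz_lie, h, zero_lie, zero_add]

theorem lie_f_lie_e (i : Fin 7) (x : AffE6) : ⁅f i, ⁅e i, x⁆⁆ = ⁅e i, ⁅f i, x⁆⁆ - ⁅coroot i, x⁆ := by
  rw [leibniz_lie, lie_f_e_self, neg_lie]; abel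

theorem lie_coroot_lie_e (i j : Fin 7) (x : AffE6) :
    ⁅coroot i, ⁅e j, x⁆⁆ = (cartanMatrix i j : ℂ) • ⁅e j, x⁆ + ⁅e j, ⁅coroot i, x⁆⁆ := by
  rw [leibniz_lie, lie_coroot_e, smul_lie]

theorem Cartan.form_coroot (H : Cartan) (j : Fin 7) :
    H.form (Cartan.coroot j) = ∑ i, H.1 i * (cartanMatrix i j : ℂ) + H.2 * (if j = 0 then 1 else 0) := by
  simp only [Cartan.form, Cartan.coroot, Pi.single_apply, mul_ite, mul_one, mul_zero, mul_zero,
    add_zero, Finset.sum_ite_eq, Finset.mem_univ, if_true, eq_comm]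
  simp only [mul_comm]

theorem lie_toG_e (H : Cartan) (j : Fin 7) : ⁅H.toG, e j⁆ = H.form (Cartan.coroot j) • e j := by
  simp only [Cartan.toG, add_lie, sum_lie, smul_lie, lie_coroot_e, lie_scal_e, smul_smul,
    ← Finset.sum_smul, ← add_smul, Cartan.form_coroot]

theorem lie_toG_f (H : Cartan) (j : Fin 7) : ⁅H.toG, f j⁆ = -H.form (Cartan.coroot j) • f j := by
  simp only [Cartan.toG, add_lie, sum_lie, smul_lie, lie_coroot_f, lie_scal_f, smul_smul,
    ← Finset.sum_smul, ← add_smul, Cartan.form_coroot]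
  congr 1
  simp only [mul_neg, Finset.sum_neg_distrib, neg_add]

theorem lie_toG_coroot (H : Cartan) (j : Fin 7) : ⁅H.toG, coroot j⁆ = 0 := by
  simp [Cartan.toG, sum_lie, lie_coroot_coroot, lie_scal_coroot]

theorem lie_toG_scal (H : Cartan) : ⁅H.toG, scal⁆ = 0 := by
  have h (i : Fin 7) : ⁅coroot i, scal⁆ = 0 := by rw [← lie_skew, lie_scal_coroot, neg_zero]
  simp [Cartan.toG, sum_lie, h]

theorem lie_toG_toG (H K : Cartan) : ⁅H.toG, K.toG⁆ = 0 := by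
  rw [Cartan.toG.eq_1 K]
  simp [lie_sum, lie_toG_coroot, lie_toG_scal]

theorem lie_toG_lie_e (H : Cartan) (j : Fin 7) (x : AffE6) :
    ⁅H.toG, ⁅e j, x⁆⁆ = H.form (Cartan.coroot j) • ⁅e j, x⁆ + ⁅e j, ⁅H.toG, x⁆⁆ := by
  rw [leibniz_lie, lie_toG_e, smul_lie]

/-! ### The component of degree one -/

/-- Root vectors spanning the component of degree one: the doublets of `e₀`, `e₁`, `e₅` under
`e₆`, `e₂`, `e₄` respectively, followed by the eight vectors
`(ad e₂)^i (ad e₄)^j (ad e₆)^k e₃`, `i, j, k ≤ 1`. -/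
noncomputable def rootVec : Fin 14 → AffE6 :=
  ![e 0, ⁅e 6, e 0⁆, e 1, ⁅e 2, e 1⁆, e 5, ⁅e 4, e 5⁆, e 3, ⁅e 2, e 3⁆, ⁅e 4, e 3⁆, ⁅e 6, e 3⁆,
    ⁅e 2, ⁅e 4, e 3⁆⁆, ⁅e 2, ⁅e 6, e 3⁆⁆, ⁅e 4, ⁅e 6, e 3⁆⁆, ⁅e 2, ⁅e 4, ⁅e 6, e 3⁆⁆⁆]

/-- Coordinates with respect to `rootVec`. -/
abbrev Deg1 : Type := Fin 14 → ℂ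

/-- The element of degree one with given coordinates. -/
noncomputable def toG1 : Deg1 →ₗ[ℂ] AffE6 := Fintype.linearCombination ℂ rootVec

theorem toG1_apply (v : Deg1) : toG1 v =
    v 0 • e 0 + v 1 • ⁅e 6, e 0⁆ + v 2 • e 1 + v 3 • ⁅e 2, e 1⁆ + v 4 • e 5 + v 5 • ⁅e 4, e 5⁆
      + v 6 • e 3 + v 7 • ⁅e 2, e 3⁆ + v 8 • ⁅e 4, e 3⁆ + v 9 • ⁅e 6, e 3⁆
      + v 10 • ⁅e 2, ⁅e 4, e 3⁆⁆ + v 11 • ⁅e 2, ⁅e 6, e 3⁆⁆ + v 12 • ⁅e 4, ⁅e 6, e 3⁆⁆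
      + v 13 • ⁅e 2, ⁅e 4, ⁅e 6, e 3⁆⁆⁆ := by
  simp only [toG1, Fintype.linearCombination_apply, rootVec, Fin.sum_univ_succ]
  simp [add_assoc]

theorem word_two_three_four : word [2, 3, 4] = -⁅e 2, ⁅e 4, e 3⁆⁆ := by
  simp only [word]
  rw [← lie_skew (e 3) (e 4), lie_neg]

theorem word_two_three_six : word [2, 3, 6] = -⁅e 2, ⁅e 6, e 3⁆⁆ := by
  simp only [word]
  rw [← lie_skew (e 3) (e 6), lie_neg]

theorem word_four_three_six : word [4, 3, 6] = -⁅e 4, ⁅e 6, e 3⁆⁆ := by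
  simp only [word]
  rw [← lie_skew (e 3) (e 6), lie_neg]

theorem comm_e24 (x : AffE6) : ⁅e 4, ⁅e 2, x⁆⁆ = ⁅e 2, ⁅e 4, x⁆⁆ := lie_lie_comm (lie_e_e rfl) x
theorem comm_e26 (x : AffE6) : ⁅e 6, ⁅e 2, x⁆⁆ = ⁅e 2, ⁅e 6, x⁆⁆ := lie_lie_comm (lie_e_e rfl) x
theorem comm_e46 (x : AffE6) : ⁅e 6, ⁅e 4, x⁆⁆ = ⁅e 4, ⁅e 6, x⁆⁆ := lie_lie_comm (lie_e_e rfl) x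

theorem word_six_two_three_four : word [6, 2, 3, 4] = -⁅e 2, ⁅e 4, ⁅e 6, e 3⁆⁆⁆ := by
  rw [show word [6, 2, 3, 4] = ⁅e 6, word [2, 3, 4]⁆ from rfl, word_two_three_four, lie_neg,
    comm_e26, comm_e46]

theorem comm_f_e {i j : Fin 7} (h : i ≠ j) (x : AffE6) : ⁅f i, ⁅e j, x⁆⁆ = ⁅e j, ⁅f i, x⁆⁆ :=
  lie_lie_comm (lie_f_e h) x

theorem lie_sq_zero {x y z : AffE6} (h : ⁅x, y⁆ = 0) (hz : ⁅x, ⁅x, z⁆⁆ = 0) :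
    ⁅x, ⁅x, ⁅y, z⁆⁆⁆ = 0 := by
  rw [lie_lie_comm h, lie_lie_comm h, hz, lie_zero]

theorem lie_lie_zero {x y z : AffE6} (h : ⁅x, y⁆ = 0) (hz : ⁅x, z⁆ = 0) : ⁅x, ⁅y, z⁆⁆ = 0 := by
  rw [lie_lie_comm h, hz, lie_zero]

theorem lie_e_e_rootVec :
    (⁅e 2, e 0⁆ = 0 ∧ ⁅e 2, ⁅e 6, e 0⁆⁆ = 0 ∧ ⁅e 2, ⁅e 2, e 1⁆⁆ = 0 ∧ ⁅e 2, e 5⁆ = 0 ∧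
      ⁅e 2, ⁅e 4, e 5⁆⁆ = 0 ∧ ⁅e 2, ⁅e 2, e 3⁆⁆ = 0 ∧ ⁅e 2, ⁅e 2, ⁅e 4, e 3⁆⁆⁆ = 0 ∧
      ⁅e 2, ⁅e 2, ⁅e 6, e 3⁆⁆⁆ = 0 ∧ ⁅e 2, ⁅e 2, ⁅e 4, ⁅e 6, e 3⁆⁆⁆⁆ = 0) ∧
    (⁅e 4, e 0⁆ = 0 ∧ ⁅e 4, ⁅e 6, e 0⁆⁆ = 0 ∧ ⁅e 4, e 1⁆ = 0 ∧ ⁅e 4, ⁅e 4, e 5⁆⁆ = 0 ∧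
      ⁅e 4, ⁅e 4, e 3⁆⁆ = 0 ∧ ⁅e 4, ⁅e 4, ⁅e 6, e 3⁆⁆⁆ = 0) ∧
    (⁅e 6, ⁅e 6, e 0⁆⁆ = 0 ∧ ⁅e 6, e 1⁆ = 0 ∧ ⁅e 6, e 5⁆ = 0 ∧ ⁅e 6, ⁅e 6, e 3⁆⁆ = 0) := by
  have h26 : ⁅e 2, e 6⁆ = 0 := lie_e_e rfl
  have h24 : ⁅e 2, e 4⁆ = 0 := lie_e_e rfl
  have h46 : ⁅e 4, e 6⁆ = 0 := lie_e_e rfl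
  have h223 : ⁅e 2, ⁅e 2, e 3⁆⁆ = 0 := lie_e_e_e rfl
  have h443 : ⁅e 4, ⁅e 4, e 3⁆⁆ = 0 := lie_e_e_e rfl
  exact ⟨⟨lie_e_e rfl, lie_lie_zero h26 (lie_e_e rfl), lie_e_e_e rfl, lie_e_e rfl,
    lie_lie_zero h24 (lie_e_e rfl), h223, lie_sq_zero h24 h223, lie_sq_zero h26 h223,
    lie_sq_zero h24 (lie_sq_zero h26 h223)⟩,
    ⟨lie_e_e rfl, lie_lie_zero h46 (lie_e_e rfl), lie_e_e rfl, lie_e_e_e rfl, h443,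
      lie_sq_zero h46 h443⟩,
    ⟨lie_e_e_e rfl, lie_e_e rfl, lie_e_e rfl, lie_e_e_e rfl⟩⟩

theorem lie_e2_toG1 (v : Deg1) :
    ⁅e 2, toG1 v⁆ = toG1 ![0, 0, 0, v 2, 0, 0, 0, v 6, 0, 0, v 8, v 9, 0, v 12] := by
  simp [toG1_apply, comm_e24, comm_e26, comm_e46, lie_e_e_rootVec]

theorem lie_f2_toG1 (v : Deg1) :
    ⁅f 2, toG1 v⁆ = toG1 ![0, 0, v 3, 0, 0, 0, v 7, 0, v 10, v 11, 0, 0, v 13, 0] := by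
  simp [toG1_apply, lie_f_e, comm_f_e, lie_f_lie_e, lie_coroot_lie_e, lie_coroot_e, cartanMatrix,
    -lie_skew, -lie_lie]

theorem lie_e4_toG1 (v : Deg1) :
    ⁅e 4, toG1 v⁆ = toG1 ![0, 0, 0, 0, 0, v 4, 0, 0, v 6, 0, v 7, 0, v 9, v 11] := by
  simp [toG1_apply, comm_e24, comm_e26, comm_e46, lie_e_e_rootVec]

theorem lie_f4_toG1 (v : Deg1) :
    ⁅f 4, toG1 v⁆ = toG1 ![0, 0, 0, 0, v 5, 0, v 8, v 10, 0, v 12, 0, v 13, 0, 0] := by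
  simp [toG1_apply, lie_f_e, comm_f_e, lie_f_lie_e, lie_coroot_lie_e, lie_coroot_e, cartanMatrix,
    -lie_skew, -lie_lie]

theorem lie_e6_toG1 (v : Deg1) :
    ⁅e 6, toG1 v⁆ = toG1 ![0, v 0, 0, 0, 0, 0, 0, 0, 0, v 6, 0, v 7, v 8, v 10] := by
  simp [toG1_apply, comm_e24, comm_e26, comm_e46, lie_e_e_rootVec]

theorem lie_f6_toG1 (v : Deg1) :
    ⁅f 6, toG1 v⁆ = toG1 ![v 1, 0, 0, 0, 0, 0, v 9, v 11, v 12, 0, v 13, 0, 0, 0] := by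
  simp [toG1_apply, lie_f_e, comm_f_e, lie_f_lie_e, lie_coroot_lie_e, lie_coroot_e, cartanMatrix,
    -lie_skew, -lie_lie]


/-- The scalars by which `H` acts on `rootVec`, in terms of the values `w j` of the simple roots
at `H`. -/
def weights (w : Fin 7 → ℂ) : Fin 14 → ℂ :=
  ![w 0, w 0 + w 6, w 1, w 1 + w 2, w 5, w 4 + w 5, w 3, w 3 + w 2, w 3 + w 4, w 3 + w 6,
    w 3 + w 2 + w 4, w 3 + w 2 + w 6, w 3 + w 4 + w 6, w 3 + w 2 + w 4 + w 6]

/-- The values of the simple roots at an element of the Cartan subalgebra. -/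
noncomputable def Cartan.root (H : Cartan) (j : Fin 7) : ℂ := H.form (Cartan.coroot j)

theorem lie_toG_rootVec (H : Cartan) (i : Fin 14) :
    ⁅H.toG, rootVec i⁆ = weights H.root i • rootVec i := by
  fin_cases i <;>
  simp [rootVec, weights, lie_toG_lie_e, lie_toG_e, Cartan.root] <;> module

theorem lie_toG_toG1 (H : Cartan) (v : Deg1) : ⁅H.toG, toG1 v⁆ = toG1 (weights H.root * v) := by
  simp only [toG1, Fintype.linearCombination_apply, lie_sum, lie_smul, lie_toG_rootVec, smul_smul,
    Pi.mul_apply, mul_comm]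

/-- The element `H + ∑ z_i e_i + ∑ y_i f_i` (`i = 2, 4, 6`) of degree zero. -/
noncomputable def toG0 (H : Cartan) (z y : Fin 3 → ℂ) : AffE6 :=
  H.toG + ∑ i, z i • e (node i) + ∑ i, y i • f (node i)

/-- The action of `toG0 H z y` on the component of degree one, in coordinates; `w` gives the
values of the simple roots at `H`. -/
def act (w : Fin 7 → ℂ) (z y : Fin 3 → ℂ) (v : Deg1) : Deg1 :=
  ![w 0 * v 0 + y 2 * v 1,
    (w 0 + w 6) * v 1 + z 2 * v 0,
    w 1 * v 2 + y 0 * v 3,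
    (w 1 + w 2) * v 3 + z 0 * v 2,
    w 5 * v 4 + y 1 * v 5,
    (w 4 + w 5) * v 5 + z 1 * v 4,
    w 3 * v 6 + y 0 * v 7 + y 1 * v 8 + y 2 * v 9,
    (w 3 + w 2) * v 7 + z 0 * v 6 + y 1 * v 10 + y 2 * v 11,
    (w 3 + w 4) * v 8 + z 1 * v 6 + y 0 * v 10 + y 2 * v 12,
    (w 3 + w 6) * v 9 + z 2 * v 6 + y 0 * v 11 + y 1 * v 12,
    (w 3 + w 2 + w 4) * v 10 + z 0 * v 8 + z 1 * v 7 + y 2 * v 13,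
    (w 3 + w 2 + w 6) * v 11 + z 0 * v 9 + z 2 * v 7 + y 1 * v 13,
    (w 3 + w 4 + w 6) * v 12 + z 1 * v 9 + z 2 * v 8 + y 0 * v 13,
    (w 3 + w 2 + w 4 + w 6) * v 13 + z 0 * v 12 + z 1 * v 11 + z 2 * v 10]

theorem lie_toG0_toG1 (H : Cartan) (z y : Fin 3 → ℂ) (v : Deg1) :
    ⁅toG0 H z y, toG1 v⁆ = toG1 (act H.root z y v) := by
  simp only [toG0, add_lie, sum_lie, smul_lie, Fin.sum_univ_three, lie_toG_toG1,
    show node 0 = 2 from rfl, show node 1 = 4 from rfl, show node 2 = 6 from rfl,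
    lie_e2_toG1, lie_e4_toG1, lie_e6_toG1, lie_f2_toG1, lie_f4_toG1, lie_f6_toG1]
  simp only [← map_smul, ← map_add]
  congr 1
  funext i
  simp only [Pi.add_apply, Pi.smul_apply, Pi.mul_apply, smul_eq_mul]
  fin_cases i <;> simp [weights, act] <;> ring

/-! ### Brackets of elements of degree one -/

section Cube

variable {a b c x : AffE6}

/-- Here `x` is a lowest weight vector for commuting raising operators `a` and `b`, and each of `a` and
`b` generates with `x` a subalgebra of type `A₂`. -/
theorem cube_aux₁ (hab : ⁅a, b⁆ = 0) (ha : ⁅x, ⁅a, x⁆⁆ = 0) (hb : ⁅x, ⁅b, x⁆⁆ = 0) :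
    ⁅x, ⁅a, ⁅b, x⁆⁆⁆ = 0 ∧ ⁅⁅a, x⁆, ⁅b, x⁆⁆ = 0 := by
  have h₁ : ⁅⁅a, x⁆, ⁅b, x⁆⁆ + ⁅x, ⁅a, ⁅b, x⁆⁆⁆ = 0 := by rw [← leibniz_lie, hb, lie_zero]
  have h₂ : ⁅⁅b, x⁆, ⁅a, x⁆⁆ + ⁅x, ⁅a, ⁅b, x⁆⁆⁆ = 0 := by
    rw [lie_lie_comm hab, ← leibniz_lie, ha, lie_zero]
  have h₃ : (2 : ℂ) • ⁅x, ⁅a, ⁅b, x⁆⁆⁆ = 0 := by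
    rw [← lie_skew] at h₂
    linear_combination (norm := module) h₁ + h₂
  have h₄ := (smul_eq_zero.1 h₃).resolve_left two_ne_zero
  exact ⟨h₄, by rwa [h₄, add_zero] at h₁⟩

theorem cube_aux₂ (hab : ⁅a, b⁆ = 0) (haa : ⁅a, ⁅a, x⁆⁆ = 0) (ha : ⁅x, ⁅a, x⁆⁆ = 0)
    (hb : ⁅x, ⁅b, x⁆⁆ = 0) : ⁅⁅a, x⁆, ⁅a, ⁅b, x⁆⁆⁆ = 0 := by
  have h : ⁅⁅a, x⁆, ⁅a, ⁅b, x⁆⁆⁆ + ⁅x, ⁅a, ⁅a, ⁅b, x⁆⁆⁆⁆ = 0 := by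
    rw [← leibniz_lie, (cube_aux₁ hab ha hb).1, lie_zero]
  rwa [lie_sq_zero hab haa, lie_zero, add_zero] at h

theorem cube_aux₃ (hab : ⁅a, b⁆ = 0) (ha : ⁅x, ⁅a, x⁆⁆ = 0) (hb : ⁅x, ⁅b, x⁆⁆ = 0) :
    ⁅⁅c, x⁆, ⁅a, ⁅b, x⁆⁆⁆ = -⁅x, ⁅c, ⁅a, ⁅b, x⁆⁆⁆⁆ := by
  rw [eq_neg_iff_add_eq_zero, ← leibniz_lie, (cube_aux₁ hab ha hb).1, lie_zero]

/-- Two doublets of an `𝔰𝔩₂` with raising operator `c`, with commuting lowest vectors, bracket into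
a singlet. -/
theorem doublet_aux (hc : ⁅c, ⁅c, a⁆⁆ = 0) (hx : ⁅c, ⁅c, x⁆⁆ = 0) (h : ⁅a, x⁆ = 0) :
    ⁅⁅c, a⁆, x⁆ = -⁅a, ⁅c, x⁆⁆ ∧ ⁅⁅c, a⁆, ⁅c, x⁆⁆ = 0 := by
  have h₁ : ⁅⁅c, a⁆, x⁆ = -⁅a, ⁅c, x⁆⁆ := by
    rw [eq_neg_iff_add_eq_zero, ← leibniz_lie, h, lie_zero]
  refine ⟨h₁, ?_⟩
  have h₂ := congrArg (fun y => ⁅c, y⁆) h₁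
  simp only [leibniz_lie c ⁅c, a⁆, hc, zero_lie, zero_add, lie_neg, leibniz_lie c a, hx, lie_zero,
    add_zero] at h₂
  have h₃ : (2 : ℂ) • ⁅⁅c, a⁆, ⁅c, x⁆⁆ = 0 := by
    linear_combination (norm := module) h₂
  exact (smul_eq_zero.1 h₃).resolve_left two_ne_zero

end Cube

/-- The part of an element of degree one in the `𝔰𝔩₂³`-submodule generated by `e₃`. -/
noncomputable def cubePart (v : Deg1) : AffE6 :=
  v 6 • e 3 + v 7 • ⁅e 2, e 3⁆ + v 8 • ⁅e 4, e 3⁆ + v 9 • ⁅e 6, e 3⁆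
    + v 10 • ⁅e 2, ⁅e 4, e 3⁆⁆ + v 11 • ⁅e 2, ⁅e 6, e 3⁆⁆ + v 12 • ⁅e 4, ⁅e 6, e 3⁆⁆
    + v 13 • ⁅e 2, ⁅e 4, ⁅e 6, e 3⁆⁆⁆

theorem toG1_eq_add_cubePart (v : Deg1) : toG1 v = (v 0 • e 0 + v 1 • ⁅e 6, e 0⁆)
    + (v 2 • e 1 + v 3 • ⁅e 2, e 1⁆) + (v 4 • e 5 + v 5 • ⁅e 4, e 5⁆) + cubePart v := by
  rw [toG1_apply, cubePart]; abel

theorem lie_neg_swap {x y z : AffE6} (h : ⁅x, y⁆ = z) : ⁅y, x⁆ = -z := by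
  rw [← h, lie_skew]

theorem lie_doublet_doublet {a c a' c' : AffE6} (h₁ : ⁅a, a'⁆ = 0) (h₂ : ⁅a, c'⁆ = 0)
    (h₃ : ⁅c, a'⁆ = 0) (h₄ : ⁅c, c'⁆ = 0) (p q r s : ℂ) :
    ⁅p • a + q • ⁅c, a⁆, r • a' + s • ⁅c', a'⁆⁆ = 0 := by
  have h₅ : ⁅a, ⁅c', a'⁆⁆ = 0 := lie_lie_zero h₂ h₁
  have h₆ : ⁅c, ⁅c', a'⁆⁆ = 0 := lie_lie_zero h₄ h₃
  simp [lie_lie, h₁, h₃, h₅, h₆]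

theorem lie_doublet_self {a c : AffE6} (h : ⁅a, ⁅a, c⁆⁆ = 0) (p q r s : ℂ) :
    ⁅p • a + q • ⁅c, a⁆, r • a + s • ⁅c, a⁆⁆ = 0 := by
  have h₁ : ⁅a, ⁅c, a⁆⁆ = 0 := by rw [← lie_skew c a, lie_neg, h, neg_zero]
  have h₂ : ⁅⁅c, a⁆, a⁆ = 0 := by rw [← lie_skew, h₁, neg_zero]
  simp only [add_lie, lie_add, smul_lie, lie_smul, lie_self, h₁, h₂, smul_zero, add_zero]

theorem lie_doublet_pair {a c x : AffE6} (hc : ⁅c, ⁅c, a⁆⁆ = 0) (hx : ⁅c, ⁅c, x⁆⁆ = 0)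
    (h : ⁅a, x⁆ = 0) (p q r s : ℂ) :
    ⁅p • a + q • ⁅c, a⁆, r • x + s • ⁅c, x⁆⁆ = (p * s - q * r) • ⁅a, ⁅c, x⁆⁆ := by
  have := doublet_aux hc hx h
  simp only [add_lie, lie_add, smul_lie, lie_smul, h, this.1, this.2]
  module

theorem lie_doublet_cubePart₀ (u v : Deg1) : ⁅u 0 • e 0 + u 1 • ⁅e 6, e 0⁆, cubePart v⁆ =
    (u 0 * v 9 - u 1 * v 6) • ⁅e 0, ⁅e 6, e 3⁆⁆
      + (u 0 * v 11 - u 1 * v 7) • ⁅e 0, ⁅e 2, ⁅e 6, e 3⁆⁆⁆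
      + (u 0 * v 12 - u 1 * v 8) • ⁅e 0, ⁅e 4, ⁅e 6, e 3⁆⁆⁆
      + (u 0 * v 13 - u 1 * v 10) • ⁅e 0, ⁅e 2, ⁅e 4, ⁅e 6, e 3⁆⁆⁆⁆ := by
  have hc : ⁅e 6, ⁅e 6, e 0⁆⁆ = 0 := lie_e_e_e rfl
  have hx : ⁅e 6, ⁅e 6, e 3⁆⁆ = 0 := lie_e_e_e rfl
  have h : ⁅e 0, e 3⁆ = 0 := lie_e_e rfl
  have hv : cubePart v = (v 6 • e 3 + v 9 • ⁅e 6, e 3⁆)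
      + (v 7 • ⁅e 2, e 3⁆ + v 11 • ⁅e 6, ⁅e 2, e 3⁆⁆)
      + (v 8 • ⁅e 4, e 3⁆ + v 12 • ⁅e 6, ⁅e 4, e 3⁆⁆)
      + (v 10 • ⁅e 2, ⁅e 4, e 3⁆⁆ + v 13 • ⁅e 6, ⁅e 2, ⁅e 4, e 3⁆⁆⁆) := by
    simp only [cubePart, comm_e24, comm_e26, comm_e46]; abel
  rw [hv, lie_add, lie_add, lie_add,
    lie_doublet_pair hc hx h,
    lie_doublet_pair hc (lie_sq_zero (lie_e_e rfl) hx) (lie_lie_zero (lie_e_e rfl) h),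
    lie_doublet_pair hc (lie_sq_zero (lie_e_e rfl) hx) (lie_lie_zero (lie_e_e rfl) h),
    lie_doublet_pair hc (lie_sq_zero (lie_e_e rfl) (lie_sq_zero (lie_e_e rfl) hx)) (lie_lie_zero (lie_e_e rfl) (lie_lie_zero (lie_e_e rfl) h))]
  simp only [comm_e24, comm_e26, comm_e46]

theorem lie_doublet_cubePart₁ (u v : Deg1) : ⁅u 2 • e 1 + u 3 • ⁅e 2, e 1⁆, cubePart v⁆ =
    (u 2 * v 7 - u 3 * v 6) • ⁅e 1, ⁅e 2, e 3⁆⁆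
      + (u 2 * v 10 - u 3 * v 8) • ⁅e 1, ⁅e 2, ⁅e 4, e 3⁆⁆⁆
      + (u 2 * v 11 - u 3 * v 9) • ⁅e 1, ⁅e 2, ⁅e 6, e 3⁆⁆⁆
      + (u 2 * v 13 - u 3 * v 12) • ⁅e 1, ⁅e 2, ⁅e 4, ⁅e 6, e 3⁆⁆⁆⁆ := by
  have hc : ⁅e 2, ⁅e 2, e 1⁆⁆ = 0 := lie_e_e_e rfl
  have hx : ⁅e 2, ⁅e 2, e 3⁆⁆ = 0 := lie_e_e_e rfl
  have h : ⁅e 1, e 3⁆ = 0 := lie_e_e rfl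
  have hv : cubePart v = (v 6 • e 3 + v 7 • ⁅e 2, e 3⁆)
      + (v 8 • ⁅e 4, e 3⁆ + v 10 • ⁅e 2, ⁅e 4, e 3⁆⁆)
      + (v 9 • ⁅e 6, e 3⁆ + v 11 • ⁅e 2, ⁅e 6, e 3⁆⁆)
      + (v 12 • ⁅e 4, ⁅e 6, e 3⁆⁆ + v 13 • ⁅e 2, ⁅e 4, ⁅e 6, e 3⁆⁆⁆) := by
    simp only [cubePart, comm_e24, comm_e26, comm_e46]; abel
  rw [hv, lie_add, lie_add, lie_add,
    lie_doublet_pair hc hx h,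
    lie_doublet_pair hc (lie_sq_zero (lie_e_e rfl) hx) (lie_lie_zero (lie_e_e rfl) h),
    lie_doublet_pair hc (lie_sq_zero (lie_e_e rfl) hx) (lie_lie_zero (lie_e_e rfl) h),
    lie_doublet_pair hc (lie_sq_zero (lie_e_e rfl) (lie_sq_zero (lie_e_e rfl) hx)) (lie_lie_zero (lie_e_e rfl) (lie_lie_zero (lie_e_e rfl) h))]

theorem lie_doublet_cubePart₅ (u v : Deg1) : ⁅u 4 • e 5 + u 5 • ⁅e 4, e 5⁆, cubePart v⁆ =
    (u 4 * v 8 - u 5 * v 6) • ⁅e 5, ⁅e 4, e 3⁆⁆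
      + (u 4 * v 10 - u 5 * v 7) • ⁅e 5, ⁅e 2, ⁅e 4, e 3⁆⁆⁆
      + (u 4 * v 12 - u 5 * v 9) • ⁅e 5, ⁅e 4, ⁅e 6, e 3⁆⁆⁆
      + (u 4 * v 13 - u 5 * v 11) • ⁅e 5, ⁅e 2, ⁅e 4, ⁅e 6, e 3⁆⁆⁆⁆ := by
  have hc : ⁅e 4, ⁅e 4, e 5⁆⁆ = 0 := lie_e_e_e rfl
  have hx : ⁅e 4, ⁅e 4, e 3⁆⁆ = 0 := lie_e_e_e rfl
  have h : ⁅e 5, e 3⁆ = 0 := lie_e_e rfl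
  have hv : cubePart v = (v 6 • e 3 + v 8 • ⁅e 4, e 3⁆)
      + (v 7 • ⁅e 2, e 3⁆ + v 10 • ⁅e 4, ⁅e 2, e 3⁆⁆)
      + (v 9 • ⁅e 6, e 3⁆ + v 12 • ⁅e 4, ⁅e 6, e 3⁆⁆)
      + (v 11 • ⁅e 2, ⁅e 6, e 3⁆⁆ + v 13 • ⁅e 4, ⁅e 2, ⁅e 6, e 3⁆⁆⁆) := by
    simp only [cubePart, comm_e24, comm_e26, comm_e46]; abel
  rw [hv, lie_add, lie_add, lie_add,
    lie_doublet_pair hc hx h,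
    lie_doublet_pair hc (lie_sq_zero (lie_e_e rfl) hx) (lie_lie_zero (lie_e_e rfl) h),
    lie_doublet_pair hc (lie_sq_zero (lie_e_e rfl) hx) (lie_lie_zero (lie_e_e rfl) h),
    lie_doublet_pair hc (lie_sq_zero (lie_e_e rfl) (lie_sq_zero (lie_e_e rfl) hx)) (lie_lie_zero (lie_e_e rfl) (lie_lie_zero (lie_e_e rfl) h))]
  simp only [comm_e24, comm_e26, comm_e46]

/-- The brackets between the eight vectors `(ad e₂)^i (ad e₄)^j (ad e₆)^k e₃`: only those of
opposite vertices of the cube survive, and up to sign these are all equal to the bracket with `e₃`. -/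
theorem lie_cube :
    ⁅e 3, ⁅e 2, e 3⁆⁆ = 0 ∧
    ⁅e 3, ⁅e 4, e 3⁆⁆ = 0 ∧
    ⁅e 3, ⁅e 6, e 3⁆⁆ = 0 ∧
    ⁅e 3, ⁅e 2, ⁅e 4, e 3⁆⁆⁆ = 0 ∧
    ⁅e 3, ⁅e 2, ⁅e 6, e 3⁆⁆⁆ = 0 ∧
    ⁅e 3, ⁅e 4, ⁅e 6, e 3⁆⁆⁆ = 0 ∧
    ⁅⁅e 2, e 3⁆, ⁅e 4, e 3⁆⁆ = 0 ∧
    ⁅⁅e 2, e 3⁆, ⁅e 6, e 3⁆⁆ = 0 ∧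
    ⁅⁅e 4, e 3⁆, ⁅e 6, e 3⁆⁆ = 0 ∧
    ⁅⁅e 2, e 3⁆, ⁅e 2, ⁅e 4, e 3⁆⁆⁆ = 0 ∧
    ⁅⁅e 2, e 3⁆, ⁅e 2, ⁅e 6, e 3⁆⁆⁆ = 0 ∧
    ⁅⁅e 2, e 3⁆, ⁅e 4, ⁅e 6, e 3⁆⁆⁆ = -⁅e 3, ⁅e 2, ⁅e 4, ⁅e 6, e 3⁆⁆⁆⁆ ∧
    ⁅⁅e 4, e 3⁆, ⁅e 2, ⁅e 4, e 3⁆⁆⁆ = 0 ∧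
    ⁅⁅e 4, e 3⁆, ⁅e 2, ⁅e 6, e 3⁆⁆⁆ = -⁅e 3, ⁅e 2, ⁅e 4, ⁅e 6, e 3⁆⁆⁆⁆ ∧
    ⁅⁅e 4, e 3⁆, ⁅e 4, ⁅e 6, e 3⁆⁆⁆ = 0 ∧
    ⁅⁅e 6, e 3⁆, ⁅e 2, ⁅e 4, e 3⁆⁆⁆ = -⁅e 3, ⁅e 2, ⁅e 4, ⁅e 6, e 3⁆⁆⁆⁆ ∧
    ⁅⁅e 6, e 3⁆, ⁅e 2, ⁅e 6, e 3⁆⁆⁆ = 0 ∧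
    ⁅⁅e 6, e 3⁆, ⁅e 4, ⁅e 6, e 3⁆⁆⁆ = 0 ∧
    ⁅⁅e 2, e 3⁆, ⁅e 2, ⁅e 4, ⁅e 6, e 3⁆⁆⁆⁆ = 0 ∧
    ⁅⁅e 4, e 3⁆, ⁅e 2, ⁅e 4, ⁅e 6, e 3⁆⁆⁆⁆ = 0 ∧
    ⁅⁅e 6, e 3⁆, ⁅e 2, ⁅e 4, ⁅e 6, e 3⁆⁆⁆⁆ = 0 ∧
    ⁅⁅e 2, ⁅e 4, e 3⁆⁆, ⁅e 2, ⁅e 6, e 3⁆⁆⁆ = 0 ∧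
    ⁅⁅e 2, ⁅e 4, e 3⁆⁆, ⁅e 4, ⁅e 6, e 3⁆⁆⁆ = 0 ∧
    ⁅⁅e 2, ⁅e 6, e 3⁆⁆, ⁅e 4, ⁅e 6, e 3⁆⁆⁆ = 0 ∧
    ⁅⁅e 2, ⁅e 4, e 3⁆⁆, ⁅e 2, ⁅e 4, ⁅e 6, e 3⁆⁆⁆⁆ = 0 ∧
    ⁅⁅e 2, ⁅e 6, e 3⁆⁆, ⁅e 2, ⁅e 4, ⁅e 6, e 3⁆⁆⁆⁆ = 0 ∧
    ⁅⁅e 4, ⁅e 6, e 3⁆⁆, ⁅e 2, ⁅e 4, ⁅e 6, e 3⁆⁆⁆⁆ = 0 := by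
  have h24 : ⁅e 2, e 4⁆ = 0 := lie_e_e rfl
  have h26 : ⁅e 2, e 6⁆ = 0 := lie_e_e rfl
  have h42 : ⁅e 4, e 2⁆ = 0 := lie_e_e rfl
  have h46 : ⁅e 4, e 6⁆ = 0 := lie_e_e rfl
  have h62 : ⁅e 6, e 2⁆ = 0 := lie_e_e rfl
  have h64 : ⁅e 6, e 4⁆ = 0 := lie_e_e rfl
  have h2 : ⁅e 3, ⁅e 2, e 3⁆⁆ = 0 := by
    rw [← lie_skew (e 2), lie_neg, lie_e_e_e rfl, neg_zero]
  have q2 : ⁅e 2, ⁅e 2, e 3⁆⁆ = 0 := lie_e_e_e rfl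
  have h4 : ⁅e 3, ⁅e 4, e 3⁆⁆ = 0 := by
    rw [← lie_skew (e 4), lie_neg, lie_e_e_e rfl, neg_zero]
  have q4 : ⁅e 4, ⁅e 4, e 3⁆⁆ = 0 := lie_e_e_e rfl
  have h6 : ⁅e 3, ⁅e 6, e 3⁆⁆ = 0 := by
    rw [← lie_skew (e 6), lie_neg, lie_e_e_e rfl, neg_zero]
  have q6 : ⁅e 6, ⁅e 6, e 3⁆⁆ = 0 := lie_e_e_e rfl
  have g24 : ⁅⁅e 2, e 3⁆, ⁅e 4, ⁅e 2, e 3⁆⁆⁆ = 0 := by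
    rw [lie_lie_comm h42]; exact cube_aux₂ h24 q2 h2 h4
  have g26 : ⁅⁅e 2, e 3⁆, ⁅e 6, ⁅e 2, e 3⁆⁆⁆ = 0 := by
    rw [lie_lie_comm h62]; exact cube_aux₂ h26 q2 h2 h6
  have g42 : ⁅⁅e 4, e 3⁆, ⁅e 2, ⁅e 4, e 3⁆⁆⁆ = 0 := by
    rw [lie_lie_comm h24]; exact cube_aux₂ h42 q4 h4 h2
  have g46 : ⁅⁅e 4, e 3⁆, ⁅e 6, ⁅e 4, e 3⁆⁆⁆ = 0 := by
    rw [lie_lie_comm h64]; exact cube_aux₂ h46 q4 h4 h6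
  have g62 : ⁅⁅e 6, e 3⁆, ⁅e 2, ⁅e 6, e 3⁆⁆⁆ = 0 := by
    rw [lie_lie_comm h26]; exact cube_aux₂ h62 q6 h6 h2
  have g64 : ⁅⁅e 6, e 3⁆, ⁅e 4, ⁅e 6, e 3⁆⁆⁆ = 0 := by
    rw [lie_lie_comm h46]; exact cube_aux₂ h64 q6 h6 h4
  exact ⟨h2,
    h4,
    h6,
    (cube_aux₁ h24 h2 h4).1,
    (cube_aux₁ h26 h2 h6).1,
    (cube_aux₁ h46 h4 h6).1,
    (cube_aux₁ h24 h2 h4).2,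
    (cube_aux₁ h26 h2 h6).2,
    (cube_aux₁ h46 h4 h6).2,
    by simpa only [comm_e24, comm_e26, comm_e46] using cube_aux₂ h24 q2 h2 h4,
    by simpa only [comm_e24, comm_e26, comm_e46] using cube_aux₂ h26 q2 h2 h6,
    by simpa only [comm_e24, comm_e26, comm_e46] using cube_aux₃ (c := e 2) h46 h4 h6,
    by simpa only [comm_e24, comm_e26, comm_e46] using cube_aux₂ h42 q4 h4 h2,
    by simpa only [comm_e24, comm_e26, comm_e46] using cube_aux₃ (c := e 4) h26 h2 h6,
    by simpa only [comm_e24, comm_e26, comm_e46] using cube_aux₂ h46 q4 h4 h6,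
    by simpa only [comm_e24, comm_e26, comm_e46] using cube_aux₃ (c := e 6) h24 h2 h4,
    by simpa only [comm_e24, comm_e26, comm_e46] using cube_aux₂ h62 q6 h6 h2,
    by simpa only [comm_e24, comm_e26, comm_e46] using cube_aux₂ h64 q6 h6 h4,
    by simpa only [comm_e24, comm_e26, comm_e46] using (cube_aux₁ h46 g24 g26).1,
    by simpa only [comm_e24, comm_e26, comm_e46] using (cube_aux₁ h26 g42 g46).1,
    by simpa only [comm_e24, comm_e26, comm_e46] using (cube_aux₁ h24 g62 g64).1,
    by simpa only [comm_e24, comm_e26, comm_e46] using (cube_aux₁ h46 g24 g26).2,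
    by simpa only [comm_e24, comm_e26, comm_e46] using (cube_aux₁ h26 g42 g46).2,
    by simpa only [comm_e24, comm_e26, comm_e46] using (cube_aux₁ h24 g62 g64).2,
    by simpa only [comm_e24, comm_e26, comm_e46] using cube_aux₂ h46 (lie_sq_zero h42 q4) g24 g26,
    by simpa only [comm_e24, comm_e26, comm_e46] using cube_aux₂ h64 (lie_sq_zero h62 q6) g26 g24,
    by simpa only [comm_e24, comm_e26, comm_e46] using cube_aux₂ h62 (lie_sq_zero h64 q6) g46 g42⟩

theorem lie_cubePart_cubePart (u v : Deg1) : ⁅cubePart u, cubePart v⁆ =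
    (u 6 * v 13 - v 6 * u 13 - (u 7 * v 12 - v 7 * u 12) - (u 8 * v 11 - v 8 * u 11)
        - (u 9 * v 10 - v 9 * u 10)) • ⁅e 3, ⁅e 2, ⁅e 4, ⁅e 6, e 3⁆⁆⁆⁆ := by
  obtain ⟨h0, h1, h2, h3, h4, h5, h6, h7, h8, h9, h10, h11, h12, h13, h14, h15, h16, h17, h18, h19, h20, h21, h22, h23, h24, h25, h26⟩ := lie_cube
  simp only [cubePart, add_lie, lie_add, smul_lie, lie_smul, lie_self,
    h0, h1, h2, h3, h4, h5, h6, h7, h8, h9, h10, h11, h12, h13, h14, h15, h16, h17, h18, h19, h20, h21, h22, h23, h24, h25, h26,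
    lie_neg_swap h0, lie_neg_swap h1, lie_neg_swap h2, lie_neg_swap h3, lie_neg_swap h4, lie_neg_swap h5, lie_neg_swap h6, lie_neg_swap h7, lie_neg_swap h8, lie_neg_swap h9, lie_neg_swap h10, lie_neg_swap h11, lie_neg_swap h12, lie_neg_swap h13, lie_neg_swap h14, lie_neg_swap h15, lie_neg_swap h16, lie_neg_swap h17, lie_neg_swap h18, lie_neg_swap h19, lie_neg_swap h20, lie_neg_swap h21, lie_neg_swap h22, lie_neg_swap h23, lie_neg_swap h24, lie_neg_swap h25, lie_neg_swap h26,
    lie_neg_swap (rfl : ⁅e 3, ⁅e 2, ⁅e 4, ⁅e 6, e 3⁆⁆⁆⁆ = _)]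
  module

theorem lie_blocks {L : Type*} [LieRing L] {x₀ x₁ x₅ y₀ y₁ y₅ p q : L}
    (h : ⁅x₀, y₀⁆ = 0 ∧ ⁅x₀, y₁⁆ = 0 ∧ ⁅x₀, y₅⁆ = 0 ∧ ⁅y₀, x₁⁆ = 0 ∧ ⁅x₁, y₁⁆ = 0 ∧ ⁅x₁, y₅⁆ = 0 ∧
      ⁅y₀, x₅⁆ = 0 ∧ ⁅y₁, x₅⁆ = 0 ∧ ⁅x₅, y₅⁆ = 0) :
    ⁅x₀ + x₁ + x₅ + p, y₀ + y₁ + y₅ + q⁆ =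
      (⁅x₀, q⁆ - ⁅y₀, p⁆) + (⁅x₁, q⁆ - ⁅y₁, p⁆) + (⁅x₅, q⁆ - ⁅y₅, p⁆) + ⁅p, q⁆ := by
  obtain ⟨h₁, h₂, h₃, h₄, h₅, h₆, h₇, h₈, h₉⟩ := h
  rw [← lie_skew] at h₄ h₇ h₈
  rw [neg_eq_zero] at h₄ h₇ h₈
  simp only [add_lie, lie_add, h₁, h₂, h₃, h₄, h₅, h₆, h₇, h₈, h₉, zero_add]
  rw [← lie_skew p y₀, ← lie_skew p y₁, ← lie_skew p y₅]
  abel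

/-- The bracket of two elements of degree one: the doublets of `e₀`, `e₁`, `e₅` commute with each
other, and only pair with the component of `e₃`. -/
theorem lie_toG1_toG1 (u v : Deg1) : ⁅toG1 u, toG1 v⁆ =
    (⁅u 0 • e 0 + u 1 • ⁅e 6, e 0⁆, cubePart v⁆ - ⁅v 0 • e 0 + v 1 • ⁅e 6, e 0⁆, cubePart u⁆)
    + (⁅u 2 • e 1 + u 3 • ⁅e 2, e 1⁆, cubePart v⁆ - ⁅v 2 • e 1 + v 3 • ⁅e 2, e 1⁆, cubePart u⁆)
    + (⁅u 4 • e 5 + u 5 • ⁅e 4, e 5⁆, cubePart v⁆ - ⁅v 4 • e 5 + v 5 • ⁅e 4, e 5⁆, cubePart u⁆)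
    + ⁅cubePart u, cubePart v⁆ := by
  have h01 := lie_doublet_doublet (a := e 0) (c := e 6) (a' := e 1) (c' := e 2)
    (lie_e_e rfl) (lie_e_e rfl) (lie_e_e rfl) (lie_e_e rfl)
  have h05 := lie_doublet_doublet (a := e 0) (c := e 6) (a' := e 5) (c' := e 4)
    (lie_e_e rfl) (lie_e_e rfl) (lie_e_e rfl) (lie_e_e rfl)
  have h15 := lie_doublet_doublet (a := e 1) (c := e 2) (a' := e 5) (c' := e 4)
    (lie_e_e rfl) (lie_e_e rfl) (lie_e_e rfl) (lie_e_e rfl)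
  have h0 := lie_doublet_self (a := e 0) (c := e 6) (lie_e_e_e rfl)
  have h1 := lie_doublet_self (a := e 1) (c := e 2) (lie_e_e_e rfl)
  have h5 := lie_doublet_self (a := e 5) (c := e 4) (lie_e_e_e rfl)
  rw [toG1_eq_add_cubePart u, toG1_eq_add_cubePart v]
  exact lie_blocks ⟨h0 _ _ _ _, h01 _ _ _ _, h05 _ _ _ _, h01 _ _ _ _, h1 _ _ _ _, h15 _ _ _ _,
    h05 _ _ _ _, h15 _ _ _ _, h5 _ _ _ _⟩

theorem Λ₁_eq : Λ₁ = toG1 ![0, 1, 1, 1, 1, 0, 2, 1, 1, 1, -1, -1, -1, -2] := by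
  rw [Λ₁, toG1_apply, word_two_three_four, word_two_three_six, word_four_three_six,
    word_six_two_three_four]
  simp only [word, Matrix.cons_val]
  module

theorem Λ₂_eq : Λ₂ = toG1 ![2, 0, 0, -2, -2, -2, -2, 2, 2, -7, 4, -5, 4, 2] := by
  rw [Λ₂, toG1_apply, word_two_three_four, word_two_three_six, word_four_three_six,
    word_six_two_three_four]
  simp only [word, Matrix.cons_val]
  module

theorem lie_Λ₁_Λ₂ : ⁅Λ₁, Λ₂⁆ = 0 := by
  rw [Λ₁_eq, Λ₂_eq, lie_toG1_toG1]
  simp only [lie_doublet_cubePart₀, lie_doublet_cubePart₁, lie_doublet_cubePart₅,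
    lie_cubePart_cubePart]
  simp only [Matrix.cons_val]
  norm_num

/-! ### Nonvanishing of the Chevalley generators: the 27-dimensional loop module -/

/-- The crystal of the 27-dimensional minuscule representation, with the edges of the affine node
added: `(a, b) ∈ edges i` if `f_i` sends the basis vector `a` to the basis vector `b`. -/
def edges : Fin 7 → List (Fin 27 × Fin 27) :=
  ![[(20, 0), (22, 1), (23, 2), (24, 3), (25, 4), (26, 6)],
    [(0, 1), (11, 14), (12, 15), (16, 17), (18, 19), (20, 22)],
    [(1, 2), (9, 11), (10, 12), (13, 16), (19, 21), (22, 23)],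
    [(2, 3), (7, 9), (8, 10), (16, 18), (17, 19), (23, 24)],
    [(3, 4), (5, 7), (10, 13), (12, 16), (15, 17), (24, 25)],
    [(4, 6), (7, 8), (9, 10), (11, 12), (14, 15), (25, 26)],
    [(3, 5), (4, 7), (6, 8), (18, 20), (19, 22), (21, 23)]]

/-- The partial map `f_i` on the crystal. -/
def down (i : Fin 7) (a : Fin 27) : Option (Fin 27) :=
  ((edges i).find? fun x => x.1 = a).map Prod.snd

/-- The partial map `e_i` on the crystal. -/
def up (i : Fin 7) (a : Fin 27) : Option (Fin 27) :=
  ((edges i).find? fun x => x.2 = a).map Prod.fst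

/-- The weight of a vertex of the crystal, evaluated at the `i`-th simple coroot. -/
def wt (i : Fin 7) (a : Fin 27) : ℤ :=
  (if (down i a).isSome then 1 else 0) - (if (up i a).isSome then 1 else 0)

theorem down_bind_up (i : Fin 7) (a : Fin 27) :
    (down i a).bind (up i) = if (down i a).isSome then some a else none := by
  revert i a; decide

theorem up_bind_down (i : Fin 7) (a : Fin 27) :
    (up i a).bind (down i) = if (up i a).isSome then some a else none := by
  revert i a; decide

theorem down_bind_up_comm (i j : Fin 7) (hij : i ≠ j) (a : Fin 27) :
    (down i a).bind (up j) = (up j a).bind (down i) := by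
  revert i j a; decide

theorem wt_down (i j : Fin 7) (a b : Fin 27) (h : down j a = some b) :
    wt i a - wt i b = cartanMatrix i j := by
  have : ∀ i j a, ∀ b ∈ down j a, wt i a - wt i b = cartanMatrix i j := by decide
  exact this i j a b h

theorem wt_up (i j : Fin 7) (a b : Fin 27) (h : up j a = some b) :
    wt i a - wt i b = -cartanMatrix i j := by
  have : ∀ i j a, ∀ b ∈ up j a, wt i a - wt i b = -cartanMatrix i j := by decide
  exact this i j a b h

/-- The entries of the Cartan matrix, as a function. -/
def entry (i j : Fin 7) : ℤ := cartanMatrix i j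

theorem entry_eq_zero_or : ∀ i j : Fin 7, i ≠ j → entry i j = 0 ∨ entry i j = -1 := by decide

theorem down_serre (i j : Fin 7) (hij : i ≠ j) :
    (cartanMatrix i j = 0 ∧ ∀ a, (down i a).bind (down j) = (down j a).bind (down i)) ∨
    (cartanMatrix i j = -1 ∧ (∀ a, (down i a).bind (down i) = none) ∧
      ∀ a, ((down i a).bind (down j)).bind (down i) = none) := by
  have h₁ : ∀ i j, entry i j = 0 → ∀ a, (down i a).bind (down j) = (down j a).bind (down i) := by
    decide
  have h₂ : ∀ i a, (down i a).bind (down i) = none := by decide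
  have h₃ : ∀ i j, entry i j = -1 → ∀ a, ((down i a).bind (down j)).bind (down i) = none := by
    decide
  rcases entry_eq_zero_or i j hij with h | h
  · exact .inl ⟨h, h₁ i j h⟩
  · exact .inr ⟨h, h₂ i, h₃ i j h⟩

theorem up_serre (i j : Fin 7) (hij : i ≠ j) :
    (cartanMatrix i j = 0 ∧ ∀ a, (up i a).bind (up j) = (up j a).bind (up i)) ∨
    (cartanMatrix i j = -1 ∧ (∀ a, (up i a).bind (up i) = none) ∧
      ∀ a, ((up i a).bind (up j)).bind (up i) = none) := by
  have h₁ : ∀ i j, entry i j = 0 → ∀ a, (up i a).bind (up j) = (up j a).bind (up i) := by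
    decide
  have h₂ : ∀ i a, (up i a).bind (up i) = none := by decide
  have h₃ : ∀ i j, entry i j = -1 → ∀ a, ((up i a).bind (up j)).bind (up i) = none := by
    decide
  rcases entry_eq_zero_or i j hij with h | h
  · exact .inl ⟨h, h₁ i j h⟩
  · exact .inr ⟨h, h₂ i, h₃ i j h⟩

/-- The space of the loop module: functions on the crystal with values in
two-sided formal series. -/
abbrev LoopModule : Type := Fin 27 → ℤ → ℂ

/-- The operator attached to a partial map of the crystal and a power of the loop parameter. -/
def shift (p : Fin 27 → Option (Fin 27)) (k : ℤ) : Module.End ℂ LoopModule where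
  toFun φ a n := (p a).elim 0 fun b => φ b (n + k)
  map_add' φ ψ := by
    funext a n
    cases h : p a <;> simp [h]
  map_smul' c φ := by
    funext a n
    cases h : p a <;> simp [h]

/-- A diagonal operator. -/
def diag (w : Fin 27 → ℤ → ℂ) : Module.End ℂ LoopModule := LinearMap.mulLeft ℂ w

theorem shift_apply (p : Fin 27 → Option (Fin 27)) (k : ℤ) (φ : LoopModule) (a : Fin 27) (n : ℤ) :
    shift p k φ a n = (p a).elim 0 fun b => φ b (n + k) := rfl

theorem diag_apply (w : Fin 27 → ℤ → ℂ) (φ : LoopModule) (a : Fin 27) (n : ℤ) :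
    diag w φ a n = w a n * φ a n := rfl

theorem shift_mul (p q : Fin 27 → Option (Fin 27)) (k l : ℤ) :
    shift p k * shift q l = shift (fun a => (p a).bind q) (k + l) := by
  refine LinearMap.ext fun φ => funext fun a => funext fun n => ?_
  simp only [Module.End.mul_apply, shift_apply]
  cases h : p a with
  | none => rfl
  | some b => simp [shift_apply, add_assoc]

theorem shift_none (k : ℤ) : shift (fun _ => none) k = 0 := by
  refine LinearMap.ext fun φ => funext fun a => funext fun n => ?_
  simp [shift_apply]

attribute [local instance] LieRing.ofAssociativeRing LieAlgebra.ofAssociativeAlgebra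

theorem lie_diag_shift (w : Fin 27 → ℤ → ℂ) (p : Fin 27 → Option (Fin 27)) (k : ℤ) (c : ℂ)
    (h : ∀ a b n, p a = some b → w a n - w b (n + k) = c) :
    ⁅diag w, shift p k⁆ = c • shift p k := by
  refine LinearMap.ext fun φ => funext fun a => funext fun n => ?_
  simp only [LieRing.of_associative_ring_bracket, LinearMap.sub_apply, Pi.sub_apply,
    Module.End.mul_apply, diag_apply, shift_apply, LinearMap.smul_apply, Pi.smul_apply, smul_eq_mul]
  cases hp : p a with
  | none => simp
  | some b => simp only [Option.elim_some, diag_apply]; rw [← h a b n hp]; ring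

theorem lie_diag_diag (w w' : Fin 27 → ℤ → ℂ) : ⁅diag w, diag w'⁆ = 0 := by
  refine LinearMap.ext fun φ => funext fun a => funext fun n => ?_
  simp only [LieRing.of_associative_ring_bracket, LinearMap.sub_apply, Pi.sub_apply,
    Module.End.mul_apply, diag_apply, LinearMap.zero_apply, Pi.zero_apply]
  ring

/-- The powers of the loop parameter carried by the Chevalley generators. -/
def loopDeg (i : Fin 7) : ℤ := if i = 0 then 1 else 0

/-- The generators acting on the loop module. The coordinate of `e_i φ` at a vertex `a` is that of `φ`
at `f_i a`. -/
noncomputable def genRep : Gen → Module.End ℂ LoopModule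
  | .e i => shift (down i) (loopDeg i)
  | .f i => shift (up i) (-loopDeg i)
  | .h i => diag fun a _ => wt i a
  | .d => diag fun _ n => -n

/-- The representation of the free Lie algebra on the loop module. -/
noncomputable def freeRep : FreeG →ₗ⁅ℂ⁆ Module.End ℂ LoopModule := FreeLieAlgebra.lift ℂ genRep

theorem freeRep_gen (x : Gen) : freeRep (gen x) = genRep x := FreeLieAlgebra.lift_of_apply genRep x

theorem serre_shift (p : Fin 7 → Fin 27 → Option (Fin 27)) (k : Fin 7 → ℤ) (i j : Fin 7)
    (h : (cartanMatrix i j = 0 ∧ ∀ a, (p i a).bind (p j) = (p j a).bind (p i)) ∨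
      (cartanMatrix i j = -1 ∧ (∀ a, (p i a).bind (p i) = none) ∧
        ∀ a, ((p i a).bind (p j)).bind (p i) = none)) :
    ((LieAlgebra.ad ℂ (Module.End ℂ LoopModule) (shift (p i) (k i))) ^ (1 - cartanMatrix i j).toNat)
      (shift (p j) (k j)) = 0 := by
  rcases h with ⟨h₀, h⟩ | ⟨h₀, h₁, h₂⟩
  · simp only [h₀, sub_zero, Int.toNat_one, pow_one, LieAlgebra.ad_apply,
      LieRing.of_associative_ring_bracket, shift_mul, h, add_comm (k i), sub_self]
  · have h₃ : shift (p i) (k i) * shift (p i) (k i) = 0 := by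
      simp only [shift_mul, h₁, shift_none]
    have h₄ : shift (p i) (k i) * shift (p j) (k j) * shift (p i) (k i) = 0 := by
      simp only [shift_mul, h₂, shift_none]
    rw [h₀, show (1 - (-1 : ℤ)).toNat = 2 from rfl]
    generalize shift (p i) (k i) = x at h₃ h₄ ⊢
    generalize shift (p j) (k j) = y at h₄ ⊢
    have : x * (x * y - y * x) - (x * y - y * x) * x =
      x * x * y - (2 : ℕ) • (x * y * x) + y * (x * x) := by
      rw [two_nsmul, mul_sub, sub_mul]
      simp only [mul_assoc]
      abel
    simp only [pow_succ, pow_zero, one_mul, Module.End.mul_apply, LieAlgebra.ad_apply,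
      LieRing.of_associative_ring_bracket, this, h₃, h₄]
    simp

theorem ad_pow_freeRep (x y : FreeG) (n : ℕ) :
    freeRep (((LieAlgebra.ad ℂ FreeG x) ^ n) y) =
      ((LieAlgebra.ad ℂ (Module.End ℂ LoopModule) (freeRep x)) ^ n) (freeRep y) := by
  induction n with
  | zero => rfl
  | succ n ih => simp only [pow_succ', Module.End.mul_apply, LieAlgebra.ad_apply, LieHom.map_lie, ih]

theorem freeRep_relator {r : FreeG} (hr : Relator r) : freeRep r = 0 := by
  cases hr with
  | serre_e i j hij =>
    rw [ad_pow_freeRep, freeRep_gen, freeRep_gen]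
    exact serre_shift down loopDeg i j (down_serre i j hij)
  | serre_f i j hij =>
    rw [ad_pow_freeRep, freeRep_gen, freeRep_gen]
    exact serre_shift up (fun i => -loopDeg i) i j (up_serre i j hij)
  | h_h i j => rw [LieHom.map_lie, freeRep_gen, freeRep_gen]; exact lie_diag_diag _ _
  | h_e i j =>
    rw [map_sub, map_smul, LieHom.map_lie, freeRep_gen, freeRep_gen, sub_eq_zero]
    refine lie_diag_shift _ _ _ _ fun a b n h => ?_
    exact_mod_cast wt_down i j a b h
  | h_f i j =>
    rw [map_add, map_smul, LieHom.map_lie, freeRep_gen, freeRep_gen, ← eq_neg_iff_add_eq_zero]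
    have h := lie_diag_shift (fun a _ => wt i a) (up j) (-loopDeg j) (-(cartanMatrix i j : ℂ))
      fun a b n h => by exact_mod_cast wt_up i j a b h
    exact h.trans (LinearMap.ext fun φ => funext fun a => funext fun n => neg_mul _ _)
  | e_f i j =>
    rw [map_sub, map_smul, LieHom.map_lie, freeRep_gen, freeRep_gen, freeRep_gen, sub_eq_zero]
    simp only [genRep, LieRing.of_associative_ring_bracket, shift_mul]
    split_ifs with hij
    · subst hij
      refine LinearMap.ext fun φ => funext fun a => funext fun n => ?_
      simp only [down_bind_up, up_bind_down, LinearMap.sub_apply, Pi.sub_apply, shift_apply,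
        one_smul, diag_apply, wt]
      split_ifs <;> simp
    · simp only [down_bind_up_comm i j hij, add_comm (loopDeg i), sub_self, zero_smul]
  | d_h i => rw [LieHom.map_lie, freeRep_gen, freeRep_gen]; exact lie_diag_diag _ _
  | d_e i =>
    rw [map_sub, map_smul, LieHom.map_lie, freeRep_gen, freeRep_gen, sub_eq_zero]
    refine lie_diag_shift _ _ _ _ fun a b n h => ?_
    simp [loopDeg]
  | d_f i =>
    rw [map_add, map_smul, LieHom.map_lie, freeRep_gen, freeRep_gen, ← eq_neg_iff_add_eq_zero]
    have h := lie_diag_shift (fun _ n => -n) (up i) (-loopDeg i) (-(if i = 0 then 1 else 0))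
      fun a b n h => by simp [loopDeg]
    exact h.trans (LinearMap.ext fun φ => funext fun a => funext fun n => neg_mul _ _)

theorem relIdeal_le_ker : relIdeal ≤ freeRep.ker :=
  LieSubmodule.lieSpan_le.2 fun _ hr => LieHom.mem_ker.2 (freeRep_relator hr)

/-- The generator `e_i` acts on the loop module by a nonzero operator. -/
theorem e_ne_zero (i : Fin 7) : e i ≠ 0 := by
  intro h
  have h₁ : gen (.e i) ∈ relIdeal := (LieSubmodule.Quotient.mk_eq_zero' (N := relIdeal)).1 h
  have h₂ : shift (down i) (loopDeg i) = 0 := by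
    have := LieHom.mem_ker.1 (relIdeal_le_ker h₁)
    rwa [freeRep_gen] at this
  have h₃ : ∀ i, ∃ a, (down i a).isSome := by decide
  obtain ⟨a, ha⟩ := h₃ i
  obtain ⟨b, hb⟩ := Option.isSome_iff_exists.1 ha
  have := congrFun (congrFun (LinearMap.congr_fun h₂ fun _ _ => 1) a) 0
  simp [shift_apply, hb] at this

/-! ### Linear independence of the root vectors -/

theorem Cartan.root_apply (H : Cartan) : H.root =
    ![2 * H.1 0 - H.1 6 + H.2, 2 * H.1 1 - H.1 2, -H.1 1 + 2 * H.1 2 - H.1 3,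
      -H.1 2 + 2 * H.1 3 - H.1 4 - H.1 6, -H.1 3 + 2 * H.1 4 - H.1 5, -H.1 4 + 2 * H.1 5,
      -H.1 0 - H.1 3 + 2 * H.1 6] := by
  funext j
  rw [Cartan.root, Cartan.form_coroot]
  fin_cases j <;> simp [Fin.sum_univ_succ, cartanMatrix] <;> ring

/-- The pairing of an element of the Cartan subalgebra with the canonical central element. -/
theorem Cartan.sum_root (H : Cartan) : H.root 0 + H.root 1 + 2 * H.root 2 + 3 * H.root 3
    + 2 * H.root 4 + H.root 5 + 2 * H.root 6 = H.2 := by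
  simp [Cartan.root_apply]
  ring

/-- An element of the Cartan subalgebra at which the simple roots take given values. -/
noncomputable def ofRoot (w : Fin 7 → ℂ) : Cartan :=
  (![0, (4 * w 1 + 5 * w 2 + 6 * w 3 + 4 * w 4 + 2 * w 5 + 3 * w 6) / 3,
      (5 * w 1 + 10 * w 2 + 12 * w 3 + 8 * w 4 + 4 * w 5 + 6 * w 6) / 3,
      (6 * w 1 + 12 * w 2 + 18 * w 3 + 12 * w 4 + 6 * w 5 + 9 * w 6) / 3,
      (4 * w 1 + 8 * w 2 + 12 * w 3 + 10 * w 4 + 5 * w 5 + 6 * w 6) / 3,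
      (2 * w 1 + 4 * w 2 + 6 * w 3 + 5 * w 4 + 4 * w 5 + 3 * w 6) / 3,
      (3 * w 1 + 6 * w 2 + 9 * w 3 + 6 * w 4 + 3 * w 5 + 6 * w 6) / 3],
    w 0 + w 1 + 2 * w 2 + 3 * w 3 + 2 * w 4 + w 5 + 2 * w 6)

theorem root_ofRoot (w : Fin 7 → ℂ) : (ofRoot w).root = w := by
  rw [Cartan.root_apply]
  funext j
  fin_cases j <;> simp [ofRoot] <;> ring

theorem lie_e_ne_zero {i : Fin 7} {x : AffE6} (h : ⁅f i, ⁅e i, x⁆⁆ = x) (hx : x ≠ 0) :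
    ⁅e i, x⁆ ≠ 0 := fun h₀ => hx (by rw [← h, h₀, lie_zero])

theorem lie_f_lie_e_rootVec :
    ⁅f 6, ⁅e 6, e 0⁆⁆ = e 0 ∧ ⁅f 2, ⁅e 2, e 1⁆⁆ = e 1 ∧ ⁅f 4, ⁅e 4, e 5⁆⁆ = e 5 ∧
    ⁅f 2, ⁅e 2, e 3⁆⁆ = e 3 ∧ ⁅f 4, ⁅e 4, e 3⁆⁆ = e 3 ∧ ⁅f 6, ⁅e 6, e 3⁆⁆ = e 3 ∧
    ⁅f 2, ⁅e 2, ⁅e 4, e 3⁆⁆⁆ = ⁅e 4, e 3⁆ ∧ ⁅f 2, ⁅e 2, ⁅e 6, e 3⁆⁆⁆ = ⁅e 6, e 3⁆ ∧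
    ⁅f 4, ⁅e 4, ⁅e 6, e 3⁆⁆⁆ = ⁅e 6, e 3⁆ ∧
    ⁅f 2, ⁅e 2, ⁅e 4, ⁅e 6, e 3⁆⁆⁆⁆ = ⁅e 4, ⁅e 6, e 3⁆⁆ := by
  simp [lie_f_e, comm_f_e, lie_f_lie_e, lie_coroot_lie_e, lie_coroot_e, cartanMatrix,
    -lie_skew, -lie_lie]

theorem rootVec_ne_zero (i : Fin 14) : rootVec i ≠ 0 := by
  obtain ⟨h₁, h₂, h₃, h₄, h₅, h₆, h₇, h₈, h₉, h₀⟩ := lie_f_lie_e_rootVec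
  have h43 := lie_e_ne_zero h₅ (e_ne_zero 3)
  have h63 := lie_e_ne_zero h₆ (e_ne_zero 3)
  have h463 := lie_e_ne_zero h₉ h63
  fin_cases i
  · exact e_ne_zero 0
  · exact lie_e_ne_zero h₁ (e_ne_zero 0)
  · exact e_ne_zero 1
  · exact lie_e_ne_zero h₂ (e_ne_zero 1)
  · exact e_ne_zero 5
  · exact lie_e_ne_zero h₃ (e_ne_zero 5)
  · exact e_ne_zero 3
  · exact lie_e_ne_zero h₄ (e_ne_zero 3)
  · exact h43
  · exact h63
  · exact lie_e_ne_zero h₇ h43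
  · exact lie_e_ne_zero h₈ h63
  · exact h463
  · exact lie_e_ne_zero h₀ h463

/-- Integers separating the roots which occur in degree one and the simple roots `2, 4, 6`. -/
def sepRoot : Fin 7 → ℤ := ![200, 300, 1, 100, 3, 400, 9]

/-- The values at `sepRoot` of the simple roots `2, 4, 6` and of the roots of degree one. -/
def sepWeight : Fin 3 ⊕ Fin 14 → ℤ :=
  Sum.elim ![1, 3, 9] ![200, 209, 300, 301, 400, 403, 100, 101, 103, 109, 104, 110, 112, 113]

/-- The root vectors `e₂, e₄, e₆` and those of degree one. -/
noncomputable def posVec : Fin 3 ⊕ Fin 14 → AffE6 := Sum.elim (fun i => e (node i)) rootVec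

/-- They are eigenvectors, for distinct eigenvalues, of one element of the Cartan subalgebra. -/
theorem linearIndependent_posVec : LinearIndependent ℂ posVec := by
  refine Module.End.eigenvectors_linearIndependent'
    (LieAlgebra.ad ℂ AffE6 (ofRoot fun j => (sepRoot j : ℂ)).toG)
    (fun i => (sepWeight i : ℂ)) ?_ _ ?_
  · have h : Function.Injective sepWeight := by decide
    exact Int.cast_injective.comp h
  · rintro (i | i)
    · refine ⟨?_, e_ne_zero _⟩
      rw [Module.End.mem_eigenspace_iff, LieAlgebra.ad_apply]
      change ⁅_, e (node i)⁆ = _ • e (node i)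
      rw [lie_toG_e]
      have := root_ofRoot fun j => (sepRoot j : ℂ)
      have h := congrFun this (node i)
      rw [Cartan.root] at h
      rw [h]
      fin_cases i <;> rfl
    · refine ⟨?_, rootVec_ne_zero i⟩
      rw [Module.End.mem_eigenspace_iff, LieAlgebra.ad_apply]
      change ⁅_, rootVec i⁆ = _ • rootVec i
      rw [lie_toG_rootVec, root_ofRoot]
      congr 1
      fin_cases i <;> simp [weights, sepRoot, sepWeight] <;> norm_num

/-- The element `∑ z_i e_i + v`, with `v` of degree one. -/
noncomputable def toPos : (Fin 3 → ℂ) × Deg1 →ₗ[ℂ] AffE6 :=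
  (Fintype.linearCombination ℂ fun i => e (node i)).coprod toG1

theorem toPos_apply (z : Fin 3 → ℂ) (v : Deg1) :
    toPos (z, v) = ∑ i, z i • e (node i) + toG1 v := by
  simp [toPos, Fintype.linearCombination_apply]

theorem ker_toPos : LinearMap.ker toPos = ⊥ := by
  rw [LinearMap.ker_eq_bot']
  rintro ⟨z, v⟩ h
  rw [toPos_apply, toG1, Fintype.linearCombination_apply] at h
  have := Fintype.linearIndependent_iff.1 linearIndependent_posVec (Sum.elim z v)
    (by rw [Fintype.sum_sum_type]; exact h)
  ext i
  · exact this (.inl i)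
  · exact this (.inr i)

theorem toPos_injective : Function.Injective toPos := LinearMap.ker_eq_bot.1 ker_toPos

theorem toG1_injective : Function.Injective toG1 := fun u v h => by
  have := @toPos_injective (0, u) (0, v) (by simpa [toPos_apply] using h)
  exact (Prod.ext_iff.1 this).2

/-- Coordinates on `𝔤` which recover `z` and `v` from `∑ z_i e_i + v`. -/
theorem exists_coord : ∃ P : AffE6 →ₗ[ℂ] (Fin 3 → ℂ) × Deg1, ∀ z v, P (toPos (z, v)) = (z, v) := by
  obtain ⟨P, hP⟩ := LinearMap.exists_leftInverse_of_injective toPos ker_toPos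
  exact ⟨P, fun z v => LinearMap.congr_fun hP (z, v)⟩

/-! ### The Borel subalgebra -/

/-- The sum of the eigenspaces, for nonnegative integral eigenvalues, of the element at which all
simple roots take the value `1`. -/
noncomputable def nonnegPart : Submodule ℂ AffE6 :=
  ⨆ n : ℕ, (LieAlgebra.ad ℂ AffE6 (ofRoot fun _ => 1).toG).eigenspace (n : ℂ)

theorem mem_nonnegPart {x : AffE6} (n : ℕ) (h : ⁅(ofRoot fun _ => 1).toG, x⁆ = (n : ℂ) • x) :
    x ∈ nonnegPart :=
  Submodule.mem_iSup_of_mem n (Module.End.mem_eigenspace_iff.2 h)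

theorem lie_mem_nonnegPart {x y : AffE6} (hx : x ∈ nonnegPart) (hy : y ∈ nonnegPart) :
    ⁅x, y⁆ ∈ nonnegPart := by
  rw [nonnegPart] at hx
  induction hx using Submodule.iSup_induction' with
  | zero => simp [nonnegPart.zero_mem]
  | add x₁ x₂ _ _ h₁ h₂ => rw [add_lie]; exact nonnegPart.add_mem h₁ h₂
  | mem m x hx =>
    rw [nonnegPart] at hy
    induction hy using Submodule.iSup_induction' with
    | zero => simp [nonnegPart.zero_mem]
    | add y₁ y₂ _ _ h₁ h₂ => rw [lie_add]; exact nonnegPart.add_mem h₁ h₂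
    | mem n y hy =>
      rw [Module.End.mem_eigenspace_iff, LieAlgebra.ad_apply] at hx hy
      refine mem_nonnegPart (m + n) ?_
      rw [leibniz_lie, hx, hy, smul_lie, lie_smul, ← add_smul, Nat.cast_add]

theorem borel_le_nonnegPart : borel ≤ nonnegPart := by
  refine sup_le (Submodule.span_le.2 ?_) fun x hx => ?_
  · rintro _ ⟨H, rfl⟩
    exact mem_nonnegPart 0 (by simp [lie_toG_toG])
  · change x ∈ LieSubalgebra.lieSpan ℂ AffE6 (Set.range e) at hx
    induction hx using LieSubalgebra.lieSpan_induction with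
    | mem x hx =>
      obtain ⟨i, rfl⟩ := hx
      refine mem_nonnegPart 1 ?_
      rw [lie_toG_e]
      exact congrArg (· • e i) ((congrFun (root_ofRoot fun _ => 1) i).trans Nat.cast_one.symm)
    | zero => exact nonnegPart.zero_mem
    | add x y _ _ hx hy => exact nonnegPart.add_mem hx hy
    | smul a x _ hx => exact nonnegPart.smul_mem a hx
    | lie x y _ _ hx hy => exact lie_mem_nonnegPart hx hy

theorem sum_f_eq_zero {y : Fin 3 → ℂ} (h : ∑ i, y i • f (node i) = 0) : y = 0 := by
  have key (j : Fin 3) : y j = 0 := by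
    have h₁ : ⁅e (node j), ⁅e (node j), ∑ i, y i • f (node i)⁆⁆ = 0 := by rw [h, lie_zero, lie_zero]
    have h₂ : ∀ i, ⁅e (node j), ⁅e (node j), y i • f (node i)⁆⁆ =
        if i = j then (-2 * y j) • e (node j) else 0 := by
      intro i
      rw [lie_smul, lie_e_f, lie_smul]
      have hinj : node j = node i ↔ i = j :=
        (by decide : ∀ i j, node j = node i ↔ i = j) i j
      simp only [hinj]
      split_ifs with hij
      · subst hij
        have hd : cartanMatrix (node i) (node i) = 2 := by fin_cases i <;> rfl
        rw [one_smul, ← lie_skew, lie_coroot_e, hd, smul_neg, smul_smul, ← neg_smul]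
        congr 1
        push_cast
        ring
      · simp
    rw [lie_sum, lie_sum] at h₁
    simp only [h₂, Finset.sum_ite_eq', Finset.mem_univ, if_true] at h₁
    rcases smul_eq_zero.1 h₁ with h₃ | h₃
    · simpa using h₃
    · exact absurd h₃ (e_ne_zero _)
  exact funext key

theorem sum_f_notMem_borel {y : Fin 3 → ℂ} (h : ∑ i, y i • f (node i) ∈ borel) : y = 0 := by
  refine sum_f_eq_zero ?_
  have h₁ : ∑ i, y i • f (node i) ∈
      (LieAlgebra.ad ℂ AffE6 (ofRoot fun _ => 1).toG).eigenspace (-1) := by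
    refine Submodule.sum_mem _ fun i _ => Submodule.smul_mem _ _ ?_
    rw [Module.End.mem_eigenspace_iff, LieAlgebra.ad_apply, lie_toG_f]
    exact congrArg (fun c => -c • f (node i)) (congrFun (root_ofRoot fun _ => 1) (node i))
  have h₂ := Module.End.eigenspaces_iSupIndep (LieAlgebra.ad ℂ AffE6 (ofRoot fun _ => 1).toG) (-1)
  refine Submodule.disjoint_def.1 h₂ _ h₁ ?_
  refine (iSup_le fun n : ℕ => ?_ : nonnegPart ≤ _) (borel_le_nonnegPart h)
  refine le_iSup₂_of_le (n : ℂ) ?_ le_rfl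
  intro hn
  have : ((n + 1 : ℕ) : ℂ) = 0 := by push_cast; rw [hn]; ring
  exact Nat.succ_ne_zero n (Nat.cast_eq_zero.1 this)

theorem toG_mem_borel (H : Cartan) : H.toG ∈ borel :=
  Submodule.mem_sup_left (Submodule.subset_span ⟨H, rfl⟩)

theorem mem_borel_of_mem_lieSpan {x : AffE6}
    (h : x ∈ LieSubalgebra.lieSpan ℂ AffE6 (Set.range e)) : x ∈ borel :=
  Submodule.mem_sup_right h

theorem e_mem_borel (i : Fin 7) : e i ∈ borel :=
  mem_borel_of_mem_lieSpan (LieSubalgebra.subset_lieSpan ⟨i, rfl⟩)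

theorem toG1_mem_borel (v : Deg1) : toG1 v ∈ borel := by
  have h₁ (i : Fin 7) : e i ∈ LieSubalgebra.lieSpan ℂ AffE6 (Set.range e) :=
    LieSubalgebra.subset_lieSpan ⟨i, rfl⟩
  have h₂ (i : Fin 7) {x : AffE6} (hx : x ∈ LieSubalgebra.lieSpan ℂ AffE6 (Set.range e)) :
      ⁅e i, x⁆ ∈ LieSubalgebra.lieSpan ℂ AffE6 (Set.range e) := LieSubalgebra.lie_mem _ (h₁ i) hx
  refine mem_borel_of_mem_lieSpan ?_
  rw [toG1, Fintype.linearCombination_apply]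
  refine sum_mem fun i _ => (LieSubalgebra.lieSpan ℂ AffE6 (Set.range e)).smul_mem _ ?_
  fin_cases i
  · exact h₁ 0
  · exact h₂ 6 (h₁ 0)
  · exact h₁ 1
  · exact h₂ 2 (h₁ 1)
  · exact h₁ 5
  · exact h₂ 4 (h₁ 5)
  · exact h₁ 3
  · exact h₂ 2 (h₁ 3)
  · exact h₂ 4 (h₁ 3)
  · exact h₂ 6 (h₁ 3)
  · exact h₂ 2 (h₂ 4 (h₁ 3))
  · exact h₂ 2 (h₂ 6 (h₁ 3))
  · exact h₂ 4 (h₂ 6 (h₁ 3))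
  · exact h₂ 2 (h₂ 4 (h₂ 6 (h₁ 3)))

theorem eq_zero_of_mem_borel {H : Cartan} {z y : Fin 3 → ℂ} {v : Deg1}
    (h : toG0 H z y + toG1 v ∈ borel) : y = 0 := by
  refine sum_f_notMem_borel ?_
  have h₁ : H.toG + ∑ i, z i • e (node i) + toG1 v ∈ borel :=
    add_mem (add_mem (toG_mem_borel H)
      (sum_mem fun i _ => Submodule.smul_mem _ _ (e_mem_borel _))) (toG1_mem_borel v)
  have := sub_mem h h₁
  rwa [toG0, show H.toG + ∑ i, z i • e (node i) + ∑ i, y i • f (node i) + toG1 v -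
    (H.toG + ∑ i, z i • e (node i) + toG1 v) = ∑ i, y i • f (node i) by abel] at this

theorem toG0_add_toG1_mem_borel (H : Cartan) (z : Fin 3 → ℂ) (v : Deg1) :
    toG0 H z 0 + toG1 v ∈ borel := by
  rw [toG0]
  refine add_mem (add_mem (add_mem (toG_mem_borel H)
      (sum_mem fun i _ => Submodule.smul_mem _ _ (e_mem_borel _))) ?_) (toG1_mem_borel v)
  simp

/-! ### The component of degree zero -/

/-- `toG0` as a linear map. -/
noncomputable def toG0Lin : Cartan × (Fin 3 → ℂ) × (Fin 3 → ℂ) →ₗ[ℂ] AffE6 where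
  toFun x := toG0 x.1 x.2.1 x.2.2
  map_add' x y := by
    simp only [toG0, Cartan.toG, Prod.fst_add, Prod.snd_add, Pi.add_apply, add_smul,
      Finset.sum_add_distrib]
    abel
  map_smul' c x := by
    simp only [toG0, Cartan.toG, Prod.smul_fst, Prod.smul_snd, Pi.smul_apply, smul_eq_mul,
      mul_smul, ← Finset.smul_sum, ← smul_add, RingHom.id_apply]

theorem toG0Lin_apply (x : Cartan × (Fin 3 → ℂ) × (Fin 3 → ℂ)) :
    toG0Lin x = toG0 x.1 x.2.1 x.2.2 := rfl

/-- The span of the simple coroots and of `e_i, f_i`, `i = 2, 4, 6`: the component of degree zero of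
the derived algebra. -/
noncomputable def derZero : Submodule ℂ AffE6 :=
  Submodule.span ℂ (Set.range (Sum.elim coroot
    (Sum.elim (fun i : Fin 3 => e (node i)) fun i : Fin 3 => f (node i))))

instance : FiniteDimensional ℂ derZero := FiniteDimensional.span_of_finite ℂ (Set.finite_range _)

theorem coroot_mem (i : Fin 7) : coroot i ∈ derZero := Submodule.subset_span ⟨.inl i, rfl⟩
theorem e_mem (i : Fin 3) : e (node i) ∈ derZero := Submodule.subset_span ⟨.inr (.inl i), rfl⟩
theorem f_mem (i : Fin 3) : f (node i) ∈ derZero := Submodule.subset_span ⟨.inr (.inr i), rfl⟩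

theorem toG0_mem {H : Cartan} (hH : H.2 = 0) (z y : Fin 3 → ℂ) : toG0 H z y ∈ derZero := by
  rw [toG0, Cartan.toG, hH, zero_smul, add_zero]
  exact add_mem (add_mem (sum_mem fun i _ => derZero.smul_mem _ (coroot_mem i))
    (sum_mem fun i _ => derZero.smul_mem _ (e_mem i)))
    (sum_mem fun i _ => derZero.smul_mem _ (f_mem i))

theorem DegZero.toG_eq (V : DegZero) : V.toG = toG0 (V.u, 0) V.x V.y := by
  simp [DegZero.toG, toG0, Cartan.toG]

theorem DegZero.toG_mem (V : DegZero) : V.toG ∈ derZero := by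
  rw [V.toG_eq]; exact toG0_mem rfl _ _

theorem exists_degZero {x : AffE6} (hx : x ∈ derZero) : ∃ V : DegZero, V.toG = x := by
  induction hx using Submodule.span_induction with
  | zero => exact ⟨⟨0, 0, 0⟩, by simp [DegZero.toG]⟩
  | add a b _ _ ha hb =>
    obtain ⟨V, rfl⟩ := ha
    obtain ⟨W, rfl⟩ := hb
    refine ⟨⟨V.u + W.u, V.x + W.x, V.y + W.y⟩, ?_⟩
    simp only [DegZero.toG, Pi.add_apply, add_smul, Finset.sum_add_distrib]
    abel
  | smul c a _ ha =>
    obtain ⟨V, rfl⟩ := ha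
    refine ⟨⟨c • V.u, c • V.x, c • V.y⟩, ?_⟩
    simp only [DegZero.toG, Pi.smul_apply, smul_eq_mul, mul_smul, ← Finset.smul_sum, ← smul_add]
  | mem a ha =>
    obtain ⟨i | i | i, rfl⟩ := ha
    · exact ⟨⟨Pi.single i 1, 0, 0⟩, by simp [DegZero.toG, Pi.single_apply]⟩
    · exact ⟨⟨0, Pi.single i 1, 0⟩, by simp [DegZero.toG, Pi.single_apply]⟩
    · exact ⟨⟨0, 0, Pi.single i 1⟩, by simp [DegZero.toG, Pi.single_apply]⟩

theorem lie_toG0_mem (H : Cartan) (z y : Fin 3 → ℂ) {x : AffE6} (hx : x ∈ derZero) :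
    ⁅toG0 H z y, x⁆ ∈ derZero := by
  induction hx using Submodule.span_induction with
  | zero => simp
  | add a b _ _ ha hb => rw [lie_add]; exact add_mem ha hb
  | smul c a _ ha => rw [lie_smul]; exact derZero.smul_mem c ha
  | mem a ha =>
    have hee : ∀ i j, cartanMatrix (node i) (node j) = 0 ∨ i = j := by
      intro i j
      fin_cases i <;> fin_cases j <;> simp [node, cartanMatrix]
    rw [toG0, add_lie, add_lie, sum_lie, sum_lie]
    obtain ⟨i | i | i, rfl⟩ := ha
    · change ⁅H.toG, coroot i⁆ + ∑ j, ⁅z j • e (node j), coroot i⁆ + ∑ j, ⁅y j • f (node j), coroot i⁆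
        ∈ derZero
      refine add_mem (add_mem ?_ (sum_mem fun j _ => ?_)) (sum_mem fun j _ => ?_)
      · rw [lie_toG_coroot]; exact zero_mem _
      · rw [smul_lie, ← lie_skew, lie_coroot_e]
        exact derZero.smul_mem _ (neg_mem (derZero.smul_mem _ (e_mem j)))
      · rw [smul_lie, ← lie_skew, lie_coroot_f]
        exact derZero.smul_mem _ (neg_mem (derZero.smul_mem _ (f_mem j)))
    · change ⁅H.toG, e (node i)⁆ + ∑ j, ⁅z j • e (node j), e (node i)⁆ +
        ∑ j, ⁅y j • f (node j), e (node i)⁆ ∈ derZero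
      refine add_mem (add_mem ?_ (sum_mem fun j _ => ?_)) (sum_mem fun j _ => ?_)
      · rw [lie_toG_e]; exact derZero.smul_mem _ (e_mem i)
      · rw [smul_lie]
        refine derZero.smul_mem _ ?_
        rcases hee j i with h | rfl
        · rw [lie_e_e h]; exact zero_mem _
        · rw [lie_self]; exact zero_mem _
      · rw [smul_lie, ← lie_skew, lie_e_f]
        exact derZero.smul_mem _ (neg_mem (derZero.smul_mem _ (coroot_mem _)))
    · change ⁅H.toG, f (node i)⁆ + ∑ j, ⁅z j • e (node j), f (node i)⁆ +
        ∑ j, ⁅y j • f (node j), f (node i)⁆ ∈ derZero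
      refine add_mem (add_mem ?_ (sum_mem fun j _ => ?_)) (sum_mem fun j _ => ?_)
      · rw [lie_toG_f]; exact derZero.smul_mem _ (f_mem i)
      · rw [smul_lie, lie_e_f]
        exact derZero.smul_mem _ (derZero.smul_mem _ (coroot_mem _))
      · rw [smul_lie]
        refine derZero.smul_mem _ ?_
        rcases hee j i with h | rfl
        · rw [lie_f_f h]; exact zero_mem _
        · rw [lie_self]; exact zero_mem _

theorem toG0_eq_add_scal (H : Cartan) (z y : Fin 3 → ℂ) :
    toG0 H z y = toG0 (H.1, 0) z y + H.2 • scal := by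
  simp only [toG0, Cartan.toG, zero_smul, add_zero]
  abel

theorem lie_toG0_toG0_mem (H K : Cartan) (z y z' y' : Fin 3 → ℂ) :
    ⁅toG0 H z y, toG0 K z' y'⁆ ∈ derZero := by
  rw [toG0_eq_add_scal K, lie_add, lie_smul]
  refine add_mem (lie_toG0_mem H z y (toG0_mem rfl z' y')) (derZero.smul_mem _ ?_)
  rw [toG0, add_lie, add_lie, sum_lie, sum_lie, lie_toG_scal, zero_add]
  refine add_mem (sum_mem fun j _ => ?_) (sum_mem fun j _ => ?_)
  · rw [smul_lie, ← lie_skew, lie_scal_e]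
    exact derZero.smul_mem _ (neg_mem (derZero.smul_mem _ (e_mem j)))
  · rw [smul_lie, ← lie_skew, lie_scal_f]
    exact derZero.smul_mem _ (neg_mem (derZero.smul_mem _ (f_mem j)))

theorem derZero_le_range : derZero ≤ LinearMap.range toG0Lin := by
  intro x hx
  obtain ⟨V, rfl⟩ := exists_degZero hx
  exact ⟨((V.u, 0), V.x, V.y), V.toG_eq.symm⟩

theorem lie_toG0_mem_range (H : Cartan) (z y : Fin 3 → ℂ) :
    ∀ x ∈ LinearMap.range toG0Lin, ⁅toG0 H z y, x⁆ ∈ LinearMap.range toG0Lin := by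
  rintro _ ⟨x, rfl⟩
  exact derZero_le_range (lie_toG0_toG0_mem H x.1 z y x.2.1 x.2.2)

theorem exists_gaugeFlow_derZero (H : Cartan) (z y : Fin 3 → ℂ) {x : AffE6} (hx : x ∈ derZero) :
    ∃ x' ∈ derZero, GaugeFlow (toG0 H z y) 0 x x' :=
  exists_gaugeFlow derZero (fun _ h => lie_toG0_mem H z y h) hx

theorem neg_toG0 (H : Cartan) (z y : Fin 3 → ℂ) : -toG0 H z y = toG0 (-H) (-z) (-y) :=
  (toG0Lin.map_neg (H, z, y)).symm

theorem exists_gaugeFlow_derZero' (H : Cartan) (z y : Fin 3 → ℂ) {x : AffE6} (hx : x ∈ derZero) :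
    ∃ x' ∈ derZero, GaugeFlow (toG0 H z y) 0 x' x := by
  obtain ⟨x', hx', h⟩ := exists_gaugeFlow_derZero (-H) (-z) (-y) hx
  refine ⟨x', hx', ?_⟩
  have := h.symm
  rwa [← neg_toG0, neg_neg] at this

/-! ### Exponentials in degree one -/

/-- The torus acting on the component of degree one, in coordinates. -/
def torus (X : Fin 7 → ℂ) (v : Deg1) : Deg1 :=
  ![X 0 * v 0, X 0 * X 6 * v 1, X 1 * v 2, X 1 * X 2 * v 3, X 5 * v 4, X 4 * X 5 * v 5, X 3 * v 6,
    X 3 * X 2 * v 7, X 3 * X 4 * v 8, X 3 * X 6 * v 9, X 3 * X 2 * X 4 * v 10,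
    X 3 * X 2 * X 6 * v 11, X 3 * X 4 * X 6 * v 12, X 3 * X 2 * X 4 * X 6 * v 13]

/-- The exponential of `∑ a_i ad e_i` on the component of degree one, in coordinates. -/
def raiseExp (a : Fin 3 → ℂ) (v : Deg1) : Deg1 :=
  ![v 0, v 1 + a 2 * v 0, v 2, v 3 + a 0 * v 2, v 4, v 5 + a 1 * v 4, v 6,
    v 7 + a 0 * v 6, v 8 + a 1 * v 6, v 9 + a 2 * v 6,
    v 10 + a 0 * v 8 + a 1 * v 7 + a 0 * a 1 * v 6,
    v 11 + a 0 * v 9 + a 2 * v 7 + a 0 * a 2 * v 6,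
    v 12 + a 1 * v 9 + a 2 * v 8 + a 1 * a 2 * v 6,
    v 13 + a 0 * v 12 + a 1 * v 11 + a 2 * v 10 + a 0 * a 1 * v 9 + a 0 * a 2 * v 8 + a 1 * a 2 * v 7
      + a 0 * a 1 * a 2 * v 6]

/-- The exponential of `∑ l_i ad f_i` on the component of degree one, in coordinates. -/
def lowerExp (l : Fin 3 → ℂ) (v : Deg1) : Deg1 :=
  ![v 0 + l 2 * v 1, v 1, v 2 + l 0 * v 3, v 3, v 4 + l 1 * v 5, v 5,
    v 6 + l 0 * v 7 + l 1 * v 8 + l 2 * v 9 + l 0 * l 1 * v 10 + l 0 * l 2 * v 11 + l 1 * l 2 * v 12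
      + l 0 * l 1 * l 2 * v 13,
    v 7 + l 1 * v 10 + l 2 * v 11 + l 1 * l 2 * v 13,
    v 8 + l 0 * v 10 + l 2 * v 12 + l 0 * l 2 * v 13,
    v 9 + l 0 * v 11 + l 1 * v 12 + l 0 * l 1 * v 13,
    v 10 + l 2 * v 13, v 11 + l 1 * v 13, v 12 + l 0 * v 13, v 13]

section Derivatives

variable {s : ℂ} {v : ℂ → Deg1} {v' : Deg1}

theorem hasDerivAt_raiseExp {a : ℂ → Fin 3 → ℂ} {a' : Fin 3 → ℂ} (ha : HasDerivAt a a' s)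
    (hv : HasDerivAt v v' s) : HasDerivAt (fun z => raiseExp (a z) (v z))
      (raiseExp (a s) v' + act 0 a' 0 (raiseExp (a s) (v s))) s := by
  have a₀ := hasDerivAt_pi.1 ha
  have w := hasDerivAt_pi.1 hv
  refine hasDerivAt_pi.2 fun i => ?_
  fin_cases i
  · exact (w 0).congr_deriv (by simp [raiseExp, act])
  · exact ((w 1).add ((a₀ 2).mul (w 0))).congr_deriv (by simp [raiseExp, act]; ring)
  · exact (w 2).congr_deriv (by simp [raiseExp, act])
  · exact ((w 3).add ((a₀ 0).mul (w 2))).congr_deriv (by simp [raiseExp, act]; ring)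
  · exact (w 4).congr_deriv (by simp [raiseExp, act])
  · exact ((w 5).add ((a₀ 1).mul (w 4))).congr_deriv (by simp [raiseExp, act]; ring)
  · exact (w 6).congr_deriv (by simp [raiseExp, act])
  · exact ((w 7).add ((a₀ 0).mul (w 6))).congr_deriv (by simp [raiseExp, act]; ring)
  · exact ((w 8).add ((a₀ 1).mul (w 6))).congr_deriv (by simp [raiseExp, act]; ring)
  · exact ((w 9).add ((a₀ 2).mul (w 6))).congr_deriv (by simp [raiseExp, act]; ring)
  · exact ((((w 10).add ((a₀ 0).mul (w 8))).add ((a₀ 1).mul (w 7))).add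
      (((a₀ 0).mul (a₀ 1)).mul (w 6))).congr_deriv (by simp [raiseExp, act]; ring)
  · exact ((((w 11).add ((a₀ 0).mul (w 9))).add ((a₀ 2).mul (w 7))).add
      (((a₀ 0).mul (a₀ 2)).mul (w 6))).congr_deriv (by simp [raiseExp, act]; ring)
  · exact ((((w 12).add ((a₀ 1).mul (w 9))).add ((a₀ 2).mul (w 8))).add
      (((a₀ 1).mul (a₀ 2)).mul (w 6))).congr_deriv (by simp [raiseExp, act]; ring)
  · exact ((((((((w 13).add ((a₀ 0).mul (w 12))).add ((a₀ 1).mul (w 11))).add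
      ((a₀ 2).mul (w 10))).add (((a₀ 0).mul (a₀ 1)).mul (w 9))).add
      (((a₀ 0).mul (a₀ 2)).mul (w 8))).add (((a₀ 1).mul (a₀ 2)).mul (w 7))).add
      ((((a₀ 0).mul (a₀ 1)).mul (a₀ 2)).mul (w 6))).congr_deriv (by simp [raiseExp, act]; ring)

theorem hasDerivAt_lowerExp {l : ℂ → Fin 3 → ℂ} {l' : Fin 3 → ℂ} (hl : HasDerivAt l l' s)
    (hv : HasDerivAt v v' s) : HasDerivAt (fun z => lowerExp (l z) (v z))
      (lowerExp (l s) v' + act 0 0 l' (lowerExp (l s) (v s))) s := by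
  have a₀ := hasDerivAt_pi.1 hl
  have w := hasDerivAt_pi.1 hv
  refine hasDerivAt_pi.2 fun i => ?_
  fin_cases i
  · exact ((w 0).add ((a₀ 2).mul (w 1))).congr_deriv (by simp [lowerExp, act]; ring)
  · exact (w 1).congr_deriv (by simp [lowerExp, act])
  · exact ((w 2).add ((a₀ 0).mul (w 3))).congr_deriv (by simp [lowerExp, act]; ring)
  · exact (w 3).congr_deriv (by simp [lowerExp, act])
  · exact ((w 4).add ((a₀ 1).mul (w 5))).congr_deriv (by simp [lowerExp, act]; ring)
  · exact (w 5).congr_deriv (by simp [lowerExp, act])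
  · exact ((((((((w 6).add ((a₀ 0).mul (w 7))).add ((a₀ 1).mul (w 8))).add
      ((a₀ 2).mul (w 9))).add (((a₀ 0).mul (a₀ 1)).mul (w 10))).add
      (((a₀ 0).mul (a₀ 2)).mul (w 11))).add (((a₀ 1).mul (a₀ 2)).mul (w 12))).add
      ((((a₀ 0).mul (a₀ 1)).mul (a₀ 2)).mul (w 13))).congr_deriv (by simp [lowerExp, act]; ring)
  · exact ((((w 7).add ((a₀ 1).mul (w 10))).add ((a₀ 2).mul (w 11))).add
      (((a₀ 1).mul (a₀ 2)).mul (w 13))).congr_deriv (by simp [lowerExp, act]; ring)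
  · exact ((((w 8).add ((a₀ 0).mul (w 10))).add ((a₀ 2).mul (w 12))).add
      (((a₀ 0).mul (a₀ 2)).mul (w 13))).congr_deriv (by simp [lowerExp, act]; ring)
  · exact ((((w 9).add ((a₀ 0).mul (w 11))).add ((a₀ 1).mul (w 12))).add
      (((a₀ 0).mul (a₀ 1)).mul (w 13))).congr_deriv (by simp [lowerExp, act]; ring)
  · exact ((w 10).add ((a₀ 2).mul (w 13))).congr_deriv (by simp [lowerExp, act]; ring)
  · exact ((w 11).add ((a₀ 1).mul (w 13))).congr_deriv (by simp [lowerExp, act]; ring)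
  · exact ((w 12).add ((a₀ 0).mul (w 13))).congr_deriv (by simp [lowerExp, act]; ring)
  · exact (w 13).congr_deriv (by simp [lowerExp, act])

/-- The derivative of the torus action; `ξ` is the logarithmic derivative of `X`. -/
theorem hasDerivAt_torus {X : ℂ → Fin 7 → ℂ} {ξ : Fin 7 → ℂ}
    (x : ∀ j, HasDerivAt (fun z => X z j) (X s j * ξ j) s) (hv : HasDerivAt v v' s) :
    HasDerivAt (fun z => torus (X z) (v z))
      (torus (X s) v' + act ξ 0 0 (torus (X s) (v s))) s := by
  have v := hasDerivAt_pi.1 hv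
  refine hasDerivAt_pi.2 fun i => ?_
  fin_cases i
  · exact ((x 0).mul (v 0)).congr_deriv (by simp [torus, act]; ring)
  · exact (((x 0).mul (x 6)).mul (v 1)).congr_deriv (by simp [torus, act]; ring)
  · exact ((x 1).mul (v 2)).congr_deriv (by simp [torus, act]; ring)
  · exact (((x 1).mul (x 2)).mul (v 3)).congr_deriv (by simp [torus, act]; ring)
  · exact ((x 5).mul (v 4)).congr_deriv (by simp [torus, act]; ring)
  · exact (((x 4).mul (x 5)).mul (v 5)).congr_deriv (by simp [torus, act]; ring)
  · exact ((x 3).mul (v 6)).congr_deriv (by simp [torus, act]; ring)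
  · exact (((x 3).mul (x 2)).mul (v 7)).congr_deriv (by simp [torus, act]; ring)
  · exact (((x 3).mul (x 4)).mul (v 8)).congr_deriv (by simp [torus, act]; ring)
  · exact (((x 3).mul (x 6)).mul (v 9)).congr_deriv (by simp [torus, act]; ring)
  · exact ((((x 3).mul (x 2)).mul (x 4)).mul (v 10)).congr_deriv (by simp [torus, act]; ring)
  · exact ((((x 3).mul (x 2)).mul (x 6)).mul (v 11)).congr_deriv (by simp [torus, act]; ring)
  · exact ((((x 3).mul (x 4)).mul (x 6)).mul (v 12)).congr_deriv (by simp [torus, act]; ring)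
  · exact (((((x 3).mul (x 2)).mul (x 4)).mul (x 6)).mul (v 13)).congr_deriv
      (by simp [torus, act]; ring)

end Derivatives

theorem act_add (w w' : Fin 7 → ℂ) (z z' y y' : Fin 3 → ℂ) (v : Deg1) :
    act (w + w') (z + z') (y + y') v = act w z y v + act w' z' y' v := by
  funext i
  rw [Pi.add_apply]
  fin_cases i <;> simp [act] <;> ring

/-- Conjugating an element of the Cartan subalgebra by a unipotent element. -/
theorem raiseExp_act (w : Fin 7 → ℂ) (a : Fin 3 → ℂ) (v : Deg1) :
    raiseExp a (act w 0 0 v) = act w (fun i => -(a i * w (node i))) 0 (raiseExp a v) := by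
  funext i
  fin_cases i <;> simp [act, raiseExp, node] <;> ring

/-! ### The first gauge transformation in closed form -/

/-- The entire function `(exp z - 1) / z`. -/
noncomputable def expSlope : ℂ → ℂ := dslope Complex.exp 0

theorem mul_expSlope (z : ℂ) : z * expSlope z = Complex.exp z - 1 := by
  have := sub_smul_dslope Complex.exp 0 z
  simpa [expSlope] using this

theorem differentiable_expSlope : Differentiable ℂ expSlope := by
  rw [← differentiableOn_univ]
  exact (Complex.differentiableOn_dslope Filter.univ_mem).2 Complex.differentiable_exp.differentiableOn

theorem hasDerivAt_expSlope (z : ℂ) : HasDerivAt expSlope (deriv expSlope z) z :=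
  (differentiable_expSlope z).hasDerivAt

theorem hasDerivAt_deriv_expSlope (z : ℂ) :
    HasDerivAt (deriv expSlope) (deriv (deriv expSlope) z) z :=
  (differentiable_expSlope.deriv z).hasDerivAt

theorem expSlope_add (z : ℂ) : expSlope z + z * deriv expSlope z = Complex.exp z := by
  have h₁ := (hasDerivAt_id z).mul (hasDerivAt_expSlope z)
  have h₂ : HasDerivAt (fun z => z * expSlope z) (Complex.exp z) z := by
    simp only [mul_expSlope]
    exact (Complex.hasDerivAt_exp z).sub_const 1
  simpa using h₁.unique h₂

theorem two_mul_deriv_expSlope_add (z : ℂ) :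
    2 * deriv expSlope z + z * deriv (deriv expSlope) z = expSlope z + z * deriv expSlope z := by
  have h₁ := (hasDerivAt_expSlope z).add ((hasDerivAt_id z).mul (hasDerivAt_deriv_expSlope z))
  have h₂ : HasDerivAt (expSlope + id * deriv expSlope) (Complex.exp z) z := by
    have : expSlope + id * deriv expSlope = Complex.exp := funext expSlope_add
    rw [this]
    exact Complex.hasDerivAt_exp z
  rw [expSlope_add, ← h₁.unique h₂]
  simp; ring

/-- `exp(H + ∑ ν_i e_i) = exp(∑ a_i e_i) exp(H)` with `a = raiseCoeff w ν`, where `w` gives the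
values of the simple roots at `H`. -/
noncomputable def raiseCoeff (w : Fin 7 → ℂ) (ν : Fin 3 → ℂ) (i : Fin 3) : ℂ :=
  ν i * expSlope (w (node i))

/-- The exponential of `ad (H + ∑ ν_i e_i)` on the component of degree one, in coordinates. -/
noncomputable def firstExp (w : Fin 7 → ℂ) (ν : Fin 3 → ℂ) (v : Deg1) : Deg1 :=
  raiseExp (raiseCoeff w ν) (torus (fun j => Complex.exp (w j)) v)

/-- The coefficients of the `e_i` in the logarithmic derivative of a curve
`exp(H + ∑ ν_i e_i)`. -/
noncomputable def firstLogDeriv (w : Fin 7 → ℂ) (ν : Fin 3 → ℂ) (w' : Fin 7 → ℂ) (ν' : Fin 3 → ℂ)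
    (i : Fin 3) : ℂ :=
  ν' i * expSlope (w (node i)) + ν i * (deriv expSlope (w (node i)) * w' (node i))
    - ν i * expSlope (w (node i)) * w' (node i)

theorem hasDerivAt_firstExp {s : ℂ} {w : ℂ → Fin 7 → ℂ} {ν : ℂ → Fin 3 → ℂ} {v : ℂ → Deg1}
    {w' : Fin 7 → ℂ} {ν' : Fin 3 → ℂ} {v' : Deg1} (hw : HasDerivAt w w' s) (hν : HasDerivAt ν ν' s)
    (hv : HasDerivAt v v' s) : HasDerivAt (fun z => firstExp (w z) (ν z) (v z))
      (firstExp (w s) (ν s) v' +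
        act w' (firstLogDeriv (w s) (ν s) w' ν') 0 (firstExp (w s) (ν s) (v s))) s := by
  have ha : HasDerivAt (fun z => raiseCoeff (w z) (ν z)) (fun i => ν' i * expSlope (w s (node i)) +
      ν s i * (deriv expSlope (w s (node i)) * w' (node i))) s := by
    refine hasDerivAt_pi.2 fun i => ?_
    have h := (hasDerivAt_expSlope (w s (node i))).comp s (hasDerivAt_pi.1 hw (node i))
    exact (hasDerivAt_pi.1 hν i).mul h
  refine (hasDerivAt_raiseExp ha (hasDerivAt_torus
    (fun j => (hasDerivAt_pi.1 hw j).cexp) hv)).congr_deriv ?_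
  have hadd (a : Fin 3 → ℂ) (u v : Deg1) : raiseExp a (u + v) = raiseExp a u + raiseExp a v := by
    funext i
    rw [Pi.add_apply]
    fin_cases i <;> simp [raiseExp] <;> ring
  rw [hadd, raiseExp_act, add_assoc, ← act_add]
  simp only [firstExp, add_zero]
  congr 2
  funext i
  simp only [Pi.add_apply, raiseCoeff, firstLogDeriv]
  ring

theorem gaugeFlow_firstExp (H : Cartan) (ν : Fin 3 → ℂ) (v : Deg1) :
    GaugeFlow (toG0 H ν 0) 0 (toG1 v) (toG1 (firstExp H.root ν v)) := by
  have hw (r : ℂ) : HasDerivAt (fun r : ℂ => r • H.root) H.root r := by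
    simpa using (hasDerivAt_id r).smul_const H.root
  have hν (r : ℂ) : HasDerivAt (fun r : ℂ => r • ν) ν r := by
    simpa using (hasDerivAt_id r).smul_const ν
  have h := GaugeFlow.of_linear (Γ := toG0 H ν 0) (Γ' := 0) toG1
    (fun r => hasDerivAt_firstExp (hw r) (hν r) (hasDerivAt_const r v)) fun r => by
      rw [lie_toG0_toG1, zero_add]
      congr 1
      have h₀ : firstExp (r • H.root) (r • ν) 0 = 0 := by
        funext i
        fin_cases i <;> simp [firstExp, raiseExp, torus]
      rw [h₀, zero_add]
      congr 1
      funext i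
      simp only [firstLogDeriv, Pi.smul_apply, smul_eq_mul]
      linear_combination ν i * expSlope_add (r * H.root (node i)) -
        ν i * mul_expSlope (r * H.root (node i))
  have h₀ : firstExp (0 • H.root) (0 • ν) v = v := by
    funext i
    fin_cases i <;> simp [firstExp, raiseExp, torus, raiseCoeff]
  simp only [zero_smul] at h₀
  simpa only [zero_smul, one_smul, h₀] using h

theorem lie_toG0_toG0 (H K : Cartan) (z z' : Fin 3 → ℂ) : ⁅toG0 H z 0, toG0 K z' 0⁆ =
    toG0 0 (fun i => H.root (node i) * z' i - K.root (node i) * z i) 0 := by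
  have hee : ∀ i j, ⁅e (node i), e (node j)⁆ = 0 := by
    intro i j
    have : cartanMatrix (node i) (node j) = 0 ∨ i = j := by
      fin_cases i <;> fin_cases j <;> simp [node, cartanMatrix]
    rcases this with h | rfl
    · exact lie_e_e h
    · exact lie_self _
  have hze (i : Fin 3) : ⁅e (node i), K.toG⁆ = -(K.root (node i) • e (node i)) := by
    rw [← lie_skew, lie_toG_e]; rfl
  have h0 : (0 : Cartan).toG = 0 := by simp [Cartan.toG]
  simp only [toG0, Pi.zero_apply, zero_smul, Finset.sum_const_zero, add_zero, add_lie, lie_add,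
    lie_toG_toG, sum_lie, lie_sum, smul_lie, lie_smul, hee, smul_zero, hze, lie_toG_e, h0, zero_add,
    ← Cartan.root.eq_1, sub_smul, Finset.sum_sub_distrib]
  simp only [smul_neg, Finset.sum_neg_distrib, smul_smul]
  rw [neg_add_eq_sub]
  simp only [mul_comm]

theorem Cartan.root_smul (r : ℂ) (H : Cartan) : (r • H).root = r • H.root := by
  rw [Cartan.root_apply, Cartan.root_apply]
  funext i
  rw [Pi.smul_apply]
  fin_cases i <;> simp <;> ring

theorem Cartan.root_add (H K : Cartan) : (H + K).root = H.root + K.root := by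
  rw [Cartan.root_apply, Cartan.root_apply, Cartan.root_apply]
  funext i
  rw [Pi.add_apply]
  fin_cases i <;> simp <;> ring

/-- `Cartan.root` as a linear map. -/
noncomputable def rootLin : Cartan →ₗ[ℂ] (Fin 7 → ℂ) where
  toFun := Cartan.root
  map_add' := Cartan.root_add
  map_smul' := Cartan.root_smul

theorem hasDerivAt_root {η : ℂ → Cartan} {η' : Cartan} {s : ℂ} (h : HasDerivAt η η' s) :
    HasDerivAt (fun z => (η z).root) η'.root s :=
  (LinearMap.toContinuousLinearMap rootLin).hasFDerivAt.comp_hasDerivAt s h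

theorem gaugeFlow_firstLogDeriv (H H' : Cartan) (ν ν' : Fin 3 → ℂ) :
    GaugeFlow (toG0 H ν 0) (toG0 H' ν' 0) 0
      (toG0 H' (firstLogDeriv H.root ν H'.root ν') 0) := by
  let v : ℂ → Cartan × (Fin 3 → ℂ) × (Fin 3 → ℂ) := fun r =>
    (r • H', (fun i => firstLogDeriv (r • H.root) (r • ν) (r • H'.root) (r • ν') i), 0)
  have hv (r : ℂ) : HasDerivAt v (H', (fun i => ν' i + (H.root (node i) *
      firstLogDeriv (r • H.root) (r • ν) (r • H'.root) (r • ν') i - r * H'.root (node i) * ν i)), 0)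
      r := by
    refine HasDerivAt.prodMk (by simpa using (hasDerivAt_id r).smul_const H')
      (HasDerivAt.prodMk (hasDerivAt_pi.2 fun i => ?_) (hasDerivAt_const r _))
    have hr (c : ℂ) : HasDerivAt (fun r : ℂ => r * c) c r := by
      simpa using (hasDerivAt_id r).mul_const c
    set w := H.root (node i)
    set w' := H'.root (node i)
    have h₁ := (hasDerivAt_expSlope (r * w)).comp r (hr w)
    have h₂ := (hasDerivAt_deriv_expSlope (r * w)).comp r (hr w)
    refine ((((hr (ν' i)).mul h₁).add ((hr (ν i)).mul (h₂.mul (hr w')))).sub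
      (((hr (ν i)).mul h₁).mul (hr w'))).congr_deriv ?_
    simp only [firstLogDeriv, Pi.smul_apply, smul_eq_mul, Pi.mul_apply, Function.comp_apply]
    change _ = ν' i + (w * (r * ν' i * expSlope (r * w) + r * ν i * (deriv expSlope (r * w) *
      (r * w')) - r * ν i * expSlope (r * w) * (r * w')) - r * w' * ν i)
    linear_combination (ν' i - r * ν i * w') * (expSlope_add (r * w) - mul_expSlope (r * w)) +
      r * ν i * w' * two_mul_deriv_expSlope_add (r * w)
  have h := GaugeFlow.of_linear (Γ := toG0 H ν 0) (Γ' := toG0 H' ν' 0) toG0Lin hv fun r => by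
    simp only [toG0Lin_apply, v, lie_toG0_toG0, Cartan.root_smul]
    simp only [← toG0Lin_apply (_, _, _), ← map_add]
    congr 1
    ext i <;> simp
  have h₀ : v 0 = 0 := by
    ext i <;> simp [v, firstLogDeriv]
  have h₁ : toG0Lin (v 1) = toG0 H' (firstLogDeriv H.root ν H'.root ν') 0 := by
    simp [v, toG0Lin_apply]
  rwa [h₀, h₁, map_zero] at h

/-! ### The second gauge transformation in closed form -/

theorem Γ₂_eq (lam : Fin 3 → ℂ) : Γ₂ lam = toG0 0 0 lam := by
  simp [Γ₂, toG0, Cartan.toG]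

theorem gaugeFlow_lowerExp (lam : Fin 3 → ℂ) (v : Deg1) :
    GaugeFlow (toG0 0 0 lam) 0 (toG1 v) (toG1 (lowerExp lam v)) := by
  have hl (r : ℂ) : HasDerivAt (fun r : ℂ => r • lam) lam r := by
    simpa using (hasDerivAt_id r).smul_const lam
  have hroot : (0 : Cartan).root = 0 := by
    have := Cartan.root_smul 0 0
    rwa [zero_smul, zero_smul] at this
  have h := GaugeFlow.of_linear (Γ := toG0 0 0 lam) (Γ' := 0) toG1
    (fun r => hasDerivAt_lowerExp (hl r) (hasDerivAt_const r v)) fun r => by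
      rw [lie_toG0_toG1, zero_add, hroot]
      congr 1
      have h₀ : lowerExp (r • lam) 0 = 0 := by
        funext i
        fin_cases i <;> simp [lowerExp]
      rw [h₀, zero_add]
  have h₀ : lowerExp 0 v = v := by
    funext i
    fin_cases i <;> simp [lowerExp]
  simpa only [zero_smul, one_smul, h₀] using h

theorem lie_f_node (i j : Fin 3) : ⁅f (node i), f (node j)⁆ = 0 := by
  have : cartanMatrix (node i) (node j) = 0 ∨ i = j := by
    fin_cases i <;> fin_cases j <;> simp [node, cartanMatrix]
  rcases this with h | rfl
  · exact lie_f_f h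
  · exact lie_self _

theorem gaugeFlow_lower (lam lam' : Fin 3 → ℂ) :
    GaugeFlow (toG0 0 0 lam) (toG0 0 0 lam') 0 (toG0 0 0 lam') := by
  have h := GaugeFlow.of_linear (Γ := toG0 0 0 lam) (Γ' := toG0 0 0 lam')
    (LinearMap.toSpanSingleton ℂ AffE6 (toG0 0 0 lam')) (fun r => hasDerivAt_id r) fun r => by
      simp [← Γ₂_eq, Γ₂, sum_lie, lie_sum, lie_f_node]
  simpa using h

/-! ### The reduced system in normalized coordinates -/

theorem lowerExp_torus (X : Fin 7 → ℂ) (l : Fin 3 → ℂ) (v : Deg1) :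
    lowerExp l (torus X v) = torus X (lowerExp (fun i => X (node i) * l i) v) := by
  funext i
  fin_cases i <;> simp [lowerExp, torus, node] <;> ring

/-- The degree one part of `𝓜⁺` up to the action of the torus, in coordinates. On the slice
`s₁ = s`, `s₂ = 1` it depends only on `s` and on the three unknowns `x, y, h`. -/
def mVec (s x y h : ℂ) : Deg1 :=
  ![h - s, 1, 1 - x, 1, 1 - y, 1, h - x * y, y, x, 1, -1, 0, 0, 0]

/-- An element of degree one commuting with `mVec s x y h`, and independent of it. -/
def kVec (s x y h : ℂ) : Deg1 :=
  ![h * (1 - s), 1 - s, 1 - s, 0, 1 - s, 0, (h - s) * (1 - x) * (1 - y) - (1 - s) * x * y,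
    (h - s) * (1 - y) + y * (1 - s), (h - s) * (1 - x) + x * (1 - s), (1 - x) * (1 - y), h - 1,
    1 - y, 1 - x, 1]

/-- The second gauge transformation only translates the normalized coordinates. -/
theorem lowerExp_mVec (s x y h : ℂ) (l : Fin 3 → ℂ) :
    lowerExp l (mVec s x y h) = mVec s (x - l 0) (y - l 1) (h + l 2) := by
  funext i
  fin_cases i <;> simp [lowerExp, mVec] <;> ring

theorem lowerExp_kVec (s x y h : ℂ) (l : Fin 3 → ℂ) :
    lowerExp l (kVec s x y h) = kVec s (x - l 0) (y - l 1) (h + l 2) := by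
  funext i
  fin_cases i <;> simp [lowerExp, kVec] <;> ring

/-- The derivative of `mVec s x y h` along a curve with `ds = 1`. -/
def mVecDeriv (x y x' y' h' : ℂ) : Deg1 :=
  ![h' - 1, 0, -x', 0, -y', 0, h' - x' * y - x * y', y', x', 0, 0, 0, 0, 0]

theorem hasDerivAt_mVec {s : ℂ} {x y h : ℂ → ℂ} {x' y' h' : ℂ} (hx : HasDerivAt x x' s)
    (hy : HasDerivAt y y' s) (hh : HasDerivAt h h' s) :
    HasDerivAt (fun z => mVec z (x z) (y z) (h z)) (mVecDeriv (x s) (y s) x' y' h') s := by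
  refine hasDerivAt_pi.2 fun i => ?_
  fin_cases i
  · exact hh.sub (hasDerivAt_id s)
  · exact hasDerivAt_const s _
  · exact hx.const_sub 1
  · exact hasDerivAt_const s _
  · exact hy.const_sub 1
  · exact hasDerivAt_const s _
  · exact (hh.sub (hx.mul hy)).congr_deriv (by simp [mVecDeriv]; ring)
  · exact hy
  · exact hx
  · exact hasDerivAt_const s _
  · exact hasDerivAt_const s _
  · exact hasDerivAt_const s _
  · exact hasDerivAt_const s _
  · exact hasDerivAt_const s _

section Solution

variable (s x y h : ℂ) (α : Fin 7 → ℂ) (μ : Fin 3 → ℂ)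

/-- The nilpotent part of the solution of the linear system in `normalized_imp`, for `T = 1`. The
last three coordinates form a triangular system for it. -/
def zSol : Fin 3 → ℂ :=
  let z6 := α 2 + α 3 + α 4 + α 6 + μ 0 * (1 - x) + μ 1 * (1 - y) + μ 2 * (h - 1)
  ![-z6 * y - (α 2 + α 3 + α 6) * (1 - y) - μ 0 * (1 - x) * (1 - y)
      - μ 2 * ((h - s) * (1 - y) + y * (1 - s)),
    -z6 * x - (α 3 + α 4 + α 6) * (1 - x) - μ 1 * (1 - x) * (1 - y)
      - μ 2 * ((h - s) * (1 - x) + x * (1 - s)),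
    z6]

/-- The semisimple part of the solution of the linear system in `normalized_imp`, for `T = 1`. -/
def ζSol : Fin 7 → ℂ :=
  let z := zSol s x y h α μ
  let K := kVec s x y h
  let R := z 0 * x + z 1 * y + (α 2 + α 3 + α 4) * (h - 1) + μ 0 * K 8 + μ 1 * K 7
  let ζ2 := R * x + z 1 * (h - x * y) + (α 3 + α 4) * K 8 + μ 1 * K 6
    - (z 0 * (1 - x) + μ 0 * (1 - s)) * (1 - x) + α 1 * (1 - s)
  let ζ4 := R * y + z 0 * (h - x * y) + (α 3 + α 2) * K 7 + μ 0 * K 6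
    - (z 1 * (1 - y) + μ 1 * (1 - s)) * (1 - y) + α 5 * (1 - s)
  let ζ6 := ζ2 + ζ4 - R - z 2 * (h - x * y) - (α 3 + α 6) * K 9 - μ 2 * K 6
  ![-ζ6 - z 2 * (h - s) - (α 0 + α 6) * (1 - s) - μ 2 * h * (1 - s),
    -ζ2 - z 0 * (1 - x) - μ 0 * (1 - s), ζ2, R - ζ2 - ζ4, ζ4,
    -ζ4 - z 1 * (1 - y) - μ 1 * (1 - s), ζ6]

/-- The evolution of `x`, up to the factor `s(s-1)`. -/
def xDot : ℂ := -ζSol s x y h α μ 1 * (1 - x) - α 1 * (1 - s)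

/-- The evolution of `y`, up to the factor `s(s-1)`. -/
def yDot : ℂ := -ζSol s x y h α μ 5 * (1 - y) - α 5 * (1 - s)

/-- The evolution of `h`, up to the factor `s(s-1)` and a shift. -/
def hDot : ℂ := ζSol s x y h α μ 0 * (h - s) + α 0 * h * (1 - s)

/-- The linear form `∑ aᵢ^∨ αᵢ`, where the `aᵢ^∨` are the marks of `E₆⁽¹⁾`. -/
def marksSum (α : Fin 7 → ℂ) : ℂ := α 0 + α 1 + 2 * α 2 + 3 * α 3 + 2 * α 4 + α 5 + 2 * α 6

/-- The evolution of `μ`, up to the factor `s(s-1)`. -/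
def μDot (i : Fin 3) : ℂ := ζSol s x y h α μ (node i) * μ i - α (node i) * zSol s x y h α μ i

variable {s x y h α μ} {ζ : Fin 7 → ℂ} {z : Fin 3 → ℂ} {x' y' h' T : ℂ}

/-- The linear system satisfied by the logarithmic derivative `(ζ, z)` of the gauge along a solution
and by the velocities `x', y', h'`. Thirteen of its fourteen coordinates determine these thirteen
unknowns, one after the other; what remains is the condition on `α`. -/
theorem normalized_imp
    (H : mVecDeriv x y x' y' h' = act ζ z 0 (mVec s x y h) + T • act α μ 0 (kVec s x y h)) :
    T * (s * (s - 1)) * marksSum α = 1 ∧ z = T • zSol s x y h α μ ∧ ζ = T • ζSol s x y h α μ ∧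
      x' = T * xDot s x y h α μ ∧ y' = T * yDot s x y h α μ ∧ h' = 1 + T * hDot s x y h α μ := by
  have E (i : Fin 14) := congrFun H i
  have e0 := E 0
  have e1 := E 1
  have e2 := E 2
  have e3 := E 3
  have e4 := E 4
  have e5 := E 5
  have e6 := E 6
  have e7 := E 7
  have e8 := E 8
  have e9 := E 9
  have e10 := E 10
  have e11 := E 11
  have e12 := E 12
  have e13 := E 13
  clear E H
  simp [act, mVec, kVec, mVecDeriv] at e0 e1 e2 e3 e4 e5 e6 e7 e8 e9 e10 e11 e12 e13
  have hz2 : z 2 = T * zSol s x y h α μ 2 := by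
    simp [zSol]; linear_combination e13
  have hz1 : z 1 = T * zSol s x y h α μ 1 := by
    simp [zSol] at hz2 ⊢; linear_combination -e12 - x * hz2
  have hz0 : z 0 = T * zSol s x y h α μ 0 := by
    simp [zSol] at hz2 ⊢; linear_combination -e11 - y * hz2
  clear e11 e12 e13
  obtain rfl : z = T • zSol s x y h α μ := by
    funext i; fin_cases i
    · exact hz0
    · exact hz1
    · exact hz2
  clear hz0 hz1 hz2
  have hζ2 : ζ 2 = T * ζSol s x y h α μ 2 := by
    simp [ζSol, kVec] at e2 e3 e8 e10 ⊢
    linear_combination e8 + e2 + x * e10 - (1 - x) * e3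
  have hζ4 : ζ 4 = T * ζSol s x y h α μ 4 := by
    simp [ζSol, kVec] at e4 e5 e7 e10 ⊢
    linear_combination e7 + e4 + y * e10 - (1 - y) * e5
  have hζ3 : ζ 3 = T * ζSol s x y h α μ 3 := by
    simp [ζSol, kVec] at e10 hζ2 hζ4 ⊢
    linear_combination e10 - hζ2 - hζ4
  have hζ6 : ζ 6 = T * ζSol s x y h α μ 6 := by
    simp [ζSol, kVec] at e9 hζ3 ⊢
    linear_combination -e9 - hζ3
  have hζ0 : ζ 0 = T * ζSol s x y h α μ 0 := by
    simp [ζSol, kVec] at e1 hζ6 ⊢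
    linear_combination -e1 - hζ6
  have hζ1 : ζ 1 = T * ζSol s x y h α μ 1 := by
    simp [ζSol, kVec] at e3 hζ2 ⊢
    linear_combination -e3 - hζ2
  have hζ5 : ζ 5 = T * ζSol s x y h α μ 5 := by
    simp [ζSol, kVec] at e5 hζ4 ⊢
    linear_combination -e5 - hζ4
  obtain rfl : ζ = T • ζSol s x y h α μ := by
    funext i; fin_cases i
    · exact hζ0
    · exact hζ1
    · exact hζ2
    · exact hζ3
    · exact hζ4
    · exact hζ5
    · exact hζ6
  clear hζ0 hζ1 hζ2 hζ3 hζ4 hζ5 hζ6 e1 e3 e5 e7 e8 e9 e10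
  have hx : x' = T * xDot s x y h α μ := by
    simp [xDot] at e2 ⊢; linear_combination -e2
  have hy : y' = T * yDot s x y h α μ := by
    simp [yDot] at e4 ⊢; linear_combination -e4
  have hh : h' = 1 + T * hDot s x y h α μ := by
    simp [hDot] at e0 ⊢; linear_combination e0
  refine ⟨?_, rfl, rfl, hx, hy, hh⟩
  subst hx hy hh
  clear e0 e2 e4
  simp [xDot, yDot, hDot, ζSol, zSol, kVec, marksSum] at e6 ⊢
  linear_combination -e6

/-- The converse of `normalized_imp`. -/
theorem normalized_of (hα : T * (s * (s - 1)) * marksSum α = 1) :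
    mVecDeriv x y (T * xDot s x y h α μ) (T * yDot s x y h α μ) (1 + T * hDot s x y h α μ) =
      act (T • ζSol s x y h α μ) (T • zSol s x y h α μ) 0 (mVec s x y h)
        + T • act α μ 0 (kVec s x y h) := by
  funext i
  rw [Pi.add_apply, Pi.smul_apply]
  fin_cases i
  · simp [mVecDeriv, act, mVec, kVec, hDot]; ring
  · simp [mVecDeriv, act, mVec, kVec, ζSol]; ring
  · simp [mVecDeriv, act, mVec, kVec, xDot]; ring
  · simp [mVecDeriv, act, mVec, kVec, ζSol]; ring
  · simp [mVecDeriv, act, mVec, kVec, yDot]; ring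
  · simp [mVecDeriv, act, mVec, kVec, ζSol]; ring
  · simp [mVecDeriv, act, mVec, kVec, xDot, yDot, hDot, ζSol, zSol, marksSum] at hα ⊢
    linear_combination -hα
  · simp [mVecDeriv, act, mVec, kVec, yDot, ζSol]; ring
  · simp [mVecDeriv, act, mVec, kVec, xDot, ζSol]; ring
  · simp [mVecDeriv, act, mVec, kVec, ζSol]; ring
  · simp [mVecDeriv, act, mVec, kVec, ζSol]; ring
  · simp [mVecDeriv, act, mVec, kVec, zSol]; ring
  · simp [mVecDeriv, act, mVec, kVec, zSol]; ring
  · simp [mVecDeriv, act, mVec, kVec, zSol]; ring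

theorem marksSum_ζSol : marksSum (ζSol s x y h α μ) = (s - 1) * marksSum α := by
  simp [marksSum, ζSol, zSol, kVec]
  ring

end Solution

/-! ### The Hamiltonian vector field -/

theorem hasDerivAt_hVI_p (p q s β₀ β₁ β₃ β₄ : ℂ) : HasDerivAt (fun z => hVI z q s β₀ β₁ β₃ β₄)
    (2 * q * (q - 1) * (q - s) * p
      - ((β₁ - 1) * q * (q - 1) + β₃ * q * (q - s) + β₄ * (q - 1) * (q - s))) p := by
  have h := hasDerivAt_id p
  refine ((((h.pow 2).const_mul (q * (q - 1) * (q - s))).sub (h.const_mul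
    ((β₁ - 1) * q * (q - 1) + β₃ * q * (q - s) + β₄ * (q - 1) * (q - s)))).add_const
    ((1 - β₀ - β₁ - β₃ - β₄) / 2 * (β₀ + (1 - β₀ - β₁ - β₃ - β₄) / 2) * q)).congr_deriv ?_
  simp; ring

theorem hasDerivAt_hVI_q (p q s β₀ β₁ β₃ β₄ : ℂ) : HasDerivAt (fun z => hVI p z s β₀ β₁ β₃ β₄)
    ((3 * q ^ 2 - 2 * (1 + s) * q + s) * p ^ 2
      - ((β₁ - 1) * (2 * q - 1) + β₃ * (2 * q - s) + β₄ * (2 * q - 1 - s)) * p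
      + (1 - β₀ - β₁ - β₃ - β₄) / 2 * (β₀ + (1 - β₀ - β₁ - β₃ - β₄) / 2)) q := by
  have h := hasDerivAt_id q
  have h₁ := h.sub_const 1
  have hs := h.sub_const s
  refine (((((h.mul h₁).mul hs).mul_const (p ^ 2)).sub
    ((((((h.const_mul (β₁ - 1)).mul h₁)).add ((h.const_mul β₃).mul hs)).add
      ((h₁.const_mul β₄).mul hs)).mul_const p)).add (h.const_mul
    ((1 - β₀ - β₁ - β₃ - β₄) / 2 * (β₀ + (1 - β₀ - β₁ - β₃ - β₄) / 2)))).congr_deriv ?_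
  simp; ring

/-- The coupling term of the Hamiltonian. -/
def coupling (s a b q p q' p' : ℂ) : ℂ := ((q - 1) * p + a) * ((q' - 1) * p' + b) * (q * q' + s)

theorem coupling_comm (s a b q p q' p' : ℂ) : coupling s a b q p q' p' = coupling s b a q' p' q p := by
  simp only [coupling]; ring

theorem hasDerivAt_coupling_p (s a b q p q' p' : ℂ) : HasDerivAt (fun z => coupling s a b q z q' p')
    ((q - 1) * ((q' - 1) * p' + b) * (q * q' + s)) p := by
  refine (((((hasDerivAt_id p).const_mul (q - 1)).add_const a).mul_const
    ((q' - 1) * p' + b)).mul_const (q * q' + s)).congr_deriv ?_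
  simp

theorem hasDerivAt_coupling_q (s a b q p q' p' : ℂ) : HasDerivAt (fun z => coupling s a b z p q' p')
    (((q' - 1) * p' + b) * (p * (q * q' + s) + ((q - 1) * p + a) * q')) q := by
  refine ((((((hasDerivAt_id q).sub_const 1).mul_const p).add_const a).mul_const
    ((q' - 1) * p' + b)).mul (((hasDerivAt_id q).mul_const q').add_const s)).congr_deriv ?_
  simp; ring

theorem coupledH_eq (α : Fin 7 → ℂ) (s : ℂ) (q p : Fin 3 → ℂ) : coupledH α s q p =
    hVI (p 0) (q 0) s (α 3) (1 - α 1 - 2 * α 2 - 2 * α 3) (α 1) (α 3)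
    + hVI (p 1) (q 1) s (α 3) (1 - 2 * α 3 - 2 * α 4 - α 5) (α 5) (α 3)
    + hVI (p 2) (q 2) s (α 3) (1 - α 0 - 2 * α 3 - 2 * α 6) (α 0) (α 3)
    + (coupling s (α 2) (α 4) (q 0) (p 0) (q 1) (p 1)
      + coupling s (α 2) (α 6) (q 0) (p 0) (q 2) (p 2)
      + coupling s (α 4) (α 6) (q 1) (p 1) (q 2) (p 2)) := by
  have h₀ : Finset.Ioi (0 : Fin 3) = {1, 2} := rfl
  have h₁ : Finset.Ioi (1 : Fin 3) = {2} := rfl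
  have h₂ : Finset.Ioi (2 : Fin 3) = ∅ := rfl
  rw [coupledH, Fin.sum_univ_three, h₀, h₁, h₂]
  simp [coupling, node, Finset.sum_pair]

theorem poisson_q (F : (Fin 3 → ℂ) → (Fin 3 → ℂ) → ℂ) (i : Fin 3) (q p : Fin 3 → ℂ) :
    poisson F (fun q' _ => q' i) q p = dp i F q p := by
  have h₁ (j : Fin 3) : dq j (fun q' _ => q' i) q p = if j = i then 1 else 0 := by
    by_cases hij : j = i
    · subst hij; simp [dq]
    · simp [dq, Function.update_of_ne (Ne.symm hij), hij]
  have h₂ (j : Fin 3) : dp j (fun q' _ => q' i) q p = 0 := by simp [dp]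
  simp [poisson, h₁, h₂]

theorem poisson_p (F : (Fin 3 → ℂ) → (Fin 3 → ℂ) → ℂ) (i : Fin 3) (q p : Fin 3 → ℂ) :
    poisson F (fun _ p' => p' i) q p = -dq i F q p := by
  have h₁ (j : Fin 3) : dp j (fun _ p' => p' i) q p = if j = i then 1 else 0 := by
    by_cases hij : j = i
    · subst hij; simp [dp]
    · simp [dp, Function.update_of_ne (Ne.symm hij), hij]
  have h₂ (j : Fin 3) : dq j (fun _ p' => p' i) q p = 0 := by simp [dq]
  simp [poisson, h₁, h₂]

section VectorField

variable (s x y h : ℂ) (α : Fin 7 → ℂ) (μ : Fin 3 → ℂ)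

/-- The positions in terms of the normalized coordinates. -/
noncomputable def qNorm : Fin 3 → ℂ := ![x, y, s / h]

/-- The momenta in terms of the normalized coordinates. -/
noncomputable def pNorm (a : ℂ) : Fin 3 → ℂ := ![-μ 0, -μ 1, -h * (h * μ 2 + a) / s]

variable {s x y h α μ}

theorem dp_zero (hs : s ≠ 0) (hh : h ≠ 0) (hα : marksSum α = 1) :
    dp 0 (coupledH α s) (qNorm s x y h) (pNorm s h μ (α 6)) = xDot s x y h α μ := by
  simp only [dp, coupledH_eq, Function.update_self,
      Function.update_of_ne (show (1 : Fin 3) ≠ 0 by decide),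
      Function.update_of_ne (show (2 : Fin 3) ≠ 0 by decide)]
  refine (HasDerivAt.deriv ((((hasDerivAt_hVI_p _ _ _ _ _ _ _).add_const _).add_const _).add
      (((hasDerivAt_coupling_p _ _ _ _ _ _ _).add
        (hasDerivAt_coupling_p _ _ _ _ _ _ _)).add_const _))).trans ?_
  have h0 : α 0 = 1 - (α 1 + 2 * α 2 + 3 * α 3 + 2 * α 4 + α 5 + 2 * α 6) := by
    rw [← hα, marksSum]; ring
  simp [qNorm, pNorm, xDot, ζSol, zSol, kVec, h0]
  field_simp
  ring

theorem dp_one (hs : s ≠ 0) (hh : h ≠ 0) (hα : marksSum α = 1) :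
    dp 1 (coupledH α s) (qNorm s x y h) (pNorm s h μ (α 6)) = yDot s x y h α μ := by
  simp only [dp, coupledH_eq, Function.update_self, coupling_comm s (α 2) (α 4),
      Function.update_of_ne (show (0 : Fin 3) ≠ 1 by decide),
      Function.update_of_ne (show (2 : Fin 3) ≠ 1 by decide)]
  refine (HasDerivAt.deriv ((((hasDerivAt_hVI_p _ _ _ _ _ _ _).const_add _).add_const _).add
      (((hasDerivAt_coupling_p _ _ _ _ _ _ _).add_const _).add
        (hasDerivAt_coupling_p _ _ _ _ _ _ _)))).trans ?_
  have h0 : α 0 = 1 - (α 1 + 2 * α 2 + 3 * α 3 + 2 * α 4 + α 5 + 2 * α 6) := by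
    rw [← hα, marksSum]; ring
  simp [qNorm, pNorm, yDot, ζSol, zSol, kVec, h0]
  field_simp
  ring

theorem dp_two (hs : s ≠ 0) (hh : h ≠ 0) (hα : marksSum α = 1) :
    dp 2 (coupledH α s) (qNorm s x y h) (pNorm s h μ (α 6)) =
      s * (s - 1) / h - s / h ^ 2 * (s * (s - 1) + hDot s x y h α μ) := by
  simp only [dp, coupledH_eq, Function.update_self, coupling_comm s _ (α 6),
      Function.update_of_ne (show (0 : Fin 3) ≠ 2 by decide),
      Function.update_of_ne (show (1 : Fin 3) ≠ 2 by decide)]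
  refine (HasDerivAt.deriv (((hasDerivAt_hVI_p _ _ _ _ _ _ _).const_add _).add
      (((hasDerivAt_coupling_p _ _ _ _ _ _ _).const_add _).add
        (hasDerivAt_coupling_p _ _ _ _ _ _ _)))).trans ?_
  have h0 : α 0 = 1 - (α 1 + 2 * α 2 + 3 * α 3 + 2 * α 4 + α 5 + 2 * α 6) := by
    rw [← hα, marksSum]; ring
  simp [qNorm, pNorm, hDot, ζSol, zSol, kVec, h0]
  field_simp
  ring

theorem dq_zero (hs : s ≠ 0) (hh : h ≠ 0) (hα : marksSum α = 1) :
    dq 0 (coupledH α s) (qNorm s x y h) (pNorm s h μ (α 6)) = μDot s x y h α μ 0 := by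
  simp only [dq, coupledH_eq, Function.update_self,
      Function.update_of_ne (show (1 : Fin 3) ≠ 0 by decide),
      Function.update_of_ne (show (2 : Fin 3) ≠ 0 by decide)]
  refine (HasDerivAt.deriv ((((hasDerivAt_hVI_q _ _ _ _ _ _ _).add_const _).add_const _).add
      (((hasDerivAt_coupling_q _ _ _ _ _ _ _).add
        (hasDerivAt_coupling_q _ _ _ _ _ _ _)).add_const _))).trans ?_
  have h0 : α 0 = 1 - (α 1 + 2 * α 2 + 3 * α 3 + 2 * α 4 + α 5 + 2 * α 6) := by
    rw [← hα, marksSum]; ring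
  simp [qNorm, pNorm, μDot, node, ζSol, zSol, kVec, h0]
  field_simp
  ring

theorem dq_one (hs : s ≠ 0) (hh : h ≠ 0) (hα : marksSum α = 1) :
    dq 1 (coupledH α s) (qNorm s x y h) (pNorm s h μ (α 6)) = μDot s x y h α μ 1 := by
  simp only [dq, coupledH_eq, Function.update_self, coupling_comm s (α 2) (α 4),
      Function.update_of_ne (show (0 : Fin 3) ≠ 1 by decide),
      Function.update_of_ne (show (2 : Fin 3) ≠ 1 by decide)]
  refine (HasDerivAt.deriv ((((hasDerivAt_hVI_q _ _ _ _ _ _ _).const_add _).add_const _).add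
      (((hasDerivAt_coupling_q _ _ _ _ _ _ _).add_const _).add
        (hasDerivAt_coupling_q _ _ _ _ _ _ _)))).trans ?_
  have h0 : α 0 = 1 - (α 1 + 2 * α 2 + 3 * α 3 + 2 * α 4 + α 5 + 2 * α 6) := by
    rw [← hα, marksSum]; ring
  simp [qNorm, pNorm, μDot, node, ζSol, zSol, kVec, h0]
  field_simp
  ring

theorem dq_two (hs : s ≠ 0) (hh : h ≠ 0) (hα : marksSum α = 1) :
    dq 2 (coupledH α s) (qNorm s x y h) (pNorm s h μ (α 6)) =
      -(s * (s - 1) * (h * (h * μ 2 + α 6)) - s * ((s * (s - 1) + hDot s x y h α μ) *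
        (2 * h * μ 2 + α 6) + h ^ 2 * μDot s x y h α μ 2)) / s ^ 2 := by
  simp only [dq, coupledH_eq, Function.update_self, coupling_comm s _ (α 6),
      Function.update_of_ne (show (0 : Fin 3) ≠ 2 by decide),
      Function.update_of_ne (show (1 : Fin 3) ≠ 2 by decide)]
  refine (HasDerivAt.deriv (((hasDerivAt_hVI_q _ _ _ _ _ _ _).const_add _).add
      (((hasDerivAt_coupling_q _ _ _ _ _ _ _).const_add _).add
        (hasDerivAt_coupling_q _ _ _ _ _ _ _)))).trans ?_
  have h0 : α 0 = 1 - (α 1 + 2 * α 2 + 3 * α 3 + 2 * α 4 + α 5 + 2 * α 6) := by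
    rw [← hα, marksSum]; ring
  simp [qNorm, pNorm, μDot, hDot, node, ζSol, zSol, kVec, h0]
  field_simp
  ring

end VectorField

/-! ### The normal form in degree one -/

/-- The coordinates of the normal form. -/
def Coeffs.coord (c : Coeffs) : Deg1 := ![c.c0, 1, c.c1, 1, c.c5, 1, c.c3, 1, 1, c.c63, -1, 0, 0, 0]

theorem Coeffs.normalForm_eq (c : Coeffs) : c.normalForm = toG1 c.coord := by
  simp [Coeffs.normalForm, toG1_apply, Coeffs.coord, word_two_three_four, -lie_skew]
  simp only [word]
  abel

theorem Mplus_eq (c : Coeffs) (κ : Cartan) (lam mu : Fin 3 → ℂ) :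
    Mplus c κ lam mu = κ.toG + toPos (mu, lowerExp lam c.coord) := by
  rw [toPos_apply]
  simp [Mplus, toG1_apply, Coeffs.coord, lowerExp, word_two_three_four, -lie_skew]
  simp only [word]
  module

/-- The slice `s₁ = s`, `s₂ = 1`, away from `s = 0`. -/
structure Coeffs.OnSlice (c : Coeffs) (s : ℂ) : Prop where
  s₁_eq : c.s₁ = s
  s₂_eq : c.s₂ = 1
  ne_zero : s ≠ 0

namespace Coeffs.OnSlice

variable {c : Coeffs} {s : ℂ} (hc : c.OnSlice s)
include hc

theorem eq_one : c.c63 * (1 + c.c1) * (1 + c.c5) = 6 := by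
  have := hc.s₂_eq
  rw [Coeffs.s₂] at this
  linear_combination 6 * this

theorem c63_ne : c.c63 ≠ 0 := by
  intro h
  have := hc.eq_one
  simp [h] at this

theorem d1_ne : 1 + c.c1 ≠ 0 := by
  intro h
  have := hc.eq_one
  simp [h] at this

theorem d5_ne : 1 + c.c5 ≠ 0 := by
  intro h
  have := hc.eq_one
  simp [h] at this

theorem c63_eq : c.c63 = 6 / ((1 + c.c1) * (1 + c.c5)) := by
  rw [eq_div_iff (mul_ne_zero hc.d1_ne hc.d5_ne), ← hc.eq_one]; ring

theorem d3_eq : 1 + c.c3 - c.c0 * c.c63 = s * ((1 + c.c1) * (1 + c.c5)) := by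
  have h := hc.s₁_eq
  rw [Coeffs.s₁] at h
  refine mul_left_cancel₀ hc.c63_ne ?_
  linear_combination 6 * h - s * hc.eq_one

theorem c0_eq : c.c0 = ((1 + c.c3) - s * ((1 + c.c1) * (1 + c.c5))) * ((1 + c.c1) * (1 + c.c5)) / 6 := by
  have h := hc.d3_eq
  have h₁ := hc.eq_one
  linear_combination (-1 / 6) * (1 + c.c1) * (1 + c.c5) * h - c.c0 / 6 * h₁

end Coeffs.OnSlice

/-- The torus element which carries `mVec` to the degree one part, in terms of the values of the
simple roots. -/
noncomputable def Coeffs.scale (c : Coeffs) : Fin 7 → ℂ :=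
  let P := (1 + c.c1) * (1 + c.c5)
  ![P ^ 2 / 6, 1 + c.c1, (1 + c.c1)⁻¹, P, (1 + c.c5)⁻¹, 1 + c.c5, 6 / P ^ 2]

/-- The normalized coordinate `x`, in terms of `λ₂`; it is the position `q₁`. -/
noncomputable def Coeffs.xCoord (c : Coeffs) (lam : Fin 3 → ℂ) : ℂ := (1 - lam 0) / (1 + c.c1)

/-- The normalized coordinate `y`, in terms of `λ₄`; it is the position `q₂`. -/
noncomputable def Coeffs.yCoord (c : Coeffs) (lam : Fin 3 → ℂ) : ℂ := (1 - lam 1) / (1 + c.c5)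

/-- The normalized coordinate `h`, in terms of `λ₆`; the position `q₃` is `s / h`. -/
noncomputable def Coeffs.hCoord (c : Coeffs) (lam : Fin 3 → ℂ) : ℂ :=
  (1 + c.c3 + c.c63 * lam 2) / ((1 + c.c1) * (1 + c.c5))

theorem torus_injective {X : Fin 7 → ℂ} (hX : ∀ j, X j ≠ 0) : Function.Injective (torus X) := by
  intro u v h
  have E (i : Fin 14) := congrFun h i
  funext i
  have e := E i
  fin_cases i <;> simpa [torus, hX] using e

theorem torus_smul (X : Fin 7 → ℂ) (r : ℂ) (v : Deg1) : torus X (r • v) = r • torus X v := by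
  funext i
  rw [Pi.smul_apply]
  fin_cases i <;> simp [torus] <;> ring

theorem lowerExp_add (l : Fin 3 → ℂ) (u v : Deg1) :
    lowerExp l (u + v) = lowerExp l u + lowerExp l v := by
  funext i
  rw [Pi.add_apply]
  fin_cases i <;> simp [lowerExp] <;> ring

theorem lowerExp_smul (l : Fin 3 → ℂ) (r : ℂ) (v : Deg1) :
    lowerExp l (r • v) = r • lowerExp l v := by
  funext i
  rw [Pi.smul_apply]
  fin_cases i <;> simp [lowerExp] <;> ring

namespace Coeffs.OnSlice

variable {c : Coeffs} {s : ℂ} (hc : c.OnSlice s)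
include hc

theorem scale_ne (j : Fin 7) : c.scale j ≠ 0 := by
  have h₁ := hc.d1_ne
  have h₅ := hc.d5_ne
  fin_cases j <;> simp [Coeffs.scale, h₁, h₅]

theorem coord_eq :
    c.coord = torus c.scale (mVec s (c.xCoord 0) (c.yCoord 0) (c.hCoord 0)) := by
  have h₁ := hc.d1_ne
  have h₅ := hc.d5_ne
  have h0 := hc.c0_eq
  have h63 := hc.c63_eq
  funext i
  fin_cases i <;> simp [Coeffs.coord, torus, Coeffs.scale, mVec, Coeffs.xCoord, Coeffs.yCoord,
    Coeffs.hCoord, h0, h63, h₁, h₅] <;> field_simp <;> ring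

theorem shift (lam : Fin 3 → ℂ) :
    c.xCoord 0 - c.scale (node 0) * lam 0 = c.xCoord lam ∧
    c.yCoord 0 - c.scale (node 1) * lam 1 = c.yCoord lam ∧
    c.hCoord 0 + c.scale (node 2) * lam 2 = c.hCoord lam := by
  have h₁ := hc.d1_ne
  have h₅ := hc.d5_ne
  have h63 := hc.c63_eq
  refine ⟨?_, ?_, ?_⟩ <;> simp [Coeffs.scale, node, Coeffs.xCoord, Coeffs.yCoord, Coeffs.hCoord, h63]
    <;> field_simp

theorem lowerExp_coord (lam : Fin 3 → ℂ) : lowerExp lam c.coord =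
    torus c.scale (mVec s (c.xCoord lam) (c.yCoord lam) (c.hCoord lam)) := by
  obtain ⟨h₁, h₂, h₃⟩ := hc.shift lam
  rw [hc.coord_eq, lowerExp_torus, lowerExp_mVec, h₁, h₂, h₃]

theorem lowerExp_torus_kVec (lam : Fin 3 → ℂ) :
    lowerExp lam (torus c.scale (kVec s (c.xCoord 0) (c.yCoord 0) (c.hCoord 0))) =
      torus c.scale (kVec s (c.xCoord lam) (c.yCoord lam) (c.hCoord lam)) := by
  obtain ⟨h₁, h₂, h₃⟩ := hc.shift lam
  rw [lowerExp_torus, lowerExp_kVec, h₁, h₂, h₃]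

end Coeffs.OnSlice

/-! ### The centralizer of the normal form in degree one -/

theorem lie_e_coroot (i j : Fin 7) : ⁅e j, coroot i⁆ = -(cartanMatrix i j : ℂ) • e j := by
  rw [← lie_skew, lie_coroot_e, neg_smul]

theorem toG_smul_coroot (r : ℂ) (i : Fin 7) : (r • Cartan.coroot i).toG = r • coroot i := by
  simp [Cartan.toG, Cartan.coroot, Pi.single_apply]

theorem lie_f0_toG1 (u : Deg1) :
    ⁅f 0, toG1 u⁆ = toG0 (-(u 0) • Cartan.coroot 0) ![0, 0, -u 1] 0 := by
  simp [toG1_apply, lie_f_e, comm_f_e, lie_f_e_self, lie_e_coroot, cartanMatrix, toG0, node,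
    toG_smul_coroot, Fin.sum_univ_three, -lie_skew, -lie_lie, -neg_smul]
  module

theorem lie_f1_toG1 (u : Deg1) :
    ⁅f 1, toG1 u⁆ = toG0 (-(u 2) • Cartan.coroot 1) ![-u 3, 0, 0] 0 := by
  simp [toG1_apply, lie_f_e, comm_f_e, lie_f_e_self, lie_e_coroot, cartanMatrix, toG0, node,
    toG_smul_coroot, Fin.sum_univ_three, -lie_skew, -lie_lie, -neg_smul]
  module

theorem lie_f5_toG1 (u : Deg1) :
    ⁅f 5, toG1 u⁆ = toG0 (-(u 4) • Cartan.coroot 5) ![0, -u 5, 0] 0 := by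
  simp [toG1_apply, lie_f_e, comm_f_e, lie_f_e_self, lie_e_coroot, cartanMatrix, toG0, node,
    toG_smul_coroot, Fin.sum_univ_three, -lie_skew, -lie_lie, -neg_smul]
  module

theorem lie_f3_toG1 (u : Deg1) :
    ⁅f 3, toG1 u⁆ = toG0 (-(u 6) • Cartan.coroot 3) ![-u 7, -u 8, -u 9] 0 := by
  have h24 : ⁅e 2, e 4⁆ = 0 := lie_e_e rfl
  have h26 : ⁅e 2, e 6⁆ = 0 := lie_e_e rfl
  have h46 : ⁅e 4, e 6⁆ = 0 := lie_e_e rfl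
  simp [toG1_apply, lie_f_e, comm_f_e, lie_f_e_self, lie_e_coroot, cartanMatrix, toG0, node, h24,
    h26, h46, toG_smul_coroot, Fin.sum_univ_three, -lie_skew, -lie_lie, -neg_smul]
  module

/-- Bracketing `[u, v] = 0` with `f_i` gives a relation in degree one. -/
theorem act_eq_of_lie_eq_zero {u v : Deg1} (h : ⁅toG1 u, toG1 v⁆ = 0) {i : Fin 7}
    {H : Deg1 → Cartan} {z : Deg1 → Fin 3 → ℂ} (hf : ∀ u, ⁅f i, toG1 u⁆ = toG0 (H u) (z u) 0) :
    act (H u).root (z u) 0 v = act (H v).root (z v) 0 u := by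
  have h₁ := leibniz_lie (f i) (toG1 u) (toG1 v)
  rw [h, lie_zero, hf, hf, ← lie_skew (toG1 u), lie_toG0_toG1, lie_toG0_toG1] at h₁
  exact toG1_injective (add_neg_eq_zero.1 h₁.symm)

theorem root_neg_smul_coroot (r : ℂ) (i : Fin 7) :
    (-r • Cartan.coroot i).root = fun j => -r * (cartanMatrix i j : ℂ) := by
  rw [Cartan.root_apply]
  funext j
  fin_cases i <;> fin_cases j <;> simp [Cartan.coroot, cartanMatrix] <;> ring

/-- The centralizer of the normal form in degree one is spanned by the normal form and by `kVec`, up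
to the torus. If `L` commutes with the normal form, bracketing the relation with `f_0, f_1, f_3, f_5`
gives linear equations between the coordinates of `L`, so that no basis of the component of degree
two is needed. -/
theorem Coeffs.OnSlice.exists_of_lie_eq_zero {c : Coeffs} {s : ℂ} (hc : c.OnSlice s) {L : Deg1}
    (h : ⁅toG1 L, toG1 c.coord⁆ = 0) : ∃ l τ : ℂ, L = l • c.coord +
      τ • torus c.scale (kVec s (c.xCoord 0) (c.yCoord 0) (c.hCoord 0)) := by
  have E0 := act_eq_of_lie_eq_zero h lie_f0_toG1
  have E1 := act_eq_of_lie_eq_zero h lie_f1_toG1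
  have E3 := act_eq_of_lie_eq_zero h lie_f3_toG1
  have E5 := act_eq_of_lie_eq_zero h lie_f5_toG1
  simp only [root_neg_smul_coroot] at E0 E1 E3 E5
  have a9 := congrFun E0 9
  have a11 := congrFun E0 11
  have a12 := congrFun E0 12
  have a13 := congrFun E0 13
  have b7 := congrFun E1 7
  have b10 := congrFun E1 10
  have b11 := congrFun E1 11
  have b13 := congrFun E1 13
  have d8 := congrFun E5 8
  have d10 := congrFun E5 10
  have d12 := congrFun E5 12
  have d13 := congrFun E5 13
  have g13 := congrFun E3 13
  clear E0 E1 E3 E5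
  simp [act, Coeffs.coord, cartanMatrix] at a9 a11 a12 a13 b7 b10 b11 b13 d8 d10 d12 d13 g13
  have h63 := hc.c63_eq
  have h₁ := hc.d1_ne
  have h₅ := hc.d5_ne
  have hd3 := hc.d3_eq
  have h0 := hc.c0_eq
  have hne := hc.c63_ne
  have e11 : L 11 = c.c5 * L 13 := by linear_combination d13
  have e12 : L 12 = c.c1 * L 13 := by linear_combination b13
  have e10 : L 10 = c.c0 * L 13 - L 1 := by linear_combination a13
  have e7 : L 7 = c.c0 * L 11 + L 1 := by linear_combination a11
  have e8 : L 8 = c.c0 * L 12 + L 1 := by linear_combination a12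
  have e9 : L 9 = c.c1 * L 11 + L 3 * c.c63 := by linear_combination b11
  have e5 : L 5 = L 3 := by
    refine mul_right_cancel₀ hne ?_
    rw [e11] at e9
    rw [e12] at d12
    linear_combination -d12 + e9
  have e2 : L 2 = L 8 - c.c1 * L 10 - L 3 := by linear_combination -b10
  have e4 : L 4 = L 7 - c.c5 * L 10 - L 5 := by linear_combination -d10
  have e6 : L 6 = L 3 * c.c3 + c.c1 * L 7 - L 2 := by linear_combination b7
  have e0 : L 0 = (L 1 * c.c3 + c.c0 * L 9 - L 6) / c.c63 := by
    rw [eq_div_iff hne]; linear_combination a9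
  rw [e11] at e9 e7
  rw [e12] at e8
  rw [e5] at e4
  rw [e10, e8] at e2
  rw [e10, e7] at e4
  rw [e7, e2] at e6
  rw [e9, e6] at e0
  rw [e9, e12, e11, e10] at g13
  have e1 : L 1 = L 3 + L 13 * ((1 + c.c1) * (1 + c.c5)) ^ 2 * (1 - s) / 6 := by
    refine mul_right_cancel₀ hne ?_
    have : L 13 * ((1 + c.c1) * (1 + c.c5)) ^ 2 * (1 - s) / 6 * c.c63 =
        L 13 * ((1 + c.c1) * (1 + c.c5)) * (1 - s) := by
      rw [h63]; field_simp
    rw [add_mul, this]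
    linear_combination -g13 - L 13 * hd3
  refine ⟨L 3, L 13 * ((1 + c.c1) * (1 + c.c5)) ^ 2 / 6, ?_⟩
  clear a9 a11 a12 a13 b7 b10 b11 b13 d8 d10 d12 d13 g13 hd3 h hc hne
  generalize hσ : L 13 = σ at *
  generalize hl : L 3 = l at *
  obtain ⟨c0, c1, c3, c5, c63⟩ := c
  dsimp only at *
  subst h63 h0
  funext i
  rw [Pi.add_apply, Pi.smul_apply, Pi.smul_apply]
  fin_cases i <;>
  simp [torus, Coeffs.scale, kVec, Coeffs.xCoord, Coeffs.yCoord, Coeffs.hCoord, Coeffs.coord, hσ, hl,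
    e0, e1, e2, e4, e5, e6, e7, e8, e9, e10, e11, e12] <;>
  field_simp <;> ring

/-! ### The first gauge transformation along the curve -/

/-- The coordinates of `Λ₁`. -/
def Λ₁Coord : Deg1 := ![0, 1, 1, 1, 1, 0, 2, 1, 1, 1, -1, -1, -1, -2]

/-- The coordinates of `Λ₂`. -/
def Λ₂Coord : Deg1 := ![2, 0, 0, -2, -2, -2, -2, 2, 2, -7, 4, -5, 4, 2]

theorem raiseExp_smul (a : Fin 3 → ℂ) (r : ℂ) (v : Deg1) :
    raiseExp a (r • v) = r • raiseExp a v := by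
  funext i
  rw [Pi.smul_apply]
  fin_cases i <;> simp [raiseExp] <;> ring

theorem firstExp_smul (w : Fin 7 → ℂ) (ν : Fin 3 → ℂ) (r : ℂ) (v : Deg1) :
    firstExp w ν (r • v) = r • firstExp w ν v := by
  rw [firstExp, torus_smul, raiseExp_smul]; rfl

theorem FirstGauge.Γ₁_eq (G : FirstGauge) (t : ℂ × ℂ) : G.Γ₁ t = toG0 (G.η t) (G.ν t) 0 := by
  simp [FirstGauge.Γ₁, toG0]

/-- The image of `a Λ₁ + b Λ₂` under the first gauge transformation, in coordinates. -/
noncomputable def FirstGauge.image (G : FirstGauge) (t a : ℂ × ℂ) : Deg1 :=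
  firstExp (G.η t).root (G.ν t) (a.1 • Λ₁Coord + a.2 • Λ₂Coord)

theorem toG1_comb (a : ℂ × ℂ) : toG1 (a.1 • Λ₁Coord + a.2 • Λ₂Coord) = a.1 • Λ₁ + a.2 • Λ₂ := by
  rw [Λ₁_eq, Λ₂_eq, map_add, map_smul, map_smul]; rfl

theorem FirstGauge.gaugeFlow_image (G : FirstGauge) (t a : ℂ × ℂ) :
    GaugeFlow (G.Γ₁ t) 0 (a.1 • Λ₁ + a.2 • Λ₂) (toG1 (G.image t a)) := by
  rw [G.Γ₁_eq, ← toG1_comb]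
  exact gaugeFlow_firstExp _ _ _

theorem FirstGauge.image_neg (G : FirstGauge) {t : ℂ × ℂ} (ht : t ∈ G.T) :
    G.image t (-t) = (G.c t).coord := by
  refine toG1_injective ?_
  rw [← Coeffs.normalForm_eq]
  refine ((G.gaugeFlow_image t (-t)).eq_of_isExpAd ?_).symm
  have := G.normalize t ht
  simpa [FirstGauge.Γ₁, sub_eq_add_neg] using this

/-- The images of `Λ₁` and `Λ₂` commute. -/
theorem FirstGauge.lie_image (G : FirstGauge) (t a b : ℂ × ℂ) :
    ⁅toG1 (G.image t a), toG1 (G.image t b)⁆ = 0 := by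
  have h := (G.gaugeFlow_image t a).isExpAd_lie (G.gaugeFlow_image t b)
  have h₀ : ⁅a.1 • Λ₁ + a.2 • Λ₂, b.1 • Λ₁ + b.2 • Λ₂⁆ = 0 := by
    have : ⁅Λ₂, Λ₁⁆ = 0 := by rw [← lie_skew, lie_Λ₁_Λ₂, neg_zero]
    simp [lie_Λ₁_Λ₂, this]
  rw [h₀] at h
  exact (GaugeFlow.of_lie_eq_zero (lie_zero _)).eq_of_isExpAd h

theorem hasDerivAt_curve {G : FirstGauge} {U : Set ℂ} (hU : IsOpen U) {γ : ℂ → ℂ × ℂ}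
    (hγ : IsSlice G U γ) {s : ℂ} (hs : s ∈ U) : ∃ (t' : ℂ × ℂ) (η' : Cartan) (ν' : Fin 3 → ℂ),
      HasDerivAt γ t' s ∧ HasDerivAt (fun z => G.η (γ z)) η' s ∧
      HasDerivAt (fun z => G.ν (γ z)) ν' s := by
  have h := (hγ.differentiableOn.differentiableAt (hU.mem_nhds hs)).hasDerivAt
  have hT := G.isOpen_T.mem_nhds (hγ.mem s hs)
  exact ⟨_, _, _, h, (G.differentiableOn_η.differentiableAt hT).hasFDerivAt.comp_hasDerivAt s h,
    (G.differentiableOn_ν.differentiableAt hT).hasFDerivAt.comp_hasDerivAt s h⟩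

theorem hasDerivAt_coord {G : FirstGauge} {U : Set ℂ} (hU : IsOpen U) {γ : ℂ → ℂ × ℂ}
    (hγ : IsSlice G U γ) {s : ℂ} (hs : s ∈ U) {t' : ℂ × ℂ} {η' : Cartan} {ν' : Fin 3 → ℂ}
    (ht : HasDerivAt γ t' s) (hη : HasDerivAt (fun z => G.η (γ z)) η' s)
    (hν : HasDerivAt (fun z => G.ν (γ z)) ν' s) :
    HasDerivAt (fun z => (G.c (γ z)).coord)
      (act η'.root (firstLogDeriv (G.η (γ s)).root (G.ν (γ s)) η'.root ν') 0 (G.c (γ s)).coord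
        - G.image (γ s) t') s := by
  have h₁ : HasDerivAt (fun z => -(γ z).1) (-t'.1) s := (hasFDerivAt_fst.comp_hasDerivAt s ht).neg
  have h₂ : HasDerivAt (fun z => -(γ z).2) (-t'.2) s := (hasFDerivAt_snd.comp_hasDerivAt s ht).neg
  have h := hasDerivAt_firstExp (hasDerivAt_root hη) hν
    ((h₁.smul_const Λ₁Coord).add (h₂.smul_const Λ₂Coord))
  have hc : (fun z => (G.c (γ z)).coord) =ᶠ[nhds s]
      fun z => G.image (γ z) (-γ z) := by
    filter_upwards [hU.mem_nhds hs] with z hz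
    exact (G.image_neg (hγ.mem z hz)).symm
  refine (h.congr_of_eventuallyEq hc).congr_deriv ?_
  rw [← G.image_neg (hγ.mem s hs), sub_eq_add_neg, add_comm]
  congr 1
  have : (-t'.1) • Λ₁Coord + (-t'.2) • Λ₂Coord = (-1 : ℂ) • (t'.1 • Λ₁Coord + t'.2 • Λ₂Coord) := by
    module
  rw [this, firstExp_smul, neg_one_smul]
  rfl

theorem IsSlice.onSlice {G : FirstGauge} {U : Set ℂ} {γ : ℂ → ℂ × ℂ} (hγ : IsSlice G U γ)
    (hU01 : ∀ s ∈ U, s ≠ 0 ∧ s ≠ 1) {s : ℂ} (hs : s ∈ U) : (G.c (γ s)).OnSlice s :=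
  ⟨hγ.s₁_eq s hs, hγ.s₂_eq s hs, (hU01 s hs).1⟩

/-- The values of the simple roots at a grading element. -/
def gradRoot : Fin 7 → ℂ := ![1, 1, 0, 1, 0, 1, 0]

theorem IsGrading.root_eq {θ : Cartan} (hθ : IsGrading θ) : θ.root = gradRoot := by
  obtain ⟨h₀, h₁⟩ := hθ
  funext i
  fin_cases i
  · exact h₁ 0 (by simp)
  · exact h₁ 1 (by simp)
  · exact h₀ 2 (by simp)
  · exact h₁ 3 (by simp)
  · exact h₀ 4 (by simp)
  · exact h₁ 5 (by simp)
  · exact h₀ 6 (by simp)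

theorem act_gradRoot (v : Deg1) : act gradRoot 0 0 v = v := by
  funext i
  fin_cases i <;> simp [act, gradRoot]

/-- Logarithmic derivative of `Coeffs.scale`, in terms of those of `1 + c₁` and `1 + c₅`. -/
def scaleLog (a b : ℂ) : Fin 7 → ℂ :=
  ![2 * (a + b), a, -a, a + b, -b, b, -2 * (a + b)]

theorem marksSum_scaleLog (a b : ℂ) : marksSum (scaleLog a b) = 0 := by
  simp [marksSum, scaleLog]; ring

theorem hasDerivAt_scale {c : ℂ → Coeffs} {s a b : ℂ} (h₁ : 1 + (c s).c1 ≠ 0) (h₅ : 1 + (c s).c5 ≠ 0)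
    (ha : HasDerivAt (fun z => (c z).c1) ((1 + (c s).c1) * a) s)
    (hb : HasDerivAt (fun z => (c z).c5) ((1 + (c s).c5) * b) s) (j : Fin 7) :
    HasDerivAt (fun z => (c z).scale j) ((c s).scale j * scaleLog a b j) s := by
  have ha := ha.const_add 1
  have hb := hb.const_add 1
  have hP := (ha.mul hb).pow 2
  have hne : ((1 + (c s).c1) * (1 + (c s).c5)) ^ 2 ≠ 0 := pow_ne_zero 2 (mul_ne_zero h₁ h₅)
  fin_cases j
  · refine (hP.div_const 6).congr_deriv ?_
    simp [Coeffs.scale, scaleLog]; ring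
  · exact ha
  · refine (ha.inv h₁).congr_deriv ?_
    simp [Coeffs.scale, scaleLog]; field_simp
  · refine (ha.mul hb).congr_deriv ?_
    simp [Coeffs.scale, scaleLog]; ring
  · refine (hb.inv h₅).congr_deriv ?_
    simp [Coeffs.scale, scaleLog]; field_simp
  · exact hb
  · refine ((hP.inv hne).const_mul 6).congr_deriv ?_
    simp [Coeffs.scale, scaleLog]; field_simp

/-! ### The linear system behind the reduced system -/

/-- Removing from a logarithmic derivative the torus action, and a multiple `l` of `𝓜⁺` itself, turns
the evolution of `𝓜⁺` into the system of `normalized_imp`. -/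
theorem act_normalize (X ξ ζ α : Fin 7 → ℂ) (z μ : Fin 3 → ℂ) (l τ : ℂ) (n K : Deg1) :
    act (ζ + ξ + l • (6 : ℂ) • α) (fun i => X (node i) * z i + l * (X (node i) * (6 * μ i))) 0
        (torus X n)
      - act ((6 : ℂ) • α) (fun i => X (node i) * (6 * μ i)) 0 (l • torus X n + τ • torus X K)
    = torus X (act ζ z 0 n + (-6 * τ) • act α μ 0 K) + act ξ 0 0 (torus X n) := by
  funext i
  fin_cases i <;> simp [act, torus, node] <;> ring

/-- A family of coefficients on the slice, differentiable at `s`. -/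
structure CurveAt (c : ℂ → Coeffs) (s : ℂ) : Prop where
  onSlice : ∀ᶠ z in nhds s, (c z).OnSlice z
  differentiableAt : DifferentiableAt ℂ (fun z => (c z).coord) s

/-- The coefficients `μᵢ` up to the action of the torus. -/
noncomputable def Coeffs.μCoord (c : Coeffs) (mu : Fin 3 → ℂ) (i : Fin 3) : ℂ :=
  mu i / (6 * c.scale (node i))

namespace CurveAt

variable {c : ℂ → Coeffs} {s : ℂ} (hc : CurveAt c s)
include hc

theorem self : (c s).OnSlice s := hc.onSlice.self_of_nhds

theorem c1 : DifferentiableAt ℂ (fun z => (c z).c1) s := differentiableAt_pi.1 hc.differentiableAt 2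
theorem c5 : DifferentiableAt ℂ (fun z => (c z).c5) s := differentiableAt_pi.1 hc.differentiableAt 4
theorem c3 : DifferentiableAt ℂ (fun z => (c z).c3) s := differentiableAt_pi.1 hc.differentiableAt 6
theorem c63 : DifferentiableAt ℂ (fun z => (c z).c63) s :=
  differentiableAt_pi.1 hc.differentiableAt 9

theorem exists_scaleLog :
    ∃ ξ, marksSum ξ = 0 ∧ ∀ j, HasDerivAt (fun z => (c z).scale j) ((c s).scale j * ξ j) s := by
  have h₁ := hc.self.d1_ne
  have h₅ := hc.self.d5_ne
  exact ⟨_, marksSum_scaleLog _ _, hasDerivAt_scale h₁ h₅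
    (hc.c1.hasDerivAt.congr_deriv (mul_div_cancel₀ _ h₁).symm)
    (hc.c5.hasDerivAt.congr_deriv (mul_div_cancel₀ _ h₅).symm)⟩

theorem differentiableAt_xCoord {lam : ℂ → Fin 3 → ℂ} (hl : DifferentiableAt ℂ lam s) :
    DifferentiableAt ℂ (fun z => (c z).xCoord (lam z)) s :=
  ((differentiableAt_const 1).sub (differentiableAt_pi.1 hl 0)).div (hc.c1.const_add 1) hc.self.d1_ne

theorem differentiableAt_yCoord {lam : ℂ → Fin 3 → ℂ} (hl : DifferentiableAt ℂ lam s) :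
    DifferentiableAt ℂ (fun z => (c z).yCoord (lam z)) s :=
  ((differentiableAt_const 1).sub (differentiableAt_pi.1 hl 1)).div (hc.c5.const_add 1) hc.self.d5_ne

theorem differentiableAt_hCoord {lam : ℂ → Fin 3 → ℂ} (hl : DifferentiableAt ℂ lam s) :
    DifferentiableAt ℂ (fun z => (c z).hCoord (lam z)) s :=
  ((hc.c3.const_add 1).add (hc.c63.mul (differentiableAt_pi.1 hl 2))).div
    ((hc.c1.const_add 1).mul (hc.c5.const_add 1)) (mul_ne_zero hc.self.d1_ne hc.self.d5_ne)

theorem differentiableAt_lam {lam : ℂ → Fin 3 → ℂ}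
    (hx : DifferentiableAt ℂ (fun z => (c z).xCoord (lam z)) s)
    (hy : DifferentiableAt ℂ (fun z => (c z).yCoord (lam z)) s)
    (hh : DifferentiableAt ℂ (fun z => (c z).hCoord (lam z)) s) : DifferentiableAt ℂ lam s := by
  refine differentiableAt_pi.2 fun i => ?_
  fin_cases i
  · refine (((hc.c1.const_add 1).mul hx).const_sub 1).congr_of_eventuallyEq ?_
    filter_upwards [hc.onSlice] with z hz
    have := hz.d1_ne
    simp [Coeffs.xCoord]
    field_simp
    ring
  · refine (((hc.c5.const_add 1).mul hy).const_sub 1).congr_of_eventuallyEq ?_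
    filter_upwards [hc.onSlice] with z hz
    have := hz.d5_ne
    simp [Coeffs.yCoord]
    field_simp
    ring
  · refine (((((hc.c1.const_add 1).mul (hc.c5.const_add 1)).mul hh).sub (hc.c3.const_add 1)).div hc.c63
      hc.self.c63_ne).congr_of_eventuallyEq ?_
    filter_upwards [hc.onSlice] with z hz
    have h₁ := hz.d5_ne
    have h₂ := hz.d1_ne
    have h₃ := hz.c63_ne
    simp [Coeffs.hCoord]
    field_simp
    ring

theorem hasDerivAt_lowerExp_coord {ξ : Fin 7 → ℂ}
    (hξ : ∀ j, HasDerivAt (fun z => (c z).scale j) ((c s).scale j * ξ j) s) {lam : ℂ → Fin 3 → ℂ}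
    {x' y' h' : ℂ} (hx : HasDerivAt (fun z => (c z).xCoord (lam z)) x' s)
    (hy : HasDerivAt (fun z => (c z).yCoord (lam z)) y' s)
    (hh : HasDerivAt (fun z => (c z).hCoord (lam z)) h' s) :
    HasDerivAt (fun z => lowerExp (lam z) (c z).coord)
      (torus (c s).scale (mVecDeriv ((c s).xCoord (lam s)) ((c s).yCoord (lam s)) x' y' h')
        + act ξ 0 0 (torus (c s).scale (mVec s ((c s).xCoord (lam s)) ((c s).yCoord (lam s))
          ((c s).hCoord (lam s))))) s := by
  refine (hasDerivAt_torus hξ (hasDerivAt_mVec hx hy hh)).congr_of_eventuallyEq ?_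
  filter_upwards [hc.onSlice] with z hz
  exact hz.lowerExp_coord (lam z)

/-- The evolution of the first gauge transformation: it fixes the rate at which the curve moves
transversally to the centralizer of the normal form, and the component along `d` of the logarithmic
derivative. This is `normalized_imp` with the grading element in place of `κ` and `μ = 0`. -/
theorem first_gauge {w : Fin 7 → ℂ} {A : Fin 3 → ℂ} {l τ : ℂ}
    (h : HasDerivAt (fun z => (c z).coord) (act w A 0 (c s).coord - (l • (c s).coord +
      τ • torus (c s).scale (kVec s ((c s).xCoord 0) ((c s).yCoord 0) ((c s).hCoord 0)))) s) :
    -6 * τ * (s * (s - 1)) = 1 ∧ marksSum w = -6 * τ * (s - 1) + 6 * l := by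
  obtain ⟨ξ, hξ₀, hξ⟩ := hc.exists_scaleLog
  have h0 : DifferentiableAt ℂ (fun _ : ℂ => (0 : Fin 3 → ℂ)) s := differentiableAt_const _
  have h' := hc.hasDerivAt_lowerExp_coord hξ (hc.differentiableAt_xCoord h0).hasDerivAt
    (hc.differentiableAt_yCoord h0).hasDerivAt (hc.differentiableAt_hCoord h0).hasDerivAt
  have hl (v : Deg1) : lowerExp 0 v = v := by
    funext i
    fin_cases i <;> simp [lowerExp]
  simp only [hl] at h'
  have key := h.unique h'
  rw [hc.self.coord_eq] at key
  let α : Fin 7 → ℂ := (6⁻¹ : ℂ) • gradRoot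
  have hα : (6 : ℂ) • α = gradRoot := by simp [α, smul_smul]
  have hmα : marksSum α = 1 := by simp [marksSum, α, gradRoot]; norm_num
  have hsc := hc.self.scale_ne
  have hn := act_normalize (c s).scale ξ (w - ξ - l • gradRoot) α
    (fun i => A i / (c s).scale (node i)) 0 l τ (mVec s ((c s).xCoord 0) ((c s).yCoord 0)
      ((c s).hCoord 0)) (kVec s ((c s).xCoord 0) ((c s).yCoord 0) ((c s).hCoord 0))
  have hz : (fun i => (c s).scale (node i) * (A i / (c s).scale (node i)) +
      l * ((c s).scale (node i) * (6 * (0 : Fin 3 → ℂ) i))) = A := by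
    funext i
    rw [mul_div_cancel₀ _ (hsc _)]
    simp
  have hw : w - ξ - l • gradRoot + ξ + l • gradRoot = w := by abel
  have hμ : (fun i => (c s).scale (node i) * (6 * (0 : Fin 3 → ℂ) i)) = 0 := by
    funext i; simp
  rw [hα, hz, hw, hμ, act_gradRoot] at hn
  rw [hn] at key
  obtain ⟨h₁, -, h₂, -⟩ := normalized_imp (torus_injective hsc (add_right_cancel key)).symm
  rw [hmα, mul_one] at h₁
  refine ⟨h₁, ?_⟩
  have h₃ := congrArg marksSum h₂
  have h₄ : marksSum ((-6 * τ) • ζSol s ((c s).xCoord 0) ((c s).yCoord 0) ((c s).hCoord 0) α 0) =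
      -6 * τ * (s - 1) := by
    have := marksSum_ζSol (s := s) (x := (c s).xCoord 0) (y := (c s).yCoord 0)
      (h := (c s).hCoord 0) (α := α) (μ := 0)
    rw [hmα, mul_one] at this
    rw [← this]
    simp only [marksSum, Pi.smul_apply, smul_eq_mul]
    ring
  rw [h₄] at h₃
  rw [← h₃]
  simp [marksSum, gradRoot] at hξ₀ ⊢
  linear_combination hξ₀

variable {l τ : ℂ} {α : Fin 7 → ℂ} {lam mu : ℂ → Fin 3 → ℂ}

theorem hasDerivAt_μCoord {ξ : Fin 7 → ℂ}
    (hξ : ∀ j, HasDerivAt (fun z => (c z).scale j) ((c s).scale j * ξ j) s) {mu' : Fin 3 → ℂ}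
    (hmu : HasDerivAt mu mu' s) (i : Fin 3) : HasDerivAt (fun z => (c z).μCoord (mu z) i)
      (mu' i / (6 * (c s).scale (node i)) - (c s).μCoord (mu s) i * ξ (node i)) s := by
  have hne := hc.self.scale_ne (node i)
  refine ((hasDerivAt_pi.1 hmu i).div ((hξ (node i)).const_mul 6)
    (mul_ne_zero (by norm_num) hne)).congr_deriv ?_
  rw [Coeffs.μCoord]
  field_simp

theorem hasDerivAt_mu {ξ : Fin 7 → ℂ}
    (hξ : ∀ j, HasDerivAt (fun z => (c z).scale j) ((c s).scale j * ξ j) s) {m' : Fin 3 → ℂ}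
    (hm : ∀ i, HasDerivAt (fun z => (c z).μCoord (mu z) i) (m' i) s) :
    HasDerivAt mu (fun i => 6 * (c s).scale (node i) *
      (m' i + (c s).μCoord (mu s) i * ξ (node i))) s := by
  refine hasDerivAt_pi.2 fun i => ?_
  refine ((((hξ (node i)).mul (hm i)).const_mul 6).congr_of_eventuallyEq ?_).congr_deriv ?_
  · filter_upwards [hc.onSlice] with z hz
    have := hz.scale_ne (node i)
    simp only [Coeffs.μCoord, Pi.mul_apply]
    field_simp
  · ring

/-- The linear system behind the reduced system amounts to `marksSum α = 1` and explicit evolution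
equations for the normalized coordinates. -/
theorem linear_system_imp {ζ : Fin 7 → ℂ} {z lam' : Fin 3 → ℂ}
    (hT : -6 * τ * (s * (s - 1)) = 1) (hlam : HasDerivAt lam lam' s)
    (hM : HasDerivAt (fun z => lowerExp (lam z) (c z).coord)
      (act ζ z 0 (lowerExp (lam s) (c s).coord) - act ((6 : ℂ) • α) (mu s) 0
        (l • lowerExp (lam s) (c s).coord + τ • torus (c s).scale (kVec s ((c s).xCoord (lam s))
          ((c s).yCoord (lam s)) ((c s).hCoord (lam s))))) s)
    (hmu : HasDerivAt mu (fun i => ζ (node i) * mu s i - ((6 : ℂ) • α) (node i) * z i) s) :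
    let x := (c s).xCoord (lam s)
    let y := (c s).yCoord (lam s)
    let h := (c s).hCoord (lam s)
    let μ := (c s).μCoord (mu s)
    marksSum α = 1 ∧ HasDerivAt (fun z => (c z).xCoord (lam z)) (-6 * τ * xDot s x y h α μ) s ∧
      HasDerivAt (fun z => (c z).yCoord (lam z)) (-6 * τ * yDot s x y h α μ) s ∧
      HasDerivAt (fun z => (c z).hCoord (lam z)) (1 + -6 * τ * hDot s x y h α μ) s ∧
      ∀ i, HasDerivAt (fun z => (c z).μCoord (mu z) i) (-6 * τ * μDot s x y h α μ i) s := by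
  intro x y h μ
  obtain ⟨ξ, hξ₀, hξ⟩ := hc.exists_scaleLog
  have hl := hlam.differentiableAt
  have hx := (hc.differentiableAt_xCoord hl).hasDerivAt
  have hy := (hc.differentiableAt_yCoord hl).hasDerivAt
  have hh := (hc.differentiableAt_hCoord hl).hasDerivAt
  have key := hM.unique (hc.hasDerivAt_lowerExp_coord hξ hx hy hh)
  rw [hc.self.lowerExp_coord] at key
  have hsc := hc.self.scale_ne
  have hn := act_normalize (c s).scale ξ (ζ - ξ - l • (6 : ℂ) • α) α
    (fun i => (z i - l * mu s i) / (c s).scale (node i)) μ l τ (mVec s x y h) (kVec s x y h)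
  have hmus : (fun i => (c s).scale (node i) * (6 * μ i)) = mu s := by
    funext i
    have := hsc (node i)
    simp only [μ, Coeffs.μCoord]
    field_simp
  have hmusi (i) : (c s).scale (node i) * (6 * μ i) = mu s i := congrFun hmus i
  have hz : (fun i => (c s).scale (node i) * ((z i - l * mu s i) / (c s).scale (node i)) +
      l * ((c s).scale (node i) * (6 * μ i))) = z := by
    funext i
    rw [mul_div_cancel₀ _ (hsc _), hmusi]
    ring
  have hw : ζ - ξ - l • (6 : ℂ) • α + ξ + l • (6 : ℂ) • α = ζ := by abel
  rw [hz, hw, hmus] at hn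
  rw [hn] at key
  obtain ⟨h₁, h₂, h₃, h₄, h₅, h₆⟩ :=
    normalized_imp (torus_injective hsc (add_right_cancel key)).symm
  rw [h₄] at hx
  rw [h₅] at hy
  rw [h₆] at hh
  rw [hT, one_mul] at h₁
  refine ⟨h₁, hx, hy, hh, fun i => (hc.hasDerivAt_μCoord hξ hmu i).congr_deriv ?_⟩
  have h₂ := congrFun h₂ i
  have h₃ := congrFun h₃ (node i)
  have hne := hsc (node i)
  simp only [Pi.smul_apply, Pi.sub_apply, smul_eq_mul] at h₂ h₃
  rw [div_eq_iff hne] at h₂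
  have hz : z i = l * mu s i + -6 * τ * zSol s x y h α μ i * (c s).scale (node i) := by
    linear_combination h₂
  have hζ : ζ (node i) = -6 * τ * ζSol s x y h α μ (node i) + ξ (node i) + l * (6 * α (node i)) := by
    linear_combination h₃
  simp only [Pi.smul_apply, smul_eq_mul, hz, hζ, μDot]
  change _ - μ i * _ = _
  rw [← hmusi]
  field_simp
  ring

/-- The converse of `linear_system_imp`; the parameter `l` is free. -/
theorem linear_system_of (hT : -6 * τ * (s * (s - 1)) = 1) (hα : marksSum α = 1)
    (hx : HasDerivAt (fun z => (c z).xCoord (lam z)) (-6 * τ * xDot s ((c s).xCoord (lam s))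
      ((c s).yCoord (lam s)) ((c s).hCoord (lam s)) α ((c s).μCoord (mu s))) s)
    (hy : HasDerivAt (fun z => (c z).yCoord (lam z)) (-6 * τ * yDot s ((c s).xCoord (lam s))
      ((c s).yCoord (lam s)) ((c s).hCoord (lam s)) α ((c s).μCoord (mu s))) s)
    (hh : HasDerivAt (fun z => (c z).hCoord (lam z)) (1 + -6 * τ * hDot s ((c s).xCoord (lam s))
      ((c s).yCoord (lam s)) ((c s).hCoord (lam s)) α ((c s).μCoord (mu s))) s)
    (hμ : ∀ i, HasDerivAt (fun z => (c z).μCoord (mu z) i) (-6 * τ * μDot s ((c s).xCoord (lam s))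
      ((c s).yCoord (lam s)) ((c s).hCoord (lam s)) α ((c s).μCoord (mu s)) i) s) :
    ∃ (ζ : Fin 7 → ℂ) (z lam' : Fin 3 → ℂ), marksSum ζ = -6 * τ * (s - 1) + 6 * l ∧
      HasDerivAt lam lam' s ∧
      HasDerivAt (fun z => lowerExp (lam z) (c z).coord)
        (act ζ z 0 (lowerExp (lam s) (c s).coord) - act ((6 : ℂ) • α) (mu s) 0
          (l • lowerExp (lam s) (c s).coord + τ • torus (c s).scale (kVec s ((c s).xCoord (lam s))
            ((c s).yCoord (lam s)) ((c s).hCoord (lam s))))) s ∧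
      HasDerivAt mu (fun i => ζ (node i) * mu s i - ((6 : ℂ) • α) (node i) * z i) s := by
  obtain ⟨ξ, hξ₀, hξ⟩ := hc.exists_scaleLog
  have hM := hc.hasDerivAt_lowerExp_coord hξ hx hy hh
  have hmu := hc.hasDerivAt_mu hξ hμ
  have hlam := hc.differentiableAt_lam hx.differentiableAt hy.differentiableAt hh.differentiableAt
  rw [normalized_of (by rw [hT, hα, one_mul])] at hM
  set x := (c s).xCoord (lam s)
  set y := (c s).yCoord (lam s)
  set h := (c s).hCoord (lam s)
  set μ := (c s).μCoord (mu s) with hμdef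
  have hmus : (fun i => (c s).scale (node i) * (6 * μ i)) = mu s := by
    funext i
    have := hc.self.scale_ne (node i)
    simp only [μ, Coeffs.μCoord]
    field_simp
  have hmusi (i) : (c s).scale (node i) * (6 * μ i) = mu s i := congrFun hmus i
  rw [← act_normalize _ _ _ _ _ _ l, hmus, ← hc.self.lowerExp_coord] at hM
  refine ⟨_, _, _, ?_, hlam.hasDerivAt, hM, hmu.congr_deriv ?_⟩
  · have := marksSum_ζSol (s := s) (x := x) (y := y) (h := h) (α := α) (μ := μ)
    simp only [marksSum, Pi.smul_apply, Pi.add_apply, smul_eq_mul] at this hξ₀ hα ⊢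
    linear_combination -6 * τ * this + hξ₀ + (6 * l + -6 * τ * (s - 1)) * hα
  · funext i
    simp only [Pi.add_apply, Pi.smul_apply, smul_eq_mul, μDot, ← hmusi]
    ring

end CurveAt

/-! ### The change of variables -/

namespace Coeffs.OnSlice

variable {c : Coeffs} {s : ℂ} (hc : c.OnSlice s)
include hc

theorem d3_ne : 1 + c.c3 - c.c0 * c.c63 ≠ 0 := by
  rw [hc.d3_eq]
  exact mul_ne_zero hc.ne_zero (mul_ne_zero hc.d1_ne hc.d5_ne)

theorem hCoord_ne {lam : Fin 3 → ℂ} (h : 1 + c.c3 + c.c63 * lam 2 ≠ 0) : c.hCoord lam ≠ 0 :=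
  div_ne_zero h (mul_ne_zero hc.d1_ne hc.d5_ne)

theorem qVar_eq (lam : Fin 3 → ℂ) :
    qVar c lam = qNorm s (c.xCoord lam) (c.yCoord lam) (c.hCoord lam) := by
  funext i
  fin_cases i
  · rfl
  · rfl
  · change (1 + c.c3 - c.c0 * c.c63) / _ = s / (_ / _)
    rw [hc.d3_eq, div_div_eq_mul_div]

theorem pVar_eq (κ : Cartan) (lam mu : Fin 3 → ℂ) :
    pVar c κ lam mu = pNorm s (c.hCoord lam) (c.μCoord mu) (param κ 6) := by
  have h₁ := hc.d1_ne
  have h₅ := hc.d5_ne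
  have hs := hc.ne_zero
  funext i
  fin_cases i
  · simp [pVar, pNorm, Coeffs.μCoord, node, Coeffs.scale]
    field_simp
  · simp [pVar, pNorm, Coeffs.μCoord, node, Coeffs.scale]
    field_simp
  · simp [pVar, pNorm, Coeffs.μCoord, node, Coeffs.scale, hc.d3_eq, Coeffs.hCoord, param]
    rw [hc.c63_eq]
    field_simp

theorem bijOn (κ : Cartan) : Set.BijOn
    (fun x : (Fin 3 → ℂ) × (Fin 3 → ℂ) => (qVar c x.1, pVar c κ x.1 x.2))
    {x | 1 + c.c3 + c.c63 * x.1 2 ≠ 0} {y | y.1 2 ≠ 0} := by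
  have h₁ := hc.d1_ne
  have h₅ := hc.d5_ne
  have h₃ := hc.d3_ne
  have h₆ := hc.c63_ne
  obtain ⟨D, hD⟩ : ∃ D, 1 + c.c3 - c.c0 * c.c63 = D := ⟨_, rfl⟩
  rw [hD] at h₃
  let W : (Fin 3 → ℂ) → ℂ := fun q => D / q 2
  let g : (Fin 3 → ℂ) × (Fin 3 → ℂ) → (Fin 3 → ℂ) × (Fin 3 → ℂ) := fun y =>
    (![1 - (1 + c.c1) * y.1 0, 1 - (1 + c.c5) * y.1 1, (W y.1 - (1 + c.c3)) / c.c63],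
      ![-6 * y.2 0 / (1 + c.c1), -6 * y.2 1 / (1 + c.c5),
        (-6 * c.c63 * D * y.2 2 / W y.1
          - c.c63 * κ.form (Cartan.coroot 6)) / W y.1])
  have hg (q : Fin 3 → ℂ) : 1 + c.c3 + c.c63 * ((W q - (1 + c.c3)) / c.c63) = W q := by
    field_simp
    ring
  refine Set.InvOn.bijOn (f' := g) ⟨?_, ?_⟩ ?_ ?_
  · rintro ⟨lam, mu⟩ (h : 1 + c.c3 + c.c63 * lam 2 ≠ 0)
    have hW : W (qVar c lam) = 1 + c.c3 + c.c63 * lam 2 := by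
      simp only [W, qVar, hD, Matrix.cons_val]
      field_simp
    refine Prod.ext ?_ ?_
    · funext i
      fin_cases i
      · simp [g, qVar]; field_simp; ring
      · simp [g, qVar]; field_simp; ring
      · simp [g, hW]; field_simp
    · funext i
      fin_cases i
      · simp [g, pVar]; field_simp
      · simp [g, pVar]; field_simp
      · simp [g, hW, pVar, hD]; field_simp; ring
  · rintro ⟨q, p⟩ (h : q 2 ≠ 0)
    have hW : W q ≠ 0 := div_ne_zero h₃ h
    refine Prod.ext ?_ ?_
    · funext i
      fin_cases i
      · simp [g, qVar]; field_simp
      · simp [g, qVar]; field_simp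
      · simp only [g, qVar]
        simp [hg, W, hD]
        field_simp
    · funext i
      fin_cases i
      · simp [g, pVar]; field_simp
      · simp [g, pVar]; field_simp
      · simp only [g, pVar]
        simp only [Fin.reduceFinMk, Matrix.cons_val, hg, hD]
        field_simp
        ring
  · rintro ⟨lam, mu⟩ (h : 1 + c.c3 + c.c63 * lam 2 ≠ 0)
    exact div_ne_zero hc.d3_ne h
  · rintro ⟨q, p⟩ (h : q 2 ≠ 0)
    change 1 + c.c3 + c.c63 * ((W q - (1 + c.c3)) / c.c63) ≠ 0
    rw [hg]
    exact div_ne_zero h₃ h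

end Coeffs.OnSlice

theorem CoupledPVI.congr {α : Fin 7 → ℂ} {U : Set ℂ} (hU : IsOpen U) {q p q' p' : ℂ → Fin 3 → ℂ}
    (hq : ∀ s ∈ U, q' s = q s) (hp : ∀ s ∈ U, p' s = p s) (h : CoupledPVI α U q p) :
    CoupledPVI α U q' p' := by
  refine ⟨h.1, fun s hs i => ?_⟩
  obtain ⟨h₁, h₂, h₃, h₄⟩ := h.2 s hs i
  have eq : (fun z => q' z i) =ᶠ[nhds s] fun z => q z i := by
    filter_upwards [hU.mem_nhds hs] with z hz
    rw [hq z hz]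
  have ep : (fun z => p' z i) =ᶠ[nhds s] fun z => p z i := by
    filter_upwards [hU.mem_nhds hs] with z hz
    rw [hp z hz]
  exact ⟨h₁.congr_of_eventuallyEq eq, h₂.congr_of_eventuallyEq ep, by
    rw [eq.deriv_eq, hq s hs, hp s hs, h₃], by rw [ep.deriv_eq, hq s hs, hp s hs, h₄]⟩

/-- The evolution equations of the normalized coordinates at time `s`. -/
def NormalizedODE (α : Fin 7 → ℂ) (x y h : ℂ → ℂ) (μ : ℂ → Fin 3 → ℂ) (s : ℂ) : Prop :=
  HasDerivAt x ((s * (s - 1))⁻¹ * xDot s (x s) (y s) (h s) α (μ s)) s ∧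
  HasDerivAt y ((s * (s - 1))⁻¹ * yDot s (x s) (y s) (h s) α (μ s)) s ∧
  HasDerivAt h (1 + (s * (s - 1))⁻¹ * hDot s (x s) (y s) (h s) α (μ s)) s ∧
  ∀ i, HasDerivAt (fun z => μ z i) ((s * (s - 1))⁻¹ * μDot s (x s) (y s) (h s) α (μ s) i) s

section PVI

variable {α : Fin 7 → ℂ} {x y h : ℂ → ℂ} {μ : ℂ → Fin 3 → ℂ} {s : ℂ}

theorem hasDerivAt_qNorm_two {h' : ℂ} (hh₀ : h s ≠ 0) (hh : HasDerivAt h h' s) :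
    HasDerivAt (fun z => qNorm z (x z) (y z) (h z) 2) (1 / h s - s * h' / h s ^ 2) s := by
  refine ((hasDerivAt_id s).div hh hh₀).congr_deriv ?_
  simp only [id]
  field_simp

theorem hasDerivAt_pNorm_two {h' m' a : ℂ} (hs₀ : s ≠ 0) (hh : HasDerivAt h h' s)
    (hm : HasDerivAt (fun z => μ z 2) m' s) : HasDerivAt (fun z => pNorm z (h z) (μ z) a 2)
      ((h s * (h s * μ s 2 + a) - s * (h' * (2 * h s * μ s 2 + a) + h s ^ 2 * m')) / s ^ 2) s := by
  refine ((hh.neg.mul ((hh.mul hm).add_const a)).div (hasDerivAt_id s) hs₀).congr_deriv ?_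
  simp only [id, Pi.neg_apply, Pi.mul_apply]
  field_simp
  ring

/-- The evolution equations of the normalized coordinates give the coupled Painlevé VI equations. -/
theorem NormalizedODE.pvi (H : NormalizedODE α x y h μ s) (hα : marksSum α = 1) (hs₀ : s ≠ 0)
    (hs₁ : s ≠ 1) (hh₀ : h s ≠ 0) (i : Fin 3) :
    DifferentiableAt ℂ (fun z => qNorm z (x z) (y z) (h z) i) s ∧
    DifferentiableAt ℂ (fun z => pNorm z (h z) (μ z) (α 6) i) s ∧
    s * (s - 1) * deriv (fun z => qNorm z (x z) (y z) (h z) i) s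
      = poisson (coupledH α s) (fun q' _ => q' i) (qNorm s (x s) (y s) (h s))
        (pNorm s (h s) (μ s) (α 6)) ∧
    s * (s - 1) * deriv (fun z => pNorm z (h z) (μ z) (α 6) i) s
      = poisson (coupledH α s) (fun _ p' => p' i) (qNorm s (x s) (y s) (h s))
        (pNorm s (h s) (μ s) (α 6)) := by
  obtain ⟨hx, hy, hh, hμ⟩ := H
  have hS : s * (s - 1) ≠ 0 := mul_ne_zero hs₀ (sub_ne_zero.2 hs₁)
  rw [poisson_q, poisson_p]
  fin_cases i
  · have hq : HasDerivAt (fun z => qNorm z (x z) (y z) (h z) 0) _ s := hx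
    have hp : HasDerivAt (fun z => pNorm z (h z) (μ z) (α 6) 0) _ s := (hμ 0).neg
    refine ⟨hq.differentiableAt, hp.differentiableAt, ?_, ?_⟩
    · refine Eq.trans ?_ (dp_zero hs₀ hh₀ hα).symm
      exact (congrArg _ hq.deriv).trans (mul_inv_cancel_left₀ hS _)
    · refine Eq.trans ?_ (congrArg Neg.neg (dq_zero hs₀ hh₀ hα).symm)
      refine (congrArg _ hp.deriv).trans ?_
      rw [mul_neg, mul_inv_cancel_left₀ hS]
  · have hq : HasDerivAt (fun z => qNorm z (x z) (y z) (h z) 1) _ s := hy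
    have hp : HasDerivAt (fun z => pNorm z (h z) (μ z) (α 6) 1) _ s := (hμ 1).neg
    refine ⟨hq.differentiableAt, hp.differentiableAt, ?_, ?_⟩
    · refine Eq.trans ?_ (dp_one hs₀ hh₀ hα).symm
      exact (congrArg _ hq.deriv).trans (mul_inv_cancel_left₀ hS _)
    · refine Eq.trans ?_ (congrArg Neg.neg (dq_one hs₀ hh₀ hα).symm)
      refine (congrArg _ hp.deriv).trans ?_
      rw [mul_neg, mul_inv_cancel_left₀ hS]
  · have hq := hasDerivAt_qNorm_two (x := x) (y := y) hh₀ hh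
    have hp := hasDerivAt_pNorm_two (a := α 6) hs₀ hh (hμ 2)
    refine ⟨hq.differentiableAt, hp.differentiableAt, ?_, ?_⟩
    · refine Eq.trans ?_ (dp_two hs₀ hh₀ hα).symm
      refine (congrArg _ hq.deriv).trans ?_
      have := sub_ne_zero.2 hs₁
      field_simp
    · refine Eq.trans ?_ (congrArg Neg.neg (dq_two hs₀ hh₀ hα).symm)
      refine (congrArg _ hp.deriv).trans ?_
      have := sub_ne_zero.2 hs₁
      field_simp

/-- The converse of `NormalizedODE.pvi`. The functions `h` and `μ₂` are recovered from `q₃` and `p₃`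
before they are known to be differentiable. -/
theorem normalizedODE_of_pvi {U : Set ℂ} (hU : IsOpen U) (hs : s ∈ U) (hh : ∀ z ∈ U, h z ≠ 0)
    (hU01 : ∀ z ∈ U, z ≠ 0 ∧ z ≠ 1)
    (H : CoupledPVI α U (fun z => qNorm z (x z) (y z) (h z)) (fun z => pNorm z (h z) (μ z) (α 6))) :
    NormalizedODE α x y h μ s := by
  have hα : marksSum α = 1 := H.1
  obtain ⟨hs₀, hs₁⟩ := hU01 s hs
  have hh₀ := hh s hs
  have hs₂ := sub_ne_zero.2 hs₁
  have hS : s * (s - 1) ≠ 0 := mul_ne_zero hs₀ hs₂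
  have hsolve {a b : ℂ} (e : s * (s - 1) * a = b) : a = (s * (s - 1))⁻¹ * b := by
    rw [← e, inv_mul_cancel_left₀ hS]
  have E (i : Fin 3) := H.2 s hs i
  simp only [poisson_q, poisson_p] at E
  obtain ⟨q0, p0, q0', p0'⟩ := E 0
  obtain ⟨q1, p1, q1', p1'⟩ := E 1
  obtain ⟨q2, p2, q2', p2'⟩ := E 2
  rw [dp_zero hs₀ hh₀ hα] at q0'
  rw [dp_one hs₀ hh₀ hα] at q1'
  rw [dp_two hs₀ hh₀ hα] at q2'
  rw [dq_zero hs₀ hh₀ hα] at p0'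
  rw [dq_one hs₀ hh₀ hα] at p1'
  rw [dq_two hs₀ hh₀ hα] at p2'
  have hd : DifferentiableAt ℂ h s := by
    refine ((differentiableAt_id (x := s)).div q2 (div_ne_zero hs₀ hh₀)).congr_of_eventuallyEq ?_
    filter_upwards [hU.mem_nhds hs] with z hz
    have := hh z hz
    have := (hU01 z hz).1
    simp [qNorm]
    field_simp
  have hd' : deriv h s = 1 + (s * (s - 1))⁻¹ * hDot s (x s) (y s) (h s) α (μ s) := by
    rw [(hasDerivAt_qNorm_two hh₀ hd.hasDerivAt).deriv] at q2'
    field_simp at q2' ⊢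
    linear_combination -q2'
  have hm : DifferentiableAt ℂ (fun z => μ z 2) s := by
    refine ((((p2.mul differentiableAt_id).div hd hh₀).neg.sub_const (α 6)).div hd
      hh₀).congr_of_eventuallyEq ?_
    filter_upwards [hU.mem_nhds hs] with z hz
    have := hh z hz
    have := (hU01 z hz).1
    simp [pNorm]
    field_simp
    ring
  have hm' : deriv (fun z => μ z 2) s = (s * (s - 1))⁻¹ * μDot s (x s) (y s) (h s) α (μ s) 2 := by
    rw [(hasDerivAt_pNorm_two hs₀ hd.hasDerivAt hm.hasDerivAt).deriv, hd'] at p2'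
    field_simp at p2' ⊢
    refine mul_left_cancel₀ (pow_ne_zero 2 hh₀) ?_
    linear_combination -p2'
  refine ⟨q0.hasDerivAt.congr_deriv (hsolve q0'), q1.hasDerivAt.congr_deriv (hsolve q1'),
    hd.hasDerivAt.congr_deriv hd', fun i => ?_⟩
  fin_cases i
  · have h₀ : HasDerivAt (fun z => μ z 0) _ s := p0.hasDerivAt.neg.congr_of_eventuallyEq
      (Filter.Eventually.of_forall fun z => (neg_neg (μ z 0)).symm)
    refine h₀.congr_deriv ?_
    rw [hsolve p0']
    simp
  · have h₀ : HasDerivAt (fun z => μ z 1) _ s := p1.hasDerivAt.neg.congr_of_eventuallyEq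
      (Filter.Eventually.of_forall fun z => (neg_neg (μ z 1)).symm)
    refine h₀.congr_deriv ?_
    rw [hsolve p1']
    simp
  · exact hm.hasDerivAt.congr_deriv hm'

end PVI

/-! ### From the reduced system to the linear system -/

/-- The image of the velocity of the curve commutes with the normal form. -/
theorem lie_image_coord {G : FirstGauge} {t : ℂ × ℂ} (ht : t ∈ G.T) (t' : ℂ × ℂ) :
    ⁅toG1 (G.image t t'), toG1 (G.c t).coord⁆ = 0 := by
  rw [← G.image_neg ht]
  exact G.lie_image _ _ _

section Curve

variable {G : FirstGauge} {U : Set ℂ} (hU : IsOpen U) (hU01 : ∀ s ∈ U, s ≠ 0 ∧ s ≠ 1)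
  {γ : ℂ → ℂ × ℂ} (hγ : IsSlice G U γ) {s : ℂ} (hs : s ∈ U)
include hU hU01 hγ hs

theorem curveAt : CurveAt (fun z => G.c (γ z)) s := by
  obtain ⟨t', η', ν', ht, hη, hν⟩ := hasDerivAt_curve hU hγ hs
  refine ⟨?_, (hasDerivAt_coord hU hγ hs ht hη hν).differentiableAt⟩
  filter_upwards [hU.mem_nhds hs] with z hz
  exact hγ.onSlice hU01 hz

theorem exists_image_eq {t' : ℂ × ℂ} {η' : Cartan} {ν' : Fin 3 → ℂ}
    (ht : HasDerivAt γ t' s) (hη : HasDerivAt (fun z => G.η (γ z)) η' s)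
    (hν : HasDerivAt (fun z => G.ν (γ z)) ν' s) :
    ∃ l τ : ℂ, G.image (γ s) t' = l • (G.c (γ s)).coord + τ • torus (G.c (γ s)).scale
        (kVec s ((G.c (γ s)).xCoord 0) ((G.c (γ s)).yCoord 0) ((G.c (γ s)).hCoord 0)) ∧
      -6 * τ * (s * (s - 1)) = 1 ∧ marksSum η'.root = -6 * τ * (s - 1) + 6 * l := by
  have hc := curveAt hU hU01 hγ hs
  obtain ⟨l, τ, h⟩ := hc.self.exists_of_lie_eq_zero (lie_image_coord (hγ.mem s hs) t')
  have hd := hasDerivAt_coord hU hγ hs ht hη hν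
  rw [h] at hd
  exact ⟨l, τ, h, hc.first_gauge hd⟩

end Curve

theorem Mplus_eq_toG0 (c : Coeffs) (κ : Cartan) (lam mu : Fin 3 → ℂ) :
    Mplus c κ lam mu = toG0 κ mu 0 + toG1 (lowerExp lam c.coord) := by
  rw [Mplus_eq, toPos_apply, toG0]
  simp only [Pi.zero_apply, zero_smul, Finset.sum_const_zero, add_zero, add_assoc]

/-- The right hand side of the reduced system: its component of degree two vanishes. -/
theorem lie_toG0_add_Mplus {c : Coeffs} {κ H : Cartan} {lam mu z : Fin 3 → ℂ} {L : Deg1}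
    (hL : ⁅toG1 L, toG1 c.coord⁆ = 0) :
    ⁅toG0 H z 0 + toG1 (lowerExp lam L), Mplus c κ lam mu⁆ =
      toPos (fun i => H.root (node i) * mu i - κ.root (node i) * z i,
        act H.root z 0 (lowerExp lam c.coord) - act κ.root mu 0 (lowerExp lam L)) := by
  have h₂ : ⁅toG1 (lowerExp lam L), toG1 (lowerExp lam c.coord)⁆ = 0 := by
    have h := (gaugeFlow_lowerExp lam L).isExpAd_lie (gaugeFlow_lowerExp lam c.coord)
    rw [hL] at h
    exact (GaugeFlow.of_lie_eq_zero (lie_zero _)).eq_of_isExpAd h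
  have h₃ (a : Fin 3 → ℂ) : toG0 0 a 0 = ∑ i, a i • e (node i) := by
    simp [toG0, Cartan.toG]
  rw [Mplus_eq_toG0, add_lie, lie_add, lie_add, h₂, lie_toG0_toG0, lie_toG0_toG1,
    ← lie_skew (toG1 _), lie_toG0_toG1, toPos_apply, map_sub, h₃]
  abel

theorem hasDerivG_Mplus {c : ℂ → Coeffs} {κ : Cartan} {lam mu : ℂ → Fin 3 → ℂ} {s : ℂ}
    {mu' : Fin 3 → ℂ} {m' : Deg1} (hmu : HasDerivAt mu mu' s)
    (hm : HasDerivAt (fun z => lowerExp (lam z) (c z).coord) m' s) :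
    HasDerivG (fun z => Mplus (c z) κ (lam z) (mu z)) (toPos (mu', m')) s := by
  have h := (hasDerivG_const κ.toG s).add (hasDerivG_linear toPos (hmu.prodMk hm))
  rw [zero_add] at h
  intro φ
  simp only [Mplus_eq]
  exact h φ

theorem hasDerivAt_of_hasDerivG_Mplus {c : ℂ → Coeffs} {κ : Cartan} {lam mu : ℂ → Fin 3 → ℂ} {s : ℂ}
    {mu' : Fin 3 → ℂ} {m' : Deg1}
    (h : HasDerivG (fun z => Mplus (c z) κ (lam z) (mu z)) (toPos (mu', m')) s) :
    HasDerivAt mu mu' s ∧ HasDerivAt (fun z => lowerExp (lam z) (c z).coord) m' s := by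
  obtain ⟨P, hP⟩ := exists_coord
  have h' (φ : Module.Dual ℂ AffE6) :
      HasDerivAt (fun z => φ (toPos (mu z, lowerExp (lam z) (c z).coord))) (φ (toPos (mu', m'))) s := by
    have := (h φ).sub_const (φ κ.toG)
    simpa [Mplus_eq] using this
  refine ⟨hasDerivAt_pi.2 fun i => ?_, hasDerivAt_pi.2 fun i => ?_⟩
  · have := h' (LinearMap.proj i ∘ₗ LinearMap.fst ℂ _ _ ∘ₗ P)
    simpa [hP] using this
  · have := h' (LinearMap.proj i ∘ₗ LinearMap.snd ℂ _ _ ∘ₗ P)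
    simpa [hP] using this

theorem CurveAt.differentiableAt_of_lowerExp {c : ℂ → Coeffs} {s : ℂ} (hc : CurveAt c s)
    {lam : ℂ → Fin 3 → ℂ} (h : DifferentiableAt ℂ (fun z => lowerExp (lam z) (c z).coord) s) :
    DifferentiableAt ℂ lam s := by
  have h := differentiableAt_pi.1 h
  have h₀ := differentiableAt_pi.1 hc.differentiableAt 0
  refine differentiableAt_pi.2 fun i => ?_
  fin_cases i
  · exact ((h 8).const_sub 1).congr_of_eventuallyEq (Filter.Eventually.of_forall fun z => by
      simp [lowerExp, Coeffs.coord])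
  · exact ((h 7).const_sub 1).congr_of_eventuallyEq (Filter.Eventually.of_forall fun z => by
      simp [lowerExp, Coeffs.coord])
  · exact ((h 0).sub h₀).congr_of_eventuallyEq (Filter.Eventually.of_forall fun z => by
      simp [lowerExp, Coeffs.coord])

theorem hasDerivG_toG0 {H : ℂ → Cartan} {z y : ℂ → Fin 3 → ℂ} {H' : Cartan} {z' y' : Fin 3 → ℂ} {s : ℂ}
    (hH : HasDerivAt H H' s) (hz : HasDerivAt z z' s) (hy : HasDerivAt y y' s) :
    HasDerivG (fun r => toG0 (H r) (z r) (y r)) (toG0 H' z' y') s := by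
  have h := hasDerivG_linear toG0Lin (hH.prodMk (hz.prodMk hy))
  simpa only [toG0Lin_apply] using h

theorem toG0_mem_range (H : Cartan) (z y : Fin 3 → ℂ) : toG0 H z y ∈ LinearMap.range toG0Lin :=
  ⟨(H, z, y), rfl⟩

section Curve

variable {G : FirstGauge} {U : Set ℂ} (hU : IsOpen U) (hU01 : ∀ s ∈ U, s ≠ 0 ∧ s ≠ 1)
  {γ : ℂ → ℂ × ℂ} (hγ : IsSlice G U γ) {s : ℂ} (hs : s ∈ U)
include hU hγ hs

/-- The operator `𝓑⁺` has no component along the `f_i`, and its component of degree one is the image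
of `Λ₁ dt₁/ds + Λ₂ dt₂/ds`. -/
theorem exists_of_isReducedOperator {θ κ : Cartan} {lam mu : ℂ → Fin 3 → ℂ} {B : AffE6}
    {t' : ℂ × ℂ} (ht : HasDerivAt γ t' s) (hlam : DifferentiableAt ℂ lam s)
    (h : IsReducedOperator θ G γ κ lam mu s B) : ∃ (H : Cartan) (z : Fin 3 → ℂ),
      B = (s * (s - 1)) • (toG0 H z 0 + toG1 (lowerExp (lam s) (G.image (γ s) t'))) := by
  obtain ⟨U₁, U₂, t'', dΓ₁, dΓ₂, Mstar, Bstar, Bplus, ht', -, -, -, hΓ₁, hB₁, hΓ₂, hB₂, hb, rfl⟩ := h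
  obtain rfl := ht'.unique ht
  obtain ⟨-, η', ν', -, hη, hν⟩ := hasDerivAt_curve hU hγ hs
  obtain rfl : dΓ₁ = toG0 η' ν' 0 := by
    refine hΓ₁.unique ?_
    simp only [G.Γ₁_eq]
    exact hasDerivG_toG0 hη hν (hasDerivAt_const s 0)
  obtain rfl : dΓ₂ = toG0 0 0 (deriv lam s) := by
    refine hΓ₂.unique ?_
    simp only [Γ₂_eq]
    exact hasDerivG_toG0 (hasDerivAt_const s 0) (hasDerivAt_const s 0) hlam.hasDerivAt
  have h₁ := hB₁.sub (G.gaugeFlow_image (γ s) t'').isGaugeTransform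
  have e₁ : t''.1 • (U₁.toG + Λ₁) + t''.2 • (U₂.toG + Λ₂) - (t''.1 • Λ₁ + t''.2 • Λ₂) =
      t''.1 • U₁.toG + t''.2 • U₂.toG := by module
  rw [e₁, G.Γ₁_eq] at h₁
  have m₁ := h₁.mem (lie_toG0_mem_range _ _ _) (derZero_le_range (add_mem
    (derZero.smul_mem _ U₁.toG_mem) (derZero.smul_mem _ U₂.toG_mem))) (toG0_mem_range _ _ _)
  rw [Γ₂_eq] at hB₂
  have h₂ := hB₂.sub (gaugeFlow_lowerExp (lam s) (G.image (γ s) t'')).isGaugeTransform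
  obtain ⟨⟨H, z, y⟩, h₃⟩ := h₂.mem (lie_toG0_mem_range _ _ _) m₁ (toG0_mem_range _ _ _)
  rw [toG0Lin_apply, eq_sub_iff_add_eq] at h₃
  dsimp only at h₃
  rw [← h₃] at hb
  obtain rfl := eq_zero_of_mem_borel hb
  exact ⟨H, z, by rw [h₃]⟩

include hU01 in
/-- A solution of the reduced system solves the linear system. -/
theorem linear_system_of_reduced {θ κ : Cartan} {lam mu : ℂ → Fin 3 → ℂ} {t' : ℂ × ℂ} {B M' : AffE6}
    (ht : HasDerivAt γ t' s) (h : IsReducedOperator θ G γ κ lam mu s B)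
    (hM : HasDerivG (fun z => Mplus (G.c (γ z)) κ (lam z) (mu z)) M' s)
    (hode : (s * (s - 1)) • M' - ⁅B, Mplus (G.c (γ s)) κ (lam s) (mu s)⁆ = 0) :
    ∃ (ζ : Fin 7 → ℂ) (z lam' : Fin 3 → ℂ), HasDerivAt lam lam' s ∧
      HasDerivAt (fun z => lowerExp (lam z) (G.c (γ z)).coord)
        (act ζ z 0 (lowerExp (lam s) (G.c (γ s)).coord) - act κ.root (mu s) 0
          (lowerExp (lam s) (G.image (γ s) t'))) s ∧
      HasDerivAt mu (fun i => ζ (node i) * mu s i - κ.root (node i) * z i) s := by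
  have hc := curveAt hU hU01 hγ hs
  have hS : s * (s - 1) ≠ 0 := mul_ne_zero (hU01 s hs).1 (sub_ne_zero.2 (hU01 s hs).2)
  -- The derivative of `𝓜⁺` lies in the span of the `e_i` and of the component of degree one, as
  -- `κ` is constant, so that it may be read off in coordinates.
  have hlam : DifferentiableAt ℂ lam s := by
    obtain ⟨P, hP⟩ := exists_coord
    refine hc.differentiableAt_of_lowerExp (differentiableAt_pi.2 fun i => ?_)
    have := ((hM (LinearMap.proj i ∘ₗ LinearMap.snd ℂ _ _ ∘ₗ P)).sub_const
      ((P κ.toG).2 i)).differentiableAt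
    simpa [Mplus_eq, hP] using this
  obtain ⟨H, z, rfl⟩ := exists_of_isReducedOperator hU hγ hs ht hlam h
  rw [smul_lie, ← smul_sub, smul_eq_zero, or_iff_right hS, sub_eq_zero,
    lie_toG0_add_Mplus (lie_image_coord (hγ.mem s hs) t')] at hode
  rw [hode] at hM
  obtain ⟨h₁, h₂⟩ := hasDerivAt_of_hasDerivG_Mplus hM
  exact ⟨H.root, z, _, hlam.hasDerivAt, h₂, h₁⟩

end Curve

/-! ### From the linear system to the reduced system -/

theorem eq_zero_of_isExpAd_zero {Γ a : AffE6} (S : Submodule ℂ AffE6) [FiniteDimensional ℂ S]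
    (hS : ∀ x ∈ S, ⁅Γ, x⁆ ∈ S) (ha : a ∈ S) (h : IsExpAd Γ a 0) : a = 0 := by
  obtain ⟨y, -, hy⟩ := exists_gaugeFlow S hS ha
  obtain rfl := hy.eq_of_isExpAd h
  exact (GaugeFlow.of_lie_eq_zero (lie_zero _)).eq_of_isExpAd hy.symm.isExpAd

theorem GaugeFlow.isExpAd_of_zero {Γ x y : AffE6} (h : GaugeFlow Γ (0 + 0 + 0) x y) :
    IsExpAd Γ x y := by
  rw [add_zero, add_zero] at h
  exact h.isExpAd

theorem IsExpAd.add {Γ x y x' y' : AffE6} (h : IsExpAd Γ x y) (h' : IsExpAd Γ x' y') :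
    IsExpAd Γ (x + x') (y + y') := fun φ => by
  simpa only [map_add, smul_add] using (h φ).add (h' φ)

theorem lie_mem_range_toG1 {x v : AffE6} (hx : x ∈ LinearMap.range toG0Lin)
    (hv : v ∈ LinearMap.range toG1) : ⁅x, v⁆ ∈ LinearMap.range toG1 := by
  obtain ⟨⟨H, z, y⟩, rfl⟩ := hx
  obtain ⟨v, rfl⟩ := hv
  exact ⟨_, (lie_toG0_toG1 H z y v).symm⟩

theorem eq_zero_of_isExpAd_toG0 {H : Cartan} {z y : Fin 3 → ℂ} {a : AffE6}
    (ha : a ∈ LinearMap.range toG1) (h : IsExpAd (toG0 H z y) a 0) : a = 0 :=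
  eq_zero_of_isExpAd_zero _ (fun _ hx => lie_mem_range_toG1 (toG0_mem_range H z y) hx) ha h

theorem IsGrading.lie_toG {θ : Cartan} (hθ : IsGrading θ) (H : Cartan) (z y : Fin 3 → ℂ) :
    ⁅toG0 H z y, θ.toG⁆ = 0 := by
  have h (i : Fin 3) : θ.root (node i) = 0 := by
    rw [hθ.root_eq]; fin_cases i <;> rfl
  have he (i : Fin 3) : ⁅e (node i), θ.toG⁆ = 0 := by
    rw [← lie_skew, lie_toG_e, ← Cartan.root.eq_1, h, zero_smul, neg_zero]
  have hf (i : Fin 3) : ⁅f (node i), θ.toG⁆ = 0 := by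
    rw [← lie_skew, lie_toG_f, ← Cartan.root.eq_1, h, neg_zero, zero_smul, neg_zero]
  simp [toG0, lie_toG_toG, sum_lie, he, hf]

theorem Cartan.marksSum_root (H : Cartan) : marksSum H.root = H.2 := H.sum_root

theorem IsGrading.snd_eq {θ : Cartan} (hθ : IsGrading θ) : θ.2 = 6 := by
  rw [← θ.marksSum_root, hθ.root_eq]
  simp [marksSum, gradRoot]
  norm_num

theorem toG0_sub (H K : Cartan) (z y z' y' : Fin 3 → ℂ) :
    toG0 H z y - toG0 K z' y' = toG0 (H - K) (z - z') (y - y') :=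
  (toG0Lin.map_sub (H, z, y) (K, z', y')).symm

theorem toG0_smul (r : ℂ) (H : Cartan) (z y : Fin 3 → ℂ) :
    toG0 (r • H) (r • z) (r • y) = r • toG0 H z y :=
  toG0Lin.map_smul r (H, z, y)

theorem Cartan.toG_eq (H : Cartan) : H.toG = toG0 H 0 0 := by simp [toG0]

theorem lowerExp_sub (l : Fin 3 → ℂ) (u v : Deg1) :
    lowerExp l (u - v) = lowerExp l u - lowerExp l v := by
  funext i
  rw [Pi.sub_apply]
  fin_cases i <;> simp [lowerExp] <;> ring

/-- Along the curve, the two times and their derivatives are linearly independent: otherwise the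
image of the velocity would be proportional to the normal form, whose last coordinate vanishes. -/
theorem det_ne_zero {G : FirstGauge} {t t' : ℂ × ℂ} (ht : t ∈ G.T) {L₁₃ : ℂ} (hL : L₁₃ ≠ 0)
    (h : G.image t t' 13 = L₁₃) : t.1 * t'.2 - t.2 * t'.1 ≠ 0 := by
  intro hD
  have hN := G.image_neg ht
  have key (r r' : ℂ) (e : r • t' = r' • t) : r = 0 := by
    have e' : r • G.image t t' = (-r') • (G.c t).coord := by
      rw [← hN]
      simp only [FirstGauge.image, ← firstExp_smul]
      congr 1
      have e₁ : r * t'.1 = r' * t.1 := congrArg Prod.fst e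
      have e₂ : r * t'.2 = r' * t.2 := congrArg Prod.snd e
      simp only [smul_add, smul_smul, e₁, e₂, Prod.fst_neg, Prod.snd_neg]
      congr 2 <;> ring
    have := congrFun e' 13
    simp [h, Coeffs.coord] at this
    exact this.resolve_right hL
  have h₁ : t.1 = 0 := key t.1 t'.1 (Prod.ext (mul_comm _ _) (by
    simp only [Prod.smul_snd, smul_eq_mul]; linear_combination hD))
  have h₂ : t.2 = 0 := key t.2 t'.2 (Prod.ext (by
    simp only [Prod.smul_fst, smul_eq_mul]; linear_combination -hD) (mul_comm _ _))
  have h₃ : G.image t (-t) = 0 := by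
    have : firstExp (G.η t).root (G.ν t) 0 = 0 := by
      have := firstExp_smul (G.η t).root (G.ν t) 0 0
      rwa [zero_smul, zero_smul] at this
    simp [FirstGauge.image, h₁, h₂, this]
  rw [h₃] at hN
  have := congrFun hN 1
  simp [Coeffs.coord] at this

/-- The degree one part of the zero curvature equation, after both gauge transformations, is the
degree one part of the evolution of `𝓜⁺`. -/
theorem zero_curvature_of_gauge {θ κ H : Cartan} (hθ : IsGrading θ) {G : FirstGauge} {t t' : ℂ × ℂ}
    (ht : t ∈ G.T) {η' : Cartan} {lam mu z lam' A : Fin 3 → ℂ} {X W y₁ y₂ : AffE6}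
    {x : ℂ} (hW : GaugeFlow (G.Γ₁ t) 0 (-W) y₁)
    (hy₁ : GaugeFlow (toG0 0 0 lam) 0 y₁ (toG0 (κ - θ) mu 0))
    (hX : GaugeFlow (G.Γ₁ t) 0 X (y₂ + x • θ.toG - toG0 η' A 0))
    (hy₂ : GaugeFlow (toG0 0 0 lam) 0 y₂ (toG0 (H - x • θ) z (-lam')))
    (hXm : X ∈ derZero) (hWm : W ∈ derZero) (hy₁m : y₁ ∈ derZero) (hy₂m : y₂ ∈ derZero)
    (hM : lowerExp lam (act η'.root A 0 (G.c t).coord - G.image t t') +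
      act 0 0 lam' (lowerExp lam (G.c t).coord) = act H.root z 0 (lowerExp lam (G.c t).coord) -
      act κ.root mu 0 (lowerExp lam (G.image t t'))) :
    ⁅X, -(t.1 • Λ₁ + t.2 • Λ₂)⁆ - ⁅t'.1 • Λ₁ + t'.2 • Λ₂, W⁆ = 0 := by
  have hr := derZero_le_range
  have hΛ (a : ℂ × ℂ) : a.1 • Λ₁ + a.2 • Λ₂ ∈ LinearMap.range toG1 := ⟨_, toG1_comb a⟩
  have hmem : ⁅X, -(t.1 • Λ₁ + t.2 • Λ₂)⁆ + ⁅-W, -(t'.1 • Λ₁ + t'.2 • Λ₂)⁆ ∈ LinearMap.range toG1 :=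
    add_mem (lie_mem_range_toG1 (hr hXm) (neg_mem (hΛ t)))
      (lie_mem_range_toG1 (hr (neg_mem hWm)) (neg_mem (hΛ t')))
  have hN : GaugeFlow (G.Γ₁ t) 0 (-(t.1 • Λ₁ + t.2 • Λ₂)) (toG1 (G.c t).coord) := by
    have := G.gaugeFlow_image t (-t)
    rw [G.image_neg ht] at this
    convert this using 1
    simp only [Prod.fst_neg, Prod.snd_neg]
    module
  have hL : GaugeFlow (G.Γ₁ t) 0 (-(t'.1 • Λ₁ + t'.2 • Λ₂)) (-toG1 (G.image t t')) := by
    have h := (G.gaugeFlow_image t t').const_smul (-1)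
    rwa [smul_zero, neg_one_smul, neg_one_smul] at h
  have h₁ := (hX.isExpAd_lie hN).add (hW.isExpAd_lie hL)
  set N := (G.c t).coord
  set L := G.image t t'
  have e₁ : ⁅y₂ + x • θ.toG - toG0 η' A 0, toG1 N⁆ + ⁅y₁, -toG1 L⁆ = ⁅y₂ + x • θ.toG, toG1 N⁆ +
      ⁅y₁, -toG1 L⁆ + toG1 (-(act η'.root A 0 N)) := by
    rw [sub_lie, lie_toG0_toG1, map_neg]
    abel
  have hθx : x • θ.toG ∈ LinearMap.range toG0Lin :=
    Submodule.smul_mem _ _ (by rw [Cartan.toG_eq]; exact toG0_mem_range _ _ _)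
  have hmem₂ : ⁅y₂ + x • θ.toG, toG1 N⁆ + ⁅y₁, -toG1 L⁆ + toG1 (-(act η'.root A 0 N)) ∈
      LinearMap.range toG1 :=
    add_mem (add_mem (lie_mem_range_toG1 (add_mem (hr hy₂m) hθx) ⟨N, rfl⟩)
      (lie_mem_range_toG1 (hr hy₁m) (neg_mem ⟨L, rfl⟩))) ⟨_, rfl⟩
  have hθ₂ : GaugeFlow (toG0 0 0 lam) 0 (x • θ.toG) (x • θ.toG) := by
    refine GaugeFlow.of_lie_eq_zero ?_
    rw [lie_smul, hθ.lie_toG, smul_zero]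
  have hy₂' := hy₂.add hθ₂
  rw [zero_add] at hy₂'
  have hL₂ : GaugeFlow (toG0 0 0 lam) 0 (-toG1 L) (-toG1 (lowerExp lam L)) := by
    have h := (gaugeFlow_lowerExp lam L).const_smul (-1)
    rwa [smul_zero, neg_one_smul, neg_one_smul] at h
  have h₂ := ((hy₂'.isExpAd_lie (gaugeFlow_lowerExp lam N)).add (hy₁.isExpAd_lie hL₂)).add
    (gaugeFlow_lowerExp lam (-(act η'.root A 0 N))).isExpAd
  have e₂ : toG0 (H - x • θ) z (-lam') + x • θ.toG = toG0 H z (-lam') := by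
    rw [Cartan.toG_eq, ← toG0_smul, ← sub_neg_eq_add, neg_toG0, toG0_sub]
    simp
  have e₃ : ⁅toG0 H z (-lam'), toG1 (lowerExp lam N)⁆ + ⁅toG0 (κ - θ) mu 0, -toG1 (lowerExp lam L)⁆ +
      toG1 (lowerExp lam (-(act η'.root A 0 N))) = 0 := by
    rw [lie_neg, lie_toG0_toG1, lie_toG0_toG1, ← map_neg, ← map_add, ← map_add]
    refine (congrArg toG1 ?_).trans (map_zero toG1)
    have hκ : act (κ - θ).root mu 0 (lowerExp lam L) = act κ.root mu 0 (lowerExp lam L) -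
        lowerExp lam L := by
      have h₀ : κ.root = (κ - θ).root + gradRoot := by
        rw [← hθ.root_eq, ← Cartan.root_add, sub_add_cancel]
      have := act_add (κ - θ).root gradRoot mu 0 0 0 (lowerExp lam L)
      rw [act_gradRoot, add_zero, add_zero, ← h₀] at this
      rw [this, add_sub_cancel_right]
    have hH : act H.root z (-lam') (lowerExp lam N) = act H.root z 0 (lowerExp lam N) -
        act 0 0 lam' (lowerExp lam N) := by
      rw [eq_sub_iff_add_eq, ← act_add, add_zero, add_zero, neg_add_cancel]
    have hneg (v : Deg1) : lowerExp lam (-v) = -lowerExp lam v := by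
      rw [← neg_one_smul ℂ, lowerExp_smul, neg_one_smul]
    rw [lowerExp_sub] at hM
    rw [hκ, hH, hneg]
    linear_combination (norm := module) -hM
  rw [e₂, e₃] at h₂
  rw [e₁, eq_zero_of_isExpAd_toG0 hmem₂ h₂, G.Γ₁_eq] at h₁
  rw [← eq_zero_of_isExpAd_toG0 hmem h₁, neg_lie, lie_neg W, neg_neg, ← lie_skew W,
    sub_eq_add_neg]

section Curve

variable {G : FirstGauge} {U : Set ℂ} (hU : IsOpen U) {γ : ℂ → ℂ × ℂ} (hγ : IsSlice G U γ) {s : ℂ} (hs : s ∈ U)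
include hU hγ hs

/-- A solution of the linear system solves the reduced system: the operators `U₁, U₂` are recovered
by inverting the two gauge transformations. -/
theorem reduced_of_linear_system {θ κ : Cartan} (hθ : IsGrading θ) (hκ : κ.2 = 6)
    {lam mu : ℂ → Fin 3 → ℂ} {t' : ℂ × ℂ} {η' : Cartan} {ν' : Fin 3 → ℂ} (ht : HasDerivAt γ t' s)
    (hη : HasDerivAt (fun z => G.η (γ z)) η' s) (hν : HasDerivAt (fun z => G.ν (γ z)) ν' s)
    (h13 : G.image (γ s) t' 13 ≠ 0) {ζ : Fin 7 → ℂ} {z lam' : Fin 3 → ℂ}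
    (hζ : marksSum ζ = η'.2) (hlam : HasDerivAt lam lam' s)
    (hM : HasDerivAt (fun z => lowerExp (lam z) (G.c (γ z)).coord)
      (act ζ z 0 (lowerExp (lam s) (G.c (γ s)).coord) - act κ.root (mu s) 0
        (lowerExp (lam s) (G.image (γ s) t'))) s)
    (hmu : HasDerivAt mu (fun i => ζ (node i) * mu s i - κ.root (node i) * z i) s) :
    ∃ B M' : AffE6, IsReducedOperator θ G γ κ lam mu s B ∧
      HasDerivG (fun z => Mplus (G.c (γ z)) κ (lam z) (mu z)) M' s ∧
      (s * (s - 1)) • M' - ⁅B, Mplus (G.c (γ s)) κ (lam s) (mu s)⁆ = 0 := by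
  have hcoord := hasDerivAt_coord hU hγ hs ht hη hν
  have hT := hγ.mem s hs
  have hM' := (hasDerivAt_lowerExp hlam hcoord).unique hM
  set t := γ s with htdef
  set A := firstLogDeriv (G.η t).root (G.ν t) η'.root ν'
  set L := G.image t t' with hL
  obtain ⟨H, rfl⟩ : ∃ H : Cartan, H.root = ζ := ⟨ofRoot ζ, root_ofRoot ζ⟩
  rw [Cartan.marksSum_root] at hζ
  have hθ6 := hθ.snd_eq
  let x : ℂ := H.2 / 6
  have hx : x * 6 = H.2 := div_mul_cancel₀ _ (by norm_num)
  have hΓ₁ := G.Γ₁_eq t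
  -- The degree zero parts are transported backwards through the two gauge transformations; the
  -- multiples of `ϑ`, which commutes with both gauge parameters, carry the component along `d`.
  obtain ⟨y₁, hy₁m, hy₁⟩ := exists_gaugeFlow_derZero' 0 0 (lam s)
    (toG0_mem (H := κ - θ) (by simp [hκ, hθ6]) (mu s) 0)
  obtain ⟨W', hWm, hW⟩ := exists_gaugeFlow_derZero' (G.η t) (G.ν t) 0 hy₁m
  obtain ⟨W, rfl⟩ : ∃ W, -W = W' := ⟨-W', neg_neg W'⟩
  replace hWm : W ∈ derZero := by simpa using neg_mem hWm
  obtain ⟨y₂, hy₂m, hy₂⟩ := exists_gaugeFlow_derZero' 0 0 (lam s)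
    (toG0_mem (H := H - x • θ) (by simp [hθ6, hx]) z (-lam'))
  have hYm : y₂ + x • θ.toG - toG0 η' A 0 ∈ derZero := by
    have e₁ : x • θ.toG - toG0 η' A 0 = toG0 (x • θ - η') (-A) 0 := by
      rw [Cartan.toG_eq, ← toG0_smul, toG0_sub]
      simp
    rw [add_sub_assoc, e₁]
    exact add_mem hy₂m (toG0_mem (by simp [hθ6, hx, hζ]) _ _)
  obtain ⟨X, hXm, hX⟩ := exists_gaugeFlow_derZero' (G.η t) (G.ν t) 0 hYm
  rw [← hΓ₁] at hW hX
  have hzc := zero_curvature_of_gauge hθ hT hW hy₁ hX hy₂ hXm hWm hy₁m hy₂m hM'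
  have hD := det_ne_zero hT h13 rfl
  set D := t.1 * t'.2 - t.2 * t'.1 with hDdef
  obtain ⟨U₁, hU₁⟩ := exists_degZero (derZero.smul_mem D⁻¹
    (sub_mem (derZero.smul_mem t'.2 hWm) (derZero.smul_mem t.2 hXm)))
  obtain ⟨U₂, hU₂⟩ := exists_degZero (derZero.smul_mem D⁻¹
    (sub_mem (derZero.smul_mem t.1 hXm) (derZero.smul_mem t'.1 hWm)))
  have hUW : t.1 • U₁.toG + t.2 • U₂.toG = W := by
    have : t.1 • U₁.toG + t.2 • U₂.toG = (D⁻¹ * D) • W := by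
      rw [hU₁, hU₂, hDdef]; module
    rw [this, inv_mul_cancel₀ hD, one_smul]
  have hUX : t'.1 • U₁.toG + t'.2 • U₂.toG = X := by
    have : t'.1 • U₁.toG + t'.2 • U₂.toG = (D⁻¹ * D) • X := by
      rw [hU₁, hU₂, hDdef]; module
    rw [this, inv_mul_cancel₀ hD, one_smul]
  have hθ₁ : GaugeFlow (G.Γ₁ t) 0 θ.toG θ.toG := by
    rw [hΓ₁]; exact .of_lie_eq_zero (hθ.lie_toG _ _ _)
  have hθ₂ : GaugeFlow (toG0 0 0 (lam s)) 0 θ.toG θ.toG := .of_lie_eq_zero (hθ.lie_toG _ _ _)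
  have hN : GaugeFlow (G.Γ₁ t) 0 ((-t).1 • Λ₁ + (-t).2 • Λ₂) (toG1 (G.c t).coord) := by
    rw [← G.image_neg hT]; exact G.gaugeFlow_image t (-t)
  refine ⟨_, toPos (fun i => H.root (node i) * mu s i - κ.root (node i) * z i, _),
    ⟨U₁, U₂, t', toG0 η' ν' 0, toG0 0 0 lam', θ.toG + y₁ + toG1 (G.c t).coord,
      y₂ + x • θ.toG + toG1 L, toG0 H z 0 + toG1 (lowerExp (lam s) L), ht, ?_, ?_, ?_, ?_, ?_, ?_, ?_,
      toG0_add_toG1_mem_borel _ _ _, rfl⟩, hasDerivG_Mplus hmu hM, ?_⟩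
  · have e₁ : ⁅Λ₁, U₂.toG⁆ - ⁅Λ₂, U₁.toG⁆ =
        D⁻¹ • (⁅X, -(t.1 • Λ₁ + t.2 • Λ₂)⁆ - ⁅t'.1 • Λ₁ + t'.2 • Λ₂, W⁆) := by
      rw [hU₁, hU₂, ← lie_skew X]
      simp only [lie_smul, lie_sub, neg_lie, add_lie, smul_lie, neg_neg]
      module
    rw [e₁, hzc, smul_zero]
  · have h := ((hθ₁.add hW).add hN).isExpAd_of_zero
    convert h using 1
    rw [← hUW]
    simp only [Prod.fst_neg, Prod.snd_neg]
    module
  · rw [Γ₂_eq]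
    have h := ((hθ₂.add hy₁).add (gaugeFlow_lowerExp (lam s) (G.c t).coord)).isExpAd_of_zero
    convert h using 1
    rw [Mplus_eq_toG0, Cartan.toG_eq, ← sub_neg_eq_add (toG0 θ 0 0), neg_toG0, toG0_sub]
    simp [htdef]
  · simp only [G.Γ₁_eq]
    exact hasDerivG_toG0 hη hν (hasDerivAt_const s 0)
  · have h := (hX.add (hΓ₁ ▸ gaugeFlow_firstLogDeriv (G.η t) η' (G.ν t) ν')).add
      (G.gaugeFlow_image t t')
    rw [zero_add, add_zero, add_zero, sub_add_cancel] at h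
    convert h.isGaugeTransform using 1
    rw [← hUX]
    module
  · simp only [Γ₂_eq]
    exact hasDerivG_toG0 (hasDerivAt_const s 0) (hasDerivAt_const s 0) hlam
  · rw [Γ₂_eq]
    have h := ((hy₂.add (hθ₂.const_smul x)).add (gaugeFlow_lower (lam s) lam')).add
      (gaugeFlow_lowerExp (lam s) L)
    rw [smul_zero, zero_add, zero_add, add_zero, add_zero] at h
    convert h.isGaugeTransform using 1
    congr 1
    rw [Cartan.toG_eq, ← toG0_smul, ← sub_neg_eq_add, ← sub_neg_eq_add, neg_toG0, neg_toG0, toG0_sub,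
      toG0_sub]
    simp
  · rw [smul_lie, lie_toG0_add_Mplus (lie_image_coord hT t'), sub_self]

end Curve

/-! ### The normalized parameters -/

theorem marksSum_param (κ : Cartan) : marksSum (param κ) = κ.2 / 6 := by
  rw [← κ.marksSum_root]
  simp only [marksSum, param, Cartan.root]
  ring

theorem root_eq_smul_param (κ : Cartan) : κ.root = (6 : ℂ) • param κ := by
  funext i
  simp only [Pi.smul_apply, smul_eq_mul, param, Cartan.root]
  ring

end E6Painleve

open E6Painleve in
theorem mainTheorem2 (θ : E6Painleve.Cartan) (hθ : E6Painleve.IsGrading θ) (G : E6Painleve.FirstGauge)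
    (U : Set ℂ) (hU : IsOpen U) (hUne : U.Nonempty) (hU01 : ∀ s ∈ U, s ≠ 0 ∧ s ≠ 1)
    (γ : ℂ → ℂ × ℂ) (hγ : E6Painleve.IsSlice G U γ) (κ : E6Painleve.Cartan) :
    (∀ s ∈ U,
      Set.BijOn
        (fun x : (Fin 3 → ℂ) × (Fin 3 → ℂ) =>
          (E6Painleve.qVar (G.c (γ s)) x.1, E6Painleve.pVar (G.c (γ s)) κ x.1 x.2))
        {x | 1 + (G.c (γ s)).c3 + (G.c (γ s)).c63 * x.1 2 ≠ 0}
        {y | y.1 2 ≠ 0}) ∧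
    ∀ lam mu : ℂ → Fin 3 → ℂ,
      (∀ s ∈ U, 1 + (G.c (γ s)).c3 + (G.c (γ s)).c63 * lam s 2 ≠ 0) →
      (E6Painleve.ReducedODE θ G γ κ U lam mu ↔
        E6Painleve.CoupledPVI (E6Painleve.param κ) U
          (fun s => E6Painleve.qVar (G.c (γ s)) (lam s))
          (fun s => E6Painleve.pVar (G.c (γ s)) κ (lam s) (mu s))) := by
  have hc (s : ℂ) (hs : s ∈ U) := curveAt hU hU01 hγ hs
  refine ⟨fun s hs => (hc s hs).self.bijOn κ, fun lam mu hne => ?_⟩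
  have hq (s : ℂ) (hs : s ∈ U) := (hc s hs).self.qVar_eq (lam s)
  have hp (s : ℂ) (hs : s ∈ U) := (hc s hs).self.pVar_eq κ (lam s) (mu s)
  have hh (s : ℂ) (hs : s ∈ U) := (hc s hs).self.hCoord_ne (hne s hs)
  have hlower {s : ℂ} (hs : s ∈ U) {l τ : ℂ} {t' : ℂ × ℂ}
      (h : G.image (γ s) t' = l • (G.c (γ s)).coord + τ • torus (G.c (γ s)).scale
        (kVec s ((G.c (γ s)).xCoord 0) ((G.c (γ s)).yCoord 0) ((G.c (γ s)).hCoord 0))) :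
      lowerExp (lam s) (G.image (γ s) t') = l • lowerExp (lam s) (G.c (γ s)).coord +
        τ • torus (G.c (γ s)).scale (kVec s ((G.c (γ s)).xCoord (lam s))
          ((G.c (γ s)).yCoord (lam s)) ((G.c (γ s)).hCoord (lam s))) := by
    rw [h, lowerExp_add, lowerExp_smul, lowerExp_smul, (hc s hs).self.lowerExp_torus_kVec]
  have hT {s τ : ℂ} (h : -6 * τ * (s * (s - 1)) = 1) : (s * (s - 1))⁻¹ = -6 * τ :=
    (eq_inv_of_mul_eq_one_left h).symm
  constructor
  -- A solution of the reduced system satisfies the linear system at each time, hence the evolution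
  -- equations of the normalized coordinates.
  · intro H
    have key (s : ℂ) (hs : s ∈ U) : marksSum (param κ) = 1 ∧
        NormalizedODE (param κ) (fun z => (G.c (γ z)).xCoord (lam z))
          (fun z => (G.c (γ z)).yCoord (lam z)) (fun z => (G.c (γ z)).hCoord (lam z))
          (fun z => (G.c (γ z)).μCoord (mu z)) s := by
      obtain ⟨B, M', hB, hM, hode⟩ := H s hs
      obtain ⟨t', η', ν', ht, hη, hν⟩ := hasDerivAt_curve hU hγ hs
      obtain ⟨l, τ, hL, hτ, -⟩ := exists_image_eq hU hU01 hγ hs ht hη hν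
      obtain ⟨ζ, z, lam', hlam, hm, hmu⟩ := linear_system_of_reduced hU hU01 hγ hs ht hB hM hode
      rw [hlower hs hL, root_eq_smul_param] at hm
      rw [root_eq_smul_param] at hmu
      obtain ⟨h₁, h₂⟩ := (hc s hs).linear_system_imp hτ hlam hm hmu
      refine ⟨h₁, ?_⟩
      rw [NormalizedODE, hT hτ]
      exact h₂
    obtain ⟨s₀, hs₀⟩ := hUne
    refine CoupledPVI.congr hU hq hp ⟨(key s₀ hs₀).1, fun s hs i => ?_⟩
    exact (key s hs).2.pvi (key s hs).1 (hU01 s hs).1 (hU01 s hs).2 (hh s hs) i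
  -- Conversely the linear system holds at each time, and its solution has the component along `d`
  -- which is needed to invert the gauge transformations.
  · intro H s hs
    obtain ⟨h₁, h₂, h₃, h₄⟩ := normalizedODE_of_pvi hU hs hh hU01
      (H.congr hU (fun s hs => (hq s hs).symm) fun s hs => (hp s hs).symm)
    have hα : marksSum (param κ) = 1 := H.1
    obtain ⟨t', η', ν', ht, hη, hν⟩ := hasDerivAt_curve hU hγ hs
    obtain ⟨l, τ, hL, hτ, hw⟩ := exists_image_eq hU hU01 hγ hs ht hη hν
    rw [hT hτ] at h₁ h₂ h₃ h₄
    obtain ⟨ζ, z, lam', hζ, hlam, hm, hmu⟩ :=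
      (hc s hs).linear_system_of (l := l) hτ hα h₁ h₂ h₃ h₄
    rw [← hlower hs hL, ← root_eq_smul_param] at hm
    rw [← root_eq_smul_param] at hmu
    have hκ : κ.2 = 6 := by
      rw [marksSum_param] at hα
      exact (div_eq_one_iff_eq (by norm_num)).1 hα
    -- The last coordinate is nonzero because that of `kVec` is `1` and `τ ≠ 0`.
    have h13 : G.image (γ s) t' 13 ≠ 0 := by
      have hsc := (hc s hs).self.scale_ne
      have hτ₀ : τ ≠ 0 := by
        rintro rfl
        simp at hτ
      rw [hL]
      simp [Coeffs.coord, torus, kVec, hsc, hτ₀]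
    rw [← hw, η'.marksSum_root] at hζ
    exact reduced_of_linear_system hU hγ hs hθ hκ ht hη hν h13 hζ hlam hm hmu
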